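/- **Setting.** Let $k$ be an infinite field, $V=k^n$, and let $\mathbf b=(b_1,\dots,b_q)$, $\mathbf c=(c_1,\dots,c_r)$ be compositions of $n$ (lists of positive integers with sum $n$). $\mathrm{Flag}(\mathbf b)$ is the variety of partial flags $0=B_0\subset B_1\subset\cdots\subset B_q=V$ with $\dim B_i/B_{i-1}=b_i$; similarly $\mathrm{Flag}(\mathbf c)$. A *decorated matrix* $(M,\Delta)$ consists of a $q\times r$ matrix $M=(m_{ij})$ of nonnegative integers with row sums $b_i$ and column sums $c_j$, and a nonempty set of positions $\Delta=\{(i_1,j_1),\dots,(i_t,j_t)\}$ with $i_1<\cdots<i_t$, $j_1>\cdots>j_t$ and $m_{ij}>0$ for all $(i,j)\in\Delta$. Its orbit $F_{M,\Delta}\subset\mathbb P(V)\times\mathrm{Flag}(\mathbf b)\times\mathrm{Flag}(\mathbf c)$ is the set of all triples $(A,B_\bullet,C_\bullet)$ for which there is a basis $\{v_{ijl}\mid 1\le l\le m_{ij}\}$ of $V$ with $$B_i=\langle v_{i'jl}\mid i'\le i\rangle,\qquad C_j=\langle v_{ij'l}\mid j'\le j\rangle,\qquad A=\Big\langle \sum_{(i,j)\in\Delta}v_{ij1}\Big\rangle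 .$$ The *degeneration order* is defined by: $(M,\Delta)\overset{\rm deg}{\le}(M',\Delta')$ if and only if $F_{M,\Delta}\subset\overline{F_{M',\Delta'}}$ (Zariski closure). **Simple moves.** Order positions by $(i,j)\le(i',j')\iff i\le i'$ and $j\le j'$, and let $<$ mean $\le$ and $\ne$. Write $(i,j)\le\Delta$ if $(i,j)\le(i',j')$ for some $(i',j')\in\Delta$. For a set $S$ of positions let $[S]$ be the set of its $\le$-maximal elements. Let $E_{ij}$ be the coordinate matrices. A simple move $(M,\Delta)\to(M',\Delta')$ is one of the following. (i) For some $(i_1,j_1)\not\le\Delta$ with $m_{i_1j_1}>0$, and $m_{ij}=0$ whenever $(i,j)<(i_1,j_1)$ and $(i,j)\not\le\Delta$: $M'=M$, $\Delta'=[\Delta\cup\{(i_1,j_1)\}]$. In (ii), (iii), (iv)(b) and (iv)(c) we have $i_0<i_1$, $j_0<j_1$, $m_{i_0j_0}>0$, $m_{i_1j_1}>0$ and $M'=M-E_{i_0j_0}-E_{i_1j_1}+E_{i_0j_1}+E_{i_1j_0}$. (ii) $m_{ij}=0$ whenever $(i_0,j_0)<(i,j)<(i_1,j_1)$ and $(i,j)\ne(i_0,j_1),(i_1,j_0)$;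 $(i_1,j_1)\notin\Delta$; $(i_0,j_1)\notin\Delta$ or $(i_1,j_0)\notin\Delta$; $(i_0,j_0)\notin\Delta$ or $m_{i_0j_0}>1$. Then $\Delta'=\Delta$. (iii)(a) $(i_0,j_0)\in\Delta$, $m_{i_0j_0}=1$; $m_{ij}=0$ whenever $(i_0,j_0)<(i,j)<(i_1,j_1)$ and $(i,j)\ne(i_1,j_0)$, and whenever $(i,j)\le(i_0,j_1)$ and $(i,j)\not\le\Delta$. Then $\Delta'=[\Delta\cup\{(i_0,j_1)\}]$. (iii)(b) The transpose of (a): $(i_0,j_0)\in\Delta$, $m_{i_0j_0}=1$; $m_{ij}=0$ whenever $(i_0,j_0)<(i,j)<(i_1,j_1)$ and $(i,j)\ne(i_0,j_1)$, and whenever $(i,j)\le(i_1,j_0)$ and $(i,j)\not\le\Delta$. Then $\Delta'=[\Delta\cup\{(i_1,j_0)\}]$. (iv)(a) $i_0<i_2<i_1$ and $j_2<j_0<j_1$; $(i_0,j_0),(i_2,j_2)\in\Delta$; $m_{i_0j_0}=m_{i_2j_2}=1$; $m_{i_1j_1}>0$; $m_{ij}=0$ whenever $(i_0,j_2)<(i,j)<(i_1,j_1)$,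 $(i,j)\not\le\Delta$ and $(i,j)\ne(i_0,j_1),(i_1,j_2)$. Then $$M'=M-E_{i_0j_0}-E_{i_1j_1}-E_{i_2j_2}+E_{i_1j_2}+E_{i_2j_0}+E_{i_0j_1},\qquad \Delta'=[\Delta\cup\{(i_2,j_0)\}].$$ (iv)(b) For some $i_2$ with $i_0<i_2<i_1$: $(i_2,j_0)\in\Delta$, $m_{i_2j_0}=1$, $(i_0,j_1)\not\le\Delta$, and $m_{ij}=0$ whenever $(i_0,j_0)<(i,j)<(i_1,j_1)$ and $(i,j)\ne(i_0,j_1),(i_1,j_0),(i_2,j_0)$. Then $\Delta'=\Delta$. (iv)(c) For some $j_2$ with $j_0<j_2<j_1$: $(i_0,j_2)\in\Delta$, $m_{i_0j_2}=1$, $(i_1,j_0)\not\le\Delta$, and $m_{ij}=0$ whenever $(i_0,j_0)<(i,j)<(i_1,j_1)$ and $(i,j)\ne(i_0,j_1),(i_1,j_0),(i_0,j_2)$. Then $\Delta'=\Delta$. (v) For some $t\ge1$, $i_0<i_1<\cdots<i_t$ and $j_1>j_2>\cdots>j_t>j_0$: $(i_1,j_1),\dots,(i_t,j_t)\in\Delta$,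 $m_{i_0j_0}>0$, and $m_{ij}=0$ whenever $(i_0,j_0)<(i,j)\le(i_s-1,j_s-1)$ for some $s\in\{1,\dots,t\}$. Then $$M'=M-\sum_{s=0}^{t}E_{i_sj_s}+E_{i_0j_1}+\sum_{s=1}^{t-1}E_{i_sj_{s+1}}+E_{i_tj_0},$$ $$\Delta'=\big[\,(\Delta\setminus\{(i_0,j_0),\dots,(i_t,j_t)\})\cup\{(i_0,j_1),(i_t,j_0)\}\,\big].$$ The *move order* is defined by: $(M,\Delta)\overset{\rm mv}{\le}(M'',\Delta'')$ if and only if $(M'',\Delta'')$ is obtained from $(M,\Delta)$ by a finite (possibly empty) sequence of simple moves. **Move Theorem.** For all decorated matrices $(M,\Delta)$ and $(M',\Delta')$ with the same $\mathbf b$, $\mathbf c$, $$(M,\Delta)\overset{\rm deg}{\le}(M',\Delta')\iff(M,\Delta)\overset{\rm mv}{\le}(M',\Delta').$$ -/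

import Mathlib

namespace LineTwoFlags

/-! ### Triples of a line and two partial flags in `V = kⁿ` -/

/-- The partial flags `0 = B₀ ⊆ B₁ ⊆ ⋯ ⊆ B_q = kⁿ` with `dim (B_i / B_{i-1}) = b_i`, for a
composition `b = (b₁, …, b_q)` of `n`. The blocks of `b` are indexed from `0` here, so
`b.blocksFun i` is the jump from `space i.castSucc` to `space i.succ`. -/
structure PartialFlag (k : Type*) [Field k] {n : ℕ} (b : Composition n) where
  space : Fin (b.length + 1) → Submodule k (Fin n → k)
  mono : Monotone space
  bot : space 0 = ⊥
  top : space (Fin.last b.length) = ⊤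
  finrank_succ : ∀ i : Fin b.length,
    Module.finrank k (space i.succ) = Module.finrank k (space i.castSucc) + b.blocksFun i

/-- A point `(A, B_•, C_•)` of `ℙ(V) × Flag(b) × Flag(c)`. -/
structure TripleFlag (k : Type*) [Field k] {n : ℕ} (b c : Composition n) where
  line : Projectivization k (Fin n → k)
  fst : PartialFlag k b
  snd : PartialFlag k c

/-! ### The Zariski closure -/

/-- `(a, g, h)` is a frame of the triple `X = (A, B_•, C_•)`: the vector `a` spans `A`, and `g`, `h`
are bases of `kⁿ` such that each `B_i` is spanned by the first `dim B_i = b₁ + ⋯ + b_i` vectors of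
`g` and each `C_j` is spanned by the first `dim C_j = c₁ + ⋯ + c_j` vectors of `h`. -/
structure IsFrame {k : Type*} [Field k] {n : ℕ} {b c : Composition n} (X : TripleFlag k b c)
    (a : Fin n → k) (g h : Fin n → Fin n → k) : Prop where
  line : X.line.submodule = Submodule.span k {a}
  fst_indep : LinearIndependent k g
  snd_indep : LinearIndependent k h
  fst : ∀ i, X.fst.space i = Submodule.span k (g '' {m | (m : ℕ) < b.sizeUpTo i})
  snd : ∀ j, X.snd.space j = Submodule.span k (h '' {m | (m : ℕ) < c.sizeUpTo j})

/-- The names of the `n + n² + n²` coordinates of a frame. -/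
abbrev FrameCoord (n : ℕ) : Type := Fin n ⊕ ((Fin n × Fin n) ⊕ (Fin n × Fin n))

/-- The coordinates of the frame `(a, g, h)`. -/
def frameCoords {k : Type*} {n : ℕ} (a : Fin n → k) (g h : Fin n → Fin n → k) :
    FrameCoord n → k :=
  Sum.elim a (Sum.elim (fun p => g p.1 p.2) (fun p => h p.1 p.2))

/-- Zariski closed subsets of `ℙ(V) × Flag(b) × Flag(c)`. This variety is the quotient of
`(V ∖ 0) × GL(V) × GL(V)`, the variety of frames, by a group acting freely, and it has the quotient
topology: a set `Z` of triples is closed iff the frames of its elements are cut out, among all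
frames, by polynomial equations in the coordinates. (For `ℙ(V)` alone this says that `Z` is cut out
by polynomials in the homogeneous coordinates.) -/
def IsZariskiClosed {k : Type*} [Field k] {n : ℕ} {b c : Composition n}
    (Z : Set (TripleFlag k b c)) : Prop :=
  ∃ S : Set (MvPolynomial (FrameCoord n) k), ∀ X a g h, IsFrame X a g h →
    (X ∈ Z ↔ ∀ P ∈ S, MvPolynomial.eval (frameCoords a g h) P = 0)

/-- The Zariski closure: the intersection of all Zariski closed sets containing the given set. -/
def zariskiClosure {k : Type*} [Field k] {n : ℕ} {b c : Composition n}
    (F : Set (TripleFlag k b c)) : Set (TripleFlag k b c) :=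
  ⋂₀ {Z | IsZariskiClosed Z ∧ F ⊆ Z}

/-! ### Decorated matrices -/

/-- A decorated matrix `(M, Δ)`: `M` is a matrix of nonnegative integers with row sums `b_i` and
column sums `c_j`, and `Δ` is a nonempty set of positions of nonzero entries of `M` which proceeds
strictly from northeast to southwest. -/
@[ext]
structure DecoratedMatrix {n : ℕ} (b c : Composition n) where
  M : Matrix (Fin b.length) (Fin c.length) ℕ
  row_sum : ∀ i, ∑ j, M i j = b.blocksFun i
  col_sum : ∀ j, ∑ i, M i j = c.blocksFun j
  Δ : Finset (Fin b.length × Fin c.length)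
  nonempty : Δ.Nonempty
  northeast_southwest : ∀ p ∈ Δ, ∀ p' ∈ Δ, p ≠ p' →
    (p.1 < p'.1 ∧ p'.2 < p.2) ∨ (p'.1 < p.1 ∧ p.2 < p'.2)
  pos : ∀ p ∈ Δ, 0 < M p.1 p.2

/-- The orbit `F_{M,Δ}`: the triples for which there is a basis `v_{ijl}` of `V`, where `(i, j)` runs
over the positions and `l` takes `m_{ij}` values, such that `B_i` is the span of the `v_{i'jl}` with
`i' ≤ i`, `C_j` is the span of the `v_{ij'l}` with `j' ≤ j`, and `A` is the line through the sum
over `(i, j) ∈ Δ` of the first basis vector at `(i, j)`. (Rows and columns are numbered from `0`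
and `B_•`, `C_•` start with the zero space, hence the strict inequalities.) -/
def orbit (k : Type*) [Field k] {n : ℕ} {b c : Composition n} (D : DecoratedMatrix b c) :
    Set (TripleFlag k b c) :=
  {X | ∃ v : Module.Basis (Σ p : Fin b.length × Fin c.length, Fin (D.M p.1 p.2)) k (Fin n → k),
    (∀ i, X.fst.space i = Submodule.span k (v '' {x | (x.1.1 : ℕ) < i})) ∧
    (∀ j, X.snd.space j = Submodule.span k (v '' {x | (x.1.2 : ℕ) < j})) ∧
    X.line.submodule = Submodule.span k {∑ x with x.1 ∈ D.Δ ∧ (x.2 : ℕ) = 0, v x}}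

/-- The degeneration order: `F_{M,Δ}` is contained in the Zariski closure of `F_{M',Δ'}`. -/
def DegLE (k : Type*) [Field k] {n : ℕ} {b c : Composition n} (D D' : DecoratedMatrix b c) : Prop :=
  orbit k D ⊆ zariskiClosure (orbit k D')

/-! ### Simple moves

Positions are ordered componentwise: `(i, j) ≤ (i', j')` iff `i ≤ i'` and `j ≤ j'`, and `<` means
`≤` and `≠`; this is the product order of `Fin q × Fin r`. -/

/-- `p ≤ Δ`: the position `p` is weakly northwest of some element of `Δ`. -/
def Below {q r : ℕ} (p : Fin q × Fin r) (Δ : Finset (Fin q × Fin r)) : Prop :=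
  ∃ d ∈ Δ, p ≤ d

open Classical in
/-- `[S]`: the set of maximal positions in `S`. -/
noncomputable def maximalPositions {q r : ℕ} (S : Finset (Fin q × Fin r)) :
    Finset (Fin q × Fin r) :=
  {p ∈ S | ∀ s ∈ S, ¬ p < s}

/-- The coordinate matrix `E_{ij}`. -/
def E {q r : ℕ} (i : Fin q) (j : Fin r) : Matrix (Fin q) (Fin r) ℕ := Matrix.single i j 1

variable {n : ℕ} {b c : Composition n}

/-- `M' = M - E_{i₀j₀} - E_{i₁j₁} + E_{i₀j₁} + E_{i₁j₀}`, written without subtraction. -/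
def IsFlip (D D' : DecoratedMatrix b c) (i₀ i₁ : Fin b.length) (j₀ j₁ : Fin c.length) : Prop :=
  D'.M + E i₀ j₀ + E i₁ j₁ = D.M + E i₀ j₁ + E i₁ j₀

/-- Move (i). -/
def MoveI (D D' : DecoratedMatrix b c) : Prop :=
  ∃ i₁ j₁, ¬ Below (i₁, j₁) D.Δ ∧ 0 < D.M i₁ j₁ ∧
    (∀ i j, (i, j) < (i₁, j₁) → ¬ Below (i, j) D.Δ → D.M i j = 0) ∧
    D'.M = D.M ∧ D'.Δ = maximalPositions (D.Δ ∪ {(i₁, j₁)})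

/-- Move (ii). -/
def MoveII (D D' : DecoratedMatrix b c) : Prop :=
  ∃ i₀ i₁ j₀ j₁, i₀ < i₁ ∧ j₀ < j₁ ∧ 0 < D.M i₀ j₀ ∧ 0 < D.M i₁ j₁ ∧
    (∀ i j, (i₀, j₀) < (i, j) → (i, j) < (i₁, j₁) →
      (i, j) ≠ (i₀, j₁) → (i, j) ≠ (i₁, j₀) → D.M i j = 0) ∧
    (i₁, j₁) ∉ D.Δ ∧ ((i₀, j₁) ∉ D.Δ ∨ (i₁, j₀) ∉ D.Δ) ∧
    ((i₀, j₀) ∉ D.Δ ∨ 1 < D.M i₀ j₀) ∧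
    IsFlip D D' i₀ i₁ j₀ j₁ ∧ D'.Δ = D.Δ

/-- Move (iii)(a). -/
def MoveIIIa (D D' : DecoratedMatrix b c) : Prop :=
  ∃ i₀ i₁ j₀ j₁, i₀ < i₁ ∧ j₀ < j₁ ∧ (i₀, j₀) ∈ D.Δ ∧ D.M i₀ j₀ = 1 ∧ 0 < D.M i₁ j₁ ∧
    (∀ i j, (i₀, j₀) < (i, j) → (i, j) < (i₁, j₁) → (i, j) ≠ (i₁, j₀) → D.M i j = 0) ∧
    (∀ i j, (i, j) ≤ (i₀, j₁) → ¬ Below (i, j) D.Δ → D.M i j = 0) ∧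
    IsFlip D D' i₀ i₁ j₀ j₁ ∧ D'.Δ = maximalPositions (D.Δ ∪ {(i₀, j₁)})

/-- Move (iii)(b), the transpose of (iii)(a). -/
def MoveIIIb (D D' : DecoratedMatrix b c) : Prop :=
  ∃ i₀ i₁ j₀ j₁, i₀ < i₁ ∧ j₀ < j₁ ∧ (i₀, j₀) ∈ D.Δ ∧ D.M i₀ j₀ = 1 ∧ 0 < D.M i₁ j₁ ∧
    (∀ i j, (i₀, j₀) < (i, j) → (i, j) < (i₁, j₁) → (i, j) ≠ (i₀, j₁) → D.M i j = 0) ∧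
    (∀ i j, (i, j) ≤ (i₁, j₀) → ¬ Below (i, j) D.Δ → D.M i j = 0) ∧
    IsFlip D D' i₀ i₁ j₀ j₁ ∧ D'.Δ = maximalPositions (D.Δ ∪ {(i₁, j₀)})

/-- Move (iv)(a):
`M' = M - E_{i₀j₀} - E_{i₁j₁} - E_{i₂j₂} + E_{i₁j₂} + E_{i₂j₀} + E_{i₀j₁}`. -/
def MoveIVa (D D' : DecoratedMatrix b c) : Prop :=
  ∃ i₀ i₁ i₂ j₀ j₁ j₂, i₀ < i₂ ∧ i₂ < i₁ ∧ j₂ < j₀ ∧ j₀ < j₁ ∧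
    (i₀, j₀) ∈ D.Δ ∧ (i₂, j₂) ∈ D.Δ ∧ D.M i₀ j₀ = 1 ∧ D.M i₂ j₂ = 1 ∧ 0 < D.M i₁ j₁ ∧
    (∀ i j, (i₀, j₂) < (i, j) → (i, j) < (i₁, j₁) → ¬ Below (i, j) D.Δ →
      (i, j) ≠ (i₀, j₁) → (i, j) ≠ (i₁, j₂) → D.M i j = 0) ∧
    D'.M + E i₀ j₀ + E i₁ j₁ + E i₂ j₂ = D.M + E i₁ j₂ + E i₂ j₀ + E i₀ j₁ ∧
    D'.Δ = maximalPositions (D.Δ ∪ {(i₂, j₀)})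

/-- Move (iv)(b). -/
def MoveIVb (D D' : DecoratedMatrix b c) : Prop :=
  ∃ i₀ i₁ i₂ j₀ j₁, i₀ < i₂ ∧ i₂ < i₁ ∧ j₀ < j₁ ∧ 0 < D.M i₀ j₀ ∧ 0 < D.M i₁ j₁ ∧
    (i₂, j₀) ∈ D.Δ ∧ D.M i₂ j₀ = 1 ∧ ¬ Below (i₀, j₁) D.Δ ∧
    (∀ i j, (i₀, j₀) < (i, j) → (i, j) < (i₁, j₁) →
      (i, j) ≠ (i₀, j₁) → (i, j) ≠ (i₁, j₀) → (i, j) ≠ (i₂, j₀) → D.M i j = 0) ∧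
    IsFlip D D' i₀ i₁ j₀ j₁ ∧ D'.Δ = D.Δ

/-- Move (iv)(c). -/
def MoveIVc (D D' : DecoratedMatrix b c) : Prop :=
  ∃ i₀ i₁ j₀ j₁ j₂, i₀ < i₁ ∧ j₀ < j₂ ∧ j₂ < j₁ ∧ 0 < D.M i₀ j₀ ∧ 0 < D.M i₁ j₁ ∧
    (i₀, j₂) ∈ D.Δ ∧ D.M i₀ j₂ = 1 ∧ ¬ Below (i₁, j₀) D.Δ ∧
    (∀ i j, (i₀, j₀) < (i, j) → (i, j) < (i₁, j₁) →
      (i, j) ≠ (i₀, j₁) → (i, j) ≠ (i₁, j₀) → (i, j) ≠ (i₀, j₂) → D.M i j = 0) ∧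
    IsFlip D D' i₀ i₁ j₀ j₁ ∧ D'.Δ = D.Δ

/-- Move (v), with `t = u + 1 ≥ 1` circled positions `(i₁, j₁), …, (i_t, j_t)`, listed as
`(i 0, j 0), …, (i u, j u)`:
`M' = M - E_{i₀j₀} - ∑_{s=1}^t E_{i_s j_s} + E_{i₀j₁} + ∑_{s=1}^{t-1} E_{i_s j_{s+1}} + E_{i_t j₀}`,
and `Δ'` consists of the maximal positions of `(Δ ∖ {(i_s, j_s) | 0 ≤ s ≤ t}) ∪ {(i₀, j₁), (i_t, j₀)}`.
-/
def MoveV (D D' : DecoratedMatrix b c) : Prop :=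
  ∃ (u : ℕ) (i₀ : Fin b.length) (j₀ : Fin c.length)
    (i : Fin (u + 1) → Fin b.length) (j : Fin (u + 1) → Fin c.length),
    StrictMono i ∧ StrictAnti j ∧ i₀ < i 0 ∧ j₀ < j (Fin.last u) ∧
    (∀ s, (i s, j s) ∈ D.Δ) ∧ 0 < D.M i₀ j₀ ∧
    (∀ x y s, (i₀, j₀) < (x, y) → x < i s → y < j s → D.M x y = 0) ∧
    D'.M + E i₀ j₀ + ∑ s, E (i s) (j s) =
      D.M + E i₀ (j 0) + ∑ s : Fin u, E (i s.castSucc) (j s.succ) + E (i (Fin.last u)) j₀ ∧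
    D'.Δ = maximalPositions
      ((D.Δ \ ({(i₀, j₀)} ∪ Finset.univ.image fun s => (i s, j s))) ∪
        {(i₀, j 0), (i (Fin.last u), j₀)})

/-- `(M, Δ) → (M', Δ')` is a simple move of one of the types (i)–(v). -/
def SimpleMove (D D' : DecoratedMatrix b c) : Prop :=
  MoveI D D' ∨ MoveII D D' ∨ (MoveIIIa D D' ∨ MoveIIIb D D') ∨
    (MoveIVa D D' ∨ MoveIVb D D' ∨ MoveIVc D D') ∨ MoveV D D'

/-- The move order: `(M', Δ')` is obtained from `(M, Δ)` by a finite sequence of simple moves. -/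
def MoveLE (D D' : DecoratedMatrix b c) : Prop :=
  Relation.ReflTransGen SimpleMove D D'

end LineTwoFlags

/-! Both orders agree with a third one, `RankLE`, and the proof is the cycle degeneration ⟹ rank
order ⟹ moves ⟹ degeneration. The rank order compares the functions `cnt M x y` (the sum of the
entries in rows of index < x and columns of index < y) and the ideals of positions weakly northwest
of Δ.

`DegLE.rankLE`: on the orbit of (M, Δ), dim(B_x + C_y) is dim B_x + dim C_y minus `cnt M x y`, and A
⊄ B_x + C_y exactly when (x, y) ≤ Δ. Upper bounds on dim(B_x + C_y) and dim(A + B_x + C_y) mean that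
minors vanish, so they pass to the closure.

`RankLE.moveLE`: by induction on `height` it is enough to find, for D ≠ D', one simple move from D
that stays below D'. Let e be the difference of the rank functions. If one more position may be
circled, move (i) applies. If e is positive at a circled position, an extremal pivot yields the
cyclic move (v). Otherwise the pair is saturated, with e = 0 at every circled position. If e = 0
everywhere, then D = D'. If not, fix a minimal entry (i₁, j₁) at a position with e > 0 and consider
its maximal sources, the entries northwest of it with e > 0 on the rectangle in between. A maximal
source that is not a simple circled entry gives (ii); a corner in the hull of Δ' gives (iii), or
(iv)(a) if two maximal sources span it. When all these fail, counting entries in rectangles through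
mixed second differences of e produces a further source in the row or column of a maximal one, which
gives (iv)(b) or (iv)(c); see `IsSaturated.cases_of_minEnd`.

`SimpleMove.degLE`: each triple in the smaller orbit is the member at t = 0 of a family whose frames
move along an affine line and whose members for t ≠ 0 lie in the larger orbit, as explicit bases
show. Since k is infinite, polynomial equations that hold for all t ≠ 0 hold at t = 0. -/

namespace LineTwoFlags

/-! ### Differences of rank functions -/

/-- `e` is the pointwise difference of the rank functions of two matrices `m`, `m'` with the same
row and column sums, and it is nonnegative. The rank function counts entries strictly northwest
of a position. -/
structure RankGap (m m' : ℕ → ℕ → ℕ) (e : ℕ → ℕ → ℤ) : Prop where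
  nonneg : ∀ x y, 0 ≤ e x y
  zero_left : ∀ y, e 0 y = 0
  zero_right : ∀ x, e x 0 = 0
  succ_succ : ∀ x y, e (x + 1) (y + 1) + e x y = e (x + 1) y + e x (y + 1) + m x y - m' x y
  bounded : ∃ N, ∀ x y, 0 < e x y → x < N ∧ y < N

/-- `e` is positive on the half-open rectangle `(i, x] × (j, y]`. -/
def PosOn (e : ℕ → ℕ → ℤ) (i j x y : ℕ) : Prop :=
  ∀ x' y', i < x' → x' ≤ x → j < y' → y' ≤ y → 0 < e x' y'

namespace RankGap

variable {m m' : ℕ → ℕ → ℕ} {e : ℕ → ℕ → ℤ}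

lemma transpose (h : RankGap m m' e) :
    RankGap (fun x y => m y x) (fun x y => m' y x) (fun x y => e y x) where
  nonneg x y := h.nonneg y x
  zero_left y := h.zero_right y
  zero_right x := h.zero_left x
  succ_succ x y := by have := h.succ_succ y x; linarith
  bounded := by
    obtain ⟨N, hN⟩ := h.bounded
    exact ⟨N, fun x y hxy => (hN y x hxy).symm⟩

lemma row_sum (h : RankGap m m' e) (x b l : ℕ) :
    ∑ j ∈ Finset.Ico b (b + l), ((m x j : ℤ) - m' x j) =
      e (x + 1) (b + l) - e x (b + l) - e (x + 1) b + e x b := by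
  induction l with
  | zero => simp
  | succ l ih =>
    rw [← add_assoc, Finset.sum_Ico_succ_top (by omega), ih]
    have := h.succ_succ x (b + l)
    linarith

lemma rect_sum (h : RankGap m m' e) (a b k l : ℕ) :
    ∑ i ∈ Finset.Ico a (a + k), ∑ j ∈ Finset.Ico b (b + l), ((m i j : ℤ) - m' i j) =
      e (a + k) (b + l) - e a (b + l) - e (a + k) b + e a b := by
  induction k with
  | zero => simp
  | succ k ih =>
    rw [← add_assoc, Finset.sum_Ico_succ_top (by omega), ih, h.row_sum]
    ring

/-- By `rect_sum` the hypothesis says that `m - m'` has positive sum over the rectangle, so `m`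
cannot vanish there. Most entries needed below are found in this way. -/
lemma exists_dot_of_rect (h : RankGap m m' e) {a a' b b' : ℕ} (ha : a ≤ a') (hb : b ≤ b')
    (hlt : e a b' + e a' b < e a' b' + e a b) :
    ∃ i j, a ≤ i ∧ i < a' ∧ b ≤ j ∧ j < b' ∧ 0 < m i j := by
  by_contra! hno
  obtain ⟨k, rfl⟩ := Nat.exists_eq_add_of_le ha
  obtain ⟨l, rfl⟩ := Nat.exists_eq_add_of_le hb
  have hs := h.rect_sum a b k l
  have : ∑ i ∈ Finset.Ico a (a + k), ∑ j ∈ Finset.Ico b (b + l), ((m i j : ℤ) - m' i j) ≤ 0 := by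
    refine Finset.sum_nonpos fun i hi => Finset.sum_nonpos fun j hj => ?_
    rw [Finset.mem_Ico] at hi hj
    have := hno i j hi.1 hi.2 hj.1 hj.2
    omega
  linarith

/-- Over this rectangle `m` sums to at most 1 and `m'` to at least 1, so the mixed second difference
of `e` is nonpositive. -/
lemma rect_le_of_single (h : RankGap m m' e) {a a' b b' : ℕ} (ha : a ≤ a') (hb : b ≤ b')
    (hm : m a b = 1)
    (hone : ∀ i j, a ≤ i → i < a' → b ≤ j → j < b' → 0 < m i j → i = a ∧ j = b)
    (hm' : ∃ i j, a ≤ i ∧ i < a' ∧ b ≤ j ∧ j < b' ∧ 0 < m' i j) :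
    e a' b' + e a b ≤ e a b' + e a' b := by
  obtain ⟨k, rfl⟩ := Nat.exists_eq_add_of_le ha
  obtain ⟨l, rfl⟩ := Nat.exists_eq_add_of_le hb
  have hs := h.rect_sum a b k l
  obtain ⟨i₀, j₀, h1, h2, h3, h4, h5⟩ := hm'
  simp only [← Finset.sum_product'] at hs
  rw [Finset.sum_sub_distrib] at hs
  have hA : ∑ p ∈ Finset.Ico a (a + k) ×ˢ Finset.Ico b (b + l), (m p.1 p.2 : ℤ) ≤ 1 := by
    have h1 : ∀ p ∈ Finset.Ico a (a + k) ×ˢ Finset.Ico b (b + l),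
        (m p.1 p.2 : ℤ) ≤ if p = (a, b) then 1 else 0 := by
      intro p hp
      simp only [Finset.mem_product, Finset.mem_Ico] at hp
      by_cases hpab : p = (a, b)
      · simp [hpab, hm]
      · rw [if_neg hpab]
        by_contra hcon
        have := hone p.1 p.2 hp.1.1 hp.1.2 hp.2.1 hp.2.2 (by omega)
        exact hpab (Prod.ext this.1 this.2)
    refine (Finset.sum_le_sum h1).trans ?_
    rw [Finset.sum_ite_eq']
    split_ifs <;> simp
  have hB : (1 : ℤ) ≤ ∑ p ∈ Finset.Ico a (a + k) ×ˢ Finset.Ico b (b + l), (m' p.1 p.2 : ℤ) := by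
    have h6 : (1 : ℤ) ≤ m' i₀ j₀ := by exact_mod_cast h5
    refine h6.trans (Finset.single_le_sum (f := fun p : ℕ × ℕ => (m' p.1 p.2 : ℤ))
      (fun p _ => by positivity) (a := (i₀, j₀)) ?_)
    simp only [Finset.mem_product, Finset.mem_Ico]
    omega
  linarith

/-- The last zero of a row weakly before a given column. -/
lemma exists_last_zero (h : RankGap m m' e) (x y : ℕ) :
    ∃ s ≤ y, e x s = 0 ∧ ∀ y', s < y' → y' ≤ y → 0 < e x y' := by
  induction y with
  | zero => exact ⟨0, le_rfl, h.zero_right x, fun y' h1 h2 => by omega⟩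
  | succ y ih =>
    by_cases hy : e x (y + 1) = 0
    · exact ⟨y + 1, le_rfl, hy, fun y' h1 h2 => by omega⟩
    · obtain ⟨s, h1, h2, h3⟩ := ih
      refine ⟨s, by omega, h2, fun y' h4 h5 => ?_⟩
      rcases Nat.lt_or_ge y y' with h6 | h6
      · obtain rfl : y' = y + 1 := by omega
        exact lt_of_le_of_ne (h.nonneg _ _) (Ne.symm hy)
      · exact h3 y' h4 h6

/-- Strictly northwest of any position with positive gap there is an entry of the smaller matrix
such that the gap is positive on the rectangle in between. -/
lemma exists_northwest (h : RankGap m m' e) {x y : ℕ} (hxy : 0 < e x y) :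
    ∃ i j, i < x ∧ j < y ∧ 0 < m i j ∧ PosOn e i j x y := by
  by_contra! hno
  -- Sweep upwards from row x, keeping a window (s, y] of columns in which the gap is positive in
  -- all rows passed, with a strictly larger gap at y than at s. If strictness failed in the next
  -- row, `exists_dot_of_rect` would find an entry of the desired kind there. In row 0 the gap
  -- vanishes, against strictness.
  have key : ∀ k ≤ x, ∃ s ≤ y, PosOn e (x - k - 1) s x y ∧ e (x - k) s < e (x - k) y := by
    intro k
    induction k with
    | zero =>
      intro _
      obtain ⟨s, h1, h2, h3⟩ := h.exists_last_zero x y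
      refine ⟨s, h1, fun x' y' h4 h5 h6 h7 => ?_, by simpa [h2] using hxy⟩
      obtain rfl : x' = x := by omega
      exact h3 y' h6 h7
    | succ k ih =>
      intro hk
      obtain ⟨s, hs, hpos, hlt⟩ := ih (by omega)
      obtain ⟨a, ha⟩ : ∃ a, x - k = a + 1 := ⟨x - k - 1, by omega⟩
      have ha' : x - (k + 1) = a := by omega
      rw [ha] at hlt hpos
      rw [ha']
      have hlt' : e a s < e a y := by
        by_contra hcon
        obtain ⟨i, j, h1, h2, h3, h4, h5⟩ := h.exists_dot_of_rect (a := a) (a' := a + 1) (b := s)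
          (b' := y) (by omega) hs (by linarith)
        refine hno i j (by omega) h4 h5 fun x' y' h6 h7 h8 h9 => ?_
        exact hpos x' y' (by omega) h7 (by omega) h9
      obtain ⟨t, ht, ht0, htp⟩ := h.exists_last_zero a y
      have hnn := h.nonneg a s
      refine ⟨max s t, by omega, fun x' y' h6 h7 h8 h9 => ?_, ?_⟩
      · rcases Nat.lt_or_ge a x' with h10 | h10
        · exact hpos x' y' (by omega) h7 (by omega) h9
        · obtain rfl : x' = a := by omega
          exact htp y' (by omega) h9
      · rcases le_total s t with h10 | h10
        · rw [max_eq_right h10, ht0]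
          linarith
        · rwa [max_eq_left h10]
  obtain ⟨s, -, -, hlt⟩ := key x le_rfl
  simp [h.zero_left] at hlt

/-- Were there no such entry, the recursion would bound a positive e(i, j) by e(i+1, j) + e(i, j+1);
induction from the far southeast, where the gap vanishes, would leave no positive value. -/
lemma exists_dot (h : RankGap m m' e) {x y : ℕ} (hxy : 0 < e x y) :
    ∃ i j, 0 < e i j ∧ 0 < m i j := by
  obtain ⟨N, hN⟩ := h.bounded
  by_contra! hno
  have key : ∀ k i j, 2 * N ≤ i + j + k → e i j ≤ 0 := by
    intro k
    induction k with
    | zero =>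
      intro i j hij
      by_contra! hpos
      have := hN i j hpos
      omega
    | succ k ih =>
      intro i j hij
      by_contra! hpos
      have h1 := h.succ_succ i j
      have h2 := ih (i + 1) j (by omega)
      have h3 := ih i (j + 1) (by omega)
      have h4 := h.nonneg (i + 1) (j + 1)
      have h5 := hno i j hpos
      have h6 : m i j = 0 := by omega
      rw [h6] at h1
      push_cast at h1
      have : (0 : ℤ) ≤ m' i j := by positivity
      linarith
  exact absurd (key (2 * N) x y (by omega)) (by omega)

end RankGap

lemma PosOn.mono {e : ℕ → ℕ → ℤ} {i j x y i' j' x' y' : ℕ} (h : PosOn e i j x y)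
    (hi : i ≤ i') (hj : j ≤ j') (hx : x' ≤ x) (hy : y' ≤ y) : PosOn e i' j' x' y' :=
  fun a b h1 h2 h3 h4 => h a b (by omega) (by omega) (by omega) (by omega)

lemma PosOn.swap {e : ℕ → ℕ → ℤ} {i j x y : ℕ} (h : PosOn e i j x y) :
    PosOn (fun a b => e b a) j i y x :=
  fun a b h1 h2 h3 h4 => h b a h3 h4 h1 h2

lemma Nat.exists_max_of_bounded {S : ℕ → Prop} {N : ℕ} (hS : ∃ k, S k) (hN : ∀ k, S k → k ≤ N) :
    ∃ k, S k ∧ ∀ k', S k' → k' ≤ k := by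
  classical
  obtain ⟨k, hk⟩ := hS
  exact ⟨_, Nat.findGreatest_spec (hN k hk) hk, fun k' hk' => Nat.le_findGreatest (hN k' hk') hk'⟩

/-- A nonempty family of positions in `ℕ × ℕ` with bounded coordinates has an element with the
largest coordinate sum. -/
lemma exists_max_sum {S : ℕ → ℕ → Prop} {N : ℕ} (hS : ∃ i j, S i j)
    (hN : ∀ i j, S i j → i < N ∧ j < N) :
    ∃ i j, S i j ∧ ∀ i' j', S i' j' → i' + j' ≤ i + j := by
  obtain ⟨i, j, hij⟩ := hS
  obtain ⟨k, ⟨a, b, hab, rfl⟩, hmax⟩ :=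
    Nat.exists_max_of_bounded (S := fun k => ∃ i j, S i j ∧ i + j = k) (N := 2 * N)
      ⟨_, i, j, hij, rfl⟩ (by
        rintro k' ⟨a, b, hab, rfl⟩
        have := hN a b hab
        omega)
  exact ⟨a, b, hab, fun a' b' h => hmax _ ⟨a', b', h, rfl⟩⟩

/-- A nonempty family of positions in `ℕ × ℕ` has an element with the least coordinate sum. -/
lemma exists_min_sum {S : ℕ → ℕ → Prop} (hS : ∃ i j, S i j) :
    ∃ i j, S i j ∧ ∀ i' j', S i' j' → i + j ≤ i' + j' := by
  obtain ⟨i, j, hij⟩ := hS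
  classical
  have hne : ∃ k', ∃ i j, S i j ∧ i + j = k' := ⟨i + j, i, j, hij, rfl⟩
  obtain ⟨a, b, hab, hk⟩ := Nat.find_spec hne
  exact ⟨a, b, hab, fun a' b' h => hk ▸ Nat.find_min' hne ⟨a', b', h, rfl⟩⟩

/-- The positions weakly northwest of the family `δ`. -/
def Ideal (δ : ℕ → ℕ → Prop) (x y : ℕ) : Prop := ∃ a b, δ a b ∧ x ≤ a ∧ y ≤ b

/-- The family `δ` proceeds strictly from northeast to southwest. -/
def IsStaircase (δ : ℕ → ℕ → Prop) : Prop :=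
  ∀ a b c d, δ a b → δ c d → (a < c ∧ d < b) ∨ (c < a ∧ b < d) ∨ (a = c ∧ b = d)

lemma IsStaircase.swap {δ : ℕ → ℕ → Prop} (h : IsStaircase δ) :
    IsStaircase fun a b => δ b a := by
  intro a b c d h1 h2
  have := h b a d c h1 h2
  tauto

lemma Ideal.mono {δ : ℕ → ℕ → Prop} {x y x' y' : ℕ} (h : Ideal δ x y) (hx : x' ≤ x)
    (hy : y' ≤ y) : Ideal δ x' y' := by
  obtain ⟨a, b, h1, h2, h3⟩ := h
  exact ⟨a, b, h1, by omega, by omega⟩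

lemma Ideal.swap {δ : ℕ → ℕ → Prop} {x y : ℕ} (h : Ideal δ x y) :
    Ideal (fun a b => δ b a) y x := by
  obtain ⟨a, b, h1, h2, h3⟩ := h
  exact ⟨b, a, h1, h3, h2⟩

/-! ### The pivot of the cyclic move -/

namespace RankGap

variable {m m' : ℕ → ℕ → ℕ} {e : ℕ → ℕ → ℤ} {δ δ' : ℕ → ℕ → Prop}

/-- Serves to contradict the extremal choice of a pivot. Between (x, y) and (c, d) the gap is
positive, since a zero there would put (x, y) into the ideal of δ'. Take a zero (u, v) between (i,
j) and (c, d) with u as large as possible; then u < x and v > b. Now e(u, y) and e(x, v) are at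
least 1 while e(u, v) + e(x, y) ≤ 1, so the rectangle in between contains an entry. -/
lemma exists_dot_southeast (h : RankGap m m' e) {i j a b c d x y : ℕ}
    (hI : ∀ x y, Ideal δ x y → e x y = 0 → Ideal δ' x y)
    (hab : PosOn e i j a b) (hcd : ¬ PosOn e i j c d) (hδ : δ c d)
    (hca : c < a) (hy : j < y) (hyb : y ≤ b) (hxc : x ≤ c)
    (hxy : ¬ Ideal δ' x y) (he : e x y ≤ 1) :
    ∃ i' j', i < i' ∧ j < j' ∧ i' < c ∧ j' < d ∧ 0 < m i' j' ∧ PosOn e i' j' c d := by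
  have hpos : ∀ x' y', x ≤ x' → x' ≤ c → y ≤ y' → y' ≤ d → 0 < e x' y' := by
    intro x' y' h1 h2 h3 h4
    refine lt_of_le_of_ne (h.nonneg _ _) fun h0 => hxy ?_
    exact (hI x' y' ⟨c, d, hδ, h2, h4⟩ h0.symm).mono h1 h3
  have hz : ∃ u, ∃ v, i < u ∧ u ≤ c ∧ j < v ∧ v ≤ d ∧ e u v = 0 := by
    unfold PosOn at hcd
    push Not at hcd
    obtain ⟨u, v, h1, h2, h3, h4, h5⟩ := hcd
    exact ⟨u, v, h1, h2, h3, h4, le_antisymm h5 (h.nonneg _ _)⟩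
  obtain ⟨u, ⟨v, h1, h2, h3, h4, h5⟩, hmax⟩ := Nat.exists_max_of_bounded (N := c) hz
    (by rintro k ⟨v, h⟩; omega)
  have hvb : b < v := by
    by_contra hcon
    have := hab u v h1 (by omega) h3 (by omega)
    omega
  have hux : u < x := by
    by_contra hcon
    have := hpos u v (by omega) h2 (by omega) h4
    omega
  have h6 := hab u y h1 (by omega) hy hyb
  have h7 := hpos x v le_rfl hxc (by omega) h4
  obtain ⟨i', j', g1, g2, g3, g4, g5⟩ := h.exists_dot_of_rect (a := u) (a' := x) (b := y) (b' := v)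
    hux.le (by omega) (by linarith)
  refine ⟨i', j', by omega, by omega, by omega, by omega, g5, fun x' y' k1 k2 k3 k4 => ?_⟩
  refine lt_of_le_of_ne (h.nonneg _ _) fun h0 => ?_
  have := hmax x' ⟨y', by omega, k2, by omega, k4, h0.symm⟩
  omega

/-- If the gap is positive at some circled position, there is an entry of the smaller matrix from
which a cyclic move through circled positions to its southeast leads to an intermediate decorated
matrix. -/
lemma exists_pivot (h : RankGap m m' e) (hδ : IsStaircase δ)
    (hI : ∀ x y, Ideal δ x y → e x y = 0 → Ideal δ' x y) (hx : ∃ a b, δ a b ∧ 0 < e a b) :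
    ∃ i j, 0 < m i j ∧ (∃ a b, δ a b ∧ i < a ∧ j < b ∧ PosOn e i j a b) ∧
      (∀ x y a b, δ a b → i < a → j < b → PosOn e i j a b → i ≤ x → j ≤ y → x < a → y < b →
        0 < m x y → x = i ∧ y = j) ∧
      ∀ x y a b c d, δ a b → i < a → j < b → PosOn e i j a b → δ c d → ¬ PosOn e i j c d →
        i < x → j < y → x ≤ a → y ≤ b → x ≤ c → y ≤ d → ¬ Ideal δ' x y → 2 ≤ e x y := by
  obtain ⟨N, hN⟩ := h.bounded
  -- With maximal coordinate sum, no entry further southeast can reach a circled position through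
  -- positive gaps; both remaining claims follow by contradiction to this.
  obtain ⟨i, j, ⟨hm, hX⟩, hmax⟩ := exists_max_sum (N := N)
    (S := fun i j => 0 < m i j ∧ ∃ a b, δ a b ∧ i < a ∧ j < b ∧ PosOn e i j a b)
    (by
      obtain ⟨a, b, hab, he⟩ := hx
      obtain ⟨i, j, h1, h2, h3, h4⟩ := h.exists_northwest he
      exact ⟨i, j, h3, a, b, hab, h1, h2, h4⟩)
    (by
      rintro i j ⟨-, a, b, -, h1, h2, h3⟩
      have := hN a b (h3 a b h1 le_rfl h2 le_rfl)
      omega)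
  refine ⟨i, j, hm, hX, ?_, ?_⟩
  · intro x y a b h1 h2 h3 h4 h5 h6 h7 h8 h9
    have := hmax x y ⟨h9, a, b, h1, h7, h8, h4.mono h5 h6 le_rfl le_rfl⟩
    omega
  · intro x y a b c d hab hia hjb hpos hcd hnpos hix hjy hxa hyb hxc hyd hxy
    by_contra hlt
    -- An unreached circled position lies northeast or southwest of the reached one; the second case
    -- is the transpose of the first.
    rcases hδ c d a b hcd hab with hh | hh | hh
    · obtain ⟨i', j', h1, h2, h3, h4, h5, h6⟩ := h.exists_dot_southeast hI hpos hnpos hcd hh.1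
        hjy hyb hxc hxy (by omega)
      have := hmax i' j' ⟨h5, c, d, hcd, h3, h4, h6⟩
      omega
    · obtain ⟨j', i', h1, h2, h3, h4, h5, h6⟩ := h.transpose.exists_dot_southeast
        (δ := fun a b => δ b a) (δ' := fun a b => δ' b a)
        (fun x y h1 h2 => (hI y x h1.swap h2).swap) hpos.swap
        (fun hc => hnpos hc.swap) hcd hh.2 hix hxa hyd (fun hc => hxy hc.swap) (by omega)
      have := hmax i' j' ⟨h5, c, d, hcd, h4, h3, h6.swap⟩
      omega
    · obtain ⟨rfl, rfl⟩ := hh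
      exact hnpos hpos

end RankGap

end LineTwoFlags

/-! ### Saturated pairs and the origin of moves (ii)–(iv) -/

namespace LineTwoFlags

/-- The largest ideal contained in the union of the ideal of `δ` and the set of positions with
positive gap. -/
def Hull (e : ℕ → ℕ → ℤ) (δ : ℕ → ℕ → Prop) (x y : ℕ) : Prop :=
  ∀ x' y', x' ≤ x → y' ≤ y → Ideal δ x' y' ∨ 0 < e x' y'

lemma Hull.mono {e : ℕ → ℕ → ℤ} {δ : ℕ → ℕ → Prop} {x y x' y' : ℕ} (h : Hull e δ x y)
    (hx : x' ≤ x) (hy : y' ≤ y) : Hull e δ x' y' :=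
  fun a b h1 h2 => h a b (by omega) (by omega)

lemma Ideal.hull {e : ℕ → ℕ → ℤ} {δ : ℕ → ℕ → Prop} {x y : ℕ} (h : Ideal δ x y) :
    Hull e δ x y :=
  fun _ _ h1 h2 => Or.inl (h.mono h1 h2)

lemma Hull.swap {e : ℕ → ℕ → ℤ} {δ : ℕ → ℕ → Prop} {x y : ℕ} (h : Hull e δ x y) :
    Hull (fun a b => e b a) (fun a b => δ b a) y x :=
  fun a b h1 h2 => (h b a h2 h1).imp Ideal.swap id

/-- The situation in which a decorated matrix below another one can neither be enlarged by circling
more positions nor by a cyclic move through circled positions. -/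
structure IsSaturated (m m' : ℕ → ℕ → ℕ) (e : ℕ → ℕ → ℤ) (δ δ' : ℕ → ℕ → Prop) : Prop
    extends RankGap m m' e where
  staircase : IsStaircase δ
  pos : ∀ a b, δ a b → 0 < m a b
  pos' : ∀ a b, δ' a b → 0 < m' a b
  eq_zero : ∀ a b, δ a b → e a b = 0
  ideal_le : ∀ x y, Ideal δ x y → Ideal δ' x y
  sat : ∀ x y, 0 < m x y → Hull e δ' x y → Ideal δ x y

/-- `(i, j)` is an entry strictly northwest of `(i₁, j₁)` such that the gap is positive in
between. -/
def IsSource (m : ℕ → ℕ → ℕ) (e : ℕ → ℕ → ℤ) (i₁ j₁ i j : ℕ) : Prop :=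
  0 < m i j ∧ i < i₁ ∧ j < j₁ ∧ PosOn e i j i₁ j₁

/-- A maximal source of `(i₁, j₁)`. -/
def IsMaxSource (m : ℕ → ℕ → ℕ) (e : ℕ → ℕ → ℤ) (i₁ j₁ i j : ℕ) : Prop :=
  IsSource m e i₁ j₁ i j ∧ ∀ i' j', IsSource m e i₁ j₁ i' j' → i ≤ i' → j ≤ j' → i' = i ∧ j' = j

/-- `(i₁, j₁)` is minimal among the entries at positions with positive gap. -/
def IsMinEnd (m : ℕ → ℕ → ℕ) (e : ℕ → ℕ → ℤ) (i₁ j₁ : ℕ) : Prop :=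
  0 < m i₁ j₁ ∧ 0 < e i₁ j₁ ∧
    ∀ x y, x ≤ i₁ → y ≤ j₁ → 0 < m x y → 0 < e x y → x = i₁ ∧ y = j₁

/-- All maximal sources of `(i₁, j₁)` are simple circled entries, and the corners of the rectangles
that they span with `(i₁, j₁)` are outside the hull. -/
def AllBlocked (m : ℕ → ℕ → ℕ) (e : ℕ → ℕ → ℤ) (δ δ' : ℕ → ℕ → Prop) (i₁ j₁ : ℕ) : Prop :=
  ∀ i j, IsMaxSource m e i₁ j₁ i j → δ i j ∧ m i j = 1 ∧ ¬ Hull e δ' i j₁ ∧ ¬ Hull e δ' i₁ j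

variable {m m' : ℕ → ℕ → ℕ} {e : ℕ → ℕ → ℤ} {δ δ' : ℕ → ℕ → Prop} {i₁ j₁ : ℕ}

lemma IsSource.swap {i j : ℕ} (h : IsSource m e i₁ j₁ i j) :
    IsSource (fun a b => m b a) (fun a b => e b a) j₁ i₁ j i :=
  ⟨h.1, h.2.2.1, h.2.1, h.2.2.2.swap⟩

lemma IsMaxSource.swap {i j : ℕ} (h : IsMaxSource m e i₁ j₁ i j) :
    IsMaxSource (fun a b => m b a) (fun a b => e b a) j₁ i₁ j i :=
  ⟨h.1.swap, fun i' j' h1 h2 h3 => (h.2 j' i' h1.swap h3 h2).symm⟩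

lemma IsMinEnd.swap (h : IsMinEnd m e i₁ j₁) :
    IsMinEnd (fun a b => m b a) (fun a b => e b a) j₁ i₁ :=
  ⟨h.1, h.2.1, fun x y h1 h2 h3 h4 => (h.2.2 y x h2 h1 h3 h4).symm⟩

lemma AllBlocked.swap (hB : AllBlocked m e δ δ' i₁ j₁) :
    AllBlocked (fun a b => m b a) (fun a b => e b a) (fun a b => δ b a) (fun a b => δ' b a)
      j₁ i₁ := by
  intro i j h
  obtain ⟨h1, h2, h3, h4⟩ := hB j i h.swap
  exact ⟨h1, h2, fun hc => h4 hc.swap, fun hc => h3 hc.swap⟩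

lemma IsSource.exists_max {i j : ℕ} (h : IsSource m e i₁ j₁ i j) :
    ∃ a b, IsMaxSource m e i₁ j₁ a b ∧ i ≤ a ∧ j ≤ b := by
  obtain ⟨a, b, ⟨h1, h2, h3⟩, hmax⟩ := exists_max_sum (N := i₁ + j₁)
    (S := fun a b => IsSource m e i₁ j₁ a b ∧ i ≤ a ∧ j ≤ b) ⟨i, j, h, le_rfl, le_rfl⟩
    (by rintro a b ⟨⟨-, h1, h2, -⟩, -⟩; omega)
  refine ⟨a, b, ⟨h1, fun a' b' h4 h5 h6 => ?_⟩, h2, h3⟩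
  have := hmax a' b' ⟨h4, by omega, by omega⟩
  omega

/-- Off the last row and column an entry inherits the positivity of the rectangle and is a source.
On the last row or column, away from the two outer corners, its own gap is positive, so minimality
of the end applies. -/
lemma IsMinEnd.eq_or_isSource (hq : IsMinEnd m e i₁ j₁) {i j x y : ℕ}
    (hp : IsSource m e i₁ j₁ i j) (hm : 0 < m x y) (hix : i ≤ x) (hxi : x ≤ i₁) (hjy : j ≤ y)
    (hyj : y ≤ j₁) :
    (x = i₁ ∧ y = j₁) ∨ (x = i ∧ y = j₁) ∨ (x = i₁ ∧ y = j) ∨ IsSource m e i₁ j₁ x y := by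
  obtain ⟨h1, h2, h3, h4⟩ := hp
  rcases Nat.lt_or_ge x i₁ with hx | hx
  · rcases Nat.lt_or_ge y j₁ with hy | hy
    · exact Or.inr (Or.inr (Or.inr ⟨hm, hx, hy, h4.mono hix hjy le_rfl le_rfl⟩))
    · rcases Nat.lt_or_ge i x with hi | hi
      · exact Or.inl (hq.2.2 x y hxi hyj hm (h4 x y hi hxi (by omega) hyj))
      · omega
  · rcases Nat.lt_or_ge j y with hj | hj
    · exact Or.inl (hq.2.2 x y hxi hyj hm (h4 x y (by omega) hxi hj hyj))
    · omega

namespace IsSaturated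

lemma transpose (h : IsSaturated m m' e δ δ') :
    IsSaturated (fun x y => m y x) (fun x y => m' y x) (fun x y => e y x) (fun x y => δ y x)
      (fun x y => δ' y x) where
  toRankGap := h.toRankGap.transpose
  staircase := h.staircase.swap
  pos a b := h.pos b a
  pos' a b := h.pos' b a
  eq_zero a b := h.eq_zero b a
  ideal_le x y hx := (h.ideal_le y x hx.swap).swap
  sat x y hm hx := (h.sat y x hm hx.swap).swap

lemma exists_minEnd (h : IsSaturated m m' e δ δ') (hne : ∃ x y, 0 < e x y) :
    ∃ i₁ j₁, IsMinEnd m e i₁ j₁ := by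
  obtain ⟨x, y, hxy⟩ := hne
  obtain ⟨i, j, ⟨h1, h2⟩, hmin⟩ := exists_min_sum (S := fun i j => 0 < e i j ∧ 0 < m i j)
    (h.exists_dot hxy)
  refine ⟨i, j, h2, h1, fun x y h3 h4 h5 h6 => ?_⟩
  have := hmin x y ⟨h6, h5⟩
  omega

lemma exists_maxSource (h : IsSaturated m m' e δ δ') (hq : IsMinEnd m e i₁ j₁) :
    ∃ i j, IsMaxSource m e i₁ j₁ i j := by
  obtain ⟨i, j, h1, h2, h3, h4⟩ := h.exists_northwest hq.2.1
  obtain ⟨a, b, h5, -⟩ := IsSource.exists_max (m := m) (e := e) ⟨h3, h1, h2, h4⟩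
  exact ⟨a, b, h5⟩

/-- A position of the hull is not strictly southeast of an element of `δ` unless empty. -/
lemma not_hull (h : IsSaturated m m' e δ δ') {i j x y : ℕ} (hd : δ i j) (hm : 0 < m x y)
    (hix : i ≤ x) (hjy : j ≤ y) (hne : x ≠ i ∨ y ≠ j) : ¬ Hull e δ' x y := by
  intro hK
  obtain ⟨a, b, h1, h2, h3⟩ := h.sat x y hm hK
  have := h.staircase _ _ _ _ hd h1
  omega

/-- A maximal source is circled here, hence has zero gap, and cannot lie where the other source
guarantees a positive gap. -/
lemma not_lt_lt (h : IsSaturated m m' e δ δ') (hB : AllBlocked m e δ δ' i₁ j₁) {i j a b : ℕ}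
    (hp : IsSource m e i₁ j₁ i j) (hab : IsMaxSource m e i₁ j₁ a b) : ¬ (i < a ∧ j < b) := by
  rintro ⟨h1, h2⟩
  have h3 := h.eq_zero a b (hB a b hab).1
  have h4 := hp.2.2.2 a b h1 hab.1.2.1.le h2 hab.1.2.2.1.le
  omega

/-- The case of a source above a maximal source in the same column. -/
lemma exists_above (h : IsSaturated m m' e δ δ') (hq : IsMinEnd m e i₁ j₁)
    (hB : AllBlocked m e δ δ' i₁ j₁) {i i₂ j : ℕ} (hp : IsSource m e i₁ j₁ i j)
    (hp₂ : IsMaxSource m e i₁ j₁ i₂ j) (hlt : i < i₂)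
    (hrow : ∀ b, ¬ IsMaxSource m e i₁ j₁ i b) :
    ∃ i₀, i₀ < i₂ ∧ IsSource m e i₁ j₁ i₀ j ∧ ¬ Ideal δ i₀ j₁ ∧
      ∀ x y, i₀ ≤ x → j ≤ y → x ≤ i₁ → y ≤ j₁ → 0 < m x y →
        (x = i₀ ∧ y = j) ∨ (x = i₁ ∧ y = j₁) ∨ (x = i₀ ∧ y = j₁) ∨ (x = i₁ ∧ y = j) ∨
          (x = i₂ ∧ y = j) := by
  -- The lowest source of the column above the maximal one, so that no source lies between the two.
  obtain ⟨i₀, ⟨h1, h2, h3⟩, hmax⟩ := Nat.exists_max_of_bounded (N := i₂)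
    (S := fun x => i ≤ x ∧ x < i₂ ∧ IsSource m e i₁ j₁ x j) ⟨i, le_rfl, hlt, hp⟩
    (by rintro k ⟨-, h, -⟩; omega)
  obtain ⟨hδ₂, hm₂, hne, hsw⟩ := hB _ _ hp₂
  have hrow' : ∀ b, ¬ IsMaxSource m e i₁ j₁ i₀ b := by
    intro b hb
    rcases Nat.lt_or_ge i i₀ with hi | hi
    · have h4 := h.not_lt_lt hB hp hb
      have h5 := h.staircase _ _ _ _ (hB _ _ hb).1 hδ₂
      omega
    · obtain rfl : i₀ = i := by omega
      exact hrow b hb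
  refine ⟨i₀, h2, h3, ?_, ?_⟩
  · intro hI
    unfold Hull at hne
    push Not at hne
    -- The hull fails at (i₂, j₁) because of a position of zero gap outside the ideal of δ'. If (i₀,
    -- j₁) were in the ideal of δ, that position would lie strictly southeast of (i₀, j), where the
    -- gap is positive.
    obtain ⟨z₁, z₂, k1, k2, k3, k4⟩ := hne
    have k5 : ¬ (z₁ ≤ i₀) := fun hc => k3 (h.ideal_le _ _ (hI.mono hc k2))
    have k6 : ¬ (z₂ ≤ j) := fun hc => k3 (h.ideal_le _ _ ⟨i₂, j, hδ₂, k1, hc⟩)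
    have k7 := h3.2.2.2 z₁ z₂ (by omega) (k1.trans hp₂.1.2.1.le) (by omega) k2
    omega
  · intro x y k1 k2 k3 k4 k5
    rcases hq.eq_or_isSource h3 k5 k1 k3 k2 k4 with k6 | k6 | k6 | k6
    · omega
    · omega
    · omega
    · obtain ⟨a, b, g1, g2, g3⟩ := k6.exists_max
      have g4 := h.not_lt_lt hB h3 g1
      have g5 : a ≠ i₀ := by rintro rfl; exact hrow' _ g1
      have g6 := h.staircase _ _ _ _ (hB _ _ g1).1 hδ₂
      obtain rfl : y = j := by omega
      have g7 : x = i₂ ∨ x < i₂ := by omega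
      rcases g7 with g7 | g7
      · omega
      · have := hmax x ⟨by omega, g7, k6⟩
        omega

/-- A bound for the gap from the band to the east of a maximal source. -/
lemma band_le (h : IsSaturated m m' e δ δ') (hB : AllBlocked m e δ δ' i₁ j₁) {i j x : ℕ}
    (hp : IsMaxSource m e i₁ j₁ i j) (hix : i ≤ x) (hxi : x ≤ i₁) (hx : ¬ Hull e δ' x j) :
    e x j₁ ≤ e i j₁ + e x j := by
  obtain ⟨h1, h2, h3, -⟩ := hB _ _ hp
  -- In the rectangle [i, x) × [j, j₁) maximality leaves only the entry (i, j) of `m`. An element of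
  -- δ' dominating (i, j) stays in the rectangle, since otherwise (x, j) or (i, j₁) would lie in the
  -- hull; it supplies the entry of `m'`.
  have h4 := h.rect_le_of_single hix hp.1.2.2.1.le h2
    (fun a b k1 k2 k3 k4 k5 =>
      hp.2 a b ⟨k5, by omega, k4, hp.1.2.2.2.mono k1 k3 le_rfl le_rfl⟩ k1 k3) (by
      obtain ⟨a, b, k1, k2, k3⟩ := h.ideal_le i j ⟨i, j, h1, le_rfl, le_rfl⟩
      refine ⟨a, b, k2, ?_, k3, ?_, h.pos' a b k1⟩
      · by_contra hc
        exact hx (Ideal.hull ⟨a, b, k1, by omega, k3⟩)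
      · by_contra hc
        exact h3 (Ideal.hull ⟨a, b, k1, k2, by omega⟩))
  have h5 := h.eq_zero _ _ h1
  omega

/-- If no two maximal sources span a corner inside the hull, then there is a source in the same
column as some maximal source above it, with no maximal source in its row, or dually. -/
lemma exists_above_or_left (h : IsSaturated m m' e δ δ') (hq : IsMinEnd m e i₁ j₁)
    (hB : AllBlocked m e δ δ' i₁ j₁)
    (hJ : ∀ i j i' j', IsMaxSource m e i₁ j₁ i j → IsMaxSource m e i₁ j₁ i' j' → i < i' →
      ¬ Hull e δ' i' j) :
    (∃ i i₂ j, IsSource m e i₁ j₁ i j ∧ IsMaxSource m e i₁ j₁ i₂ j ∧ i < i₂ ∧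
      ∀ b, ¬ IsMaxSource m e i₁ j₁ i b) ∨
    (∃ i j j₂, IsSource m e i₁ j₁ i j ∧ IsMaxSource m e i₁ j₁ i j₂ ∧ j < j₂ ∧
      ∀ a, ¬ IsMaxSource m e i₁ j₁ a j) := by
  have hst : ∀ {a b c d}, IsMaxSource m e i₁ j₁ a b → IsMaxSource m e i₁ j₁ c d →
      (a < c ∧ d < b) ∨ (c < a ∧ b < d) ∨ (a = c ∧ b = d) :=
    fun h1 h2 => h.staircase _ _ _ _ (hB _ _ h1).1 (hB _ _ h2).1
  -- `band_le` transports positivity of the gap along the staircase of maximal sources. Either some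
  -- maximal source has positive gap at the east end of its row, and the topmost such source is
  -- used, or the positivity at (i₁, j₁) reaches the south end of the column of the last one.
  by_cases hY : ∃ i, ∃ j, IsMaxSource m e i₁ j₁ i j ∧ 0 < e i j₁
  · obtain ⟨i, ⟨j, hp, hpos⟩, hmin⟩ : ∃ i, (∃ j, IsMaxSource m e i₁ j₁ i j ∧ 0 < e i j₁) ∧
        ∀ i', (∃ j, IsMaxSource m e i₁ j₁ i' j ∧ 0 < e i' j₁) → i ≤ i' := by
      classical
      exact ⟨Nat.find hY, Nat.find_spec hY, fun i' hi' => Nat.find_min' hY hi'⟩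
    have he := h.eq_zero _ _ (hB _ _ hp).1
    by_cases hup : ∃ a, ∃ b, IsMaxSource m e i₁ j₁ a b ∧ a < i
    · obtain ⟨a, ⟨b, hp', hai⟩, hmax⟩ := Nat.exists_max_of_bounded (N := i)
        (S := fun a => ∃ b, IsMaxSource m e i₁ j₁ a b ∧ a < i) hup (by rintro k ⟨b, -, h⟩; omega)
      have he' := h.eq_zero _ _ (hB _ _ hp').1
      have hjb : j < b := by have := hst hp hp'; omega
      have hJ' := hJ _ _ _ _ hp' hp hai
      have hband := h.band_le hB hp' hai.le hp.1.2.1.le hJ'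
      have hz : ¬ 0 < e a j₁ := fun hc => by
        have := hmin a ⟨b, hp', hc⟩
        omega
      -- The band inequality gives e(i, b) > 0 at the corner of two neighbouring maximal sources.
      -- The entry found northwest of it is trapped in rows ≥ a and columns ≥ j, because the gap
      -- vanishes at (a, b) and (i, j). Gluing three positive regions makes it a source of (i₁, j₁).
      obtain ⟨x, y, hxi, hyb, hmxy, hxy⟩ := h.exists_northwest (x := i) (y := b) (by omega)
      have hax : a ≤ x := by
        by_contra hc
        have := hxy a b (by omega) hai.le hyb le_rfl
        omega
      have hjy : j ≤ y := by
        by_contra hc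
        have := hxy i j hxi le_rfl (by omega) hjb.le
        omega
      have hs : IsSource m e i₁ j₁ x y := by
        refine ⟨hmxy, by have := hp.1.2.1; omega, by have := hp'.1.2.2.1; omega,
          fun u v g1 g2 g3 g4 => ?_⟩
        by_cases hu : i < u
        · exact hp.1.2.2.2 u v hu g2 (by omega) g4
        · by_cases hv : b < v
          · exact hp'.1.2.2.2 u v (by omega) g2 hv g4
          · exact hxy u v g1 (by omega) g3 (by omega)
      obtain ⟨c, d, g1, g2, g3⟩ := hs.exists_max
      have g4 := h.not_lt_lt hB hs g1
      have g5 := hst g1 hp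
      have g6 := hst g1 hp'
      have g7 : ¬ (a < c ∧ c < i) := fun hc => by
        have := hmax c ⟨d, g1, hc.2⟩
        omega
      unfold Hull at hJ'
      push Not at hJ'
      obtain ⟨z₁, z₂, k1, k2, k3, k4⟩ := hJ'
      have k5 : ¬ (z₁ ≤ a) := fun hc => k3 (h.ideal_le _ _ ⟨a, b, (hB _ _ hp').1, hc, k2⟩)
      have k6 : ¬ (z₂ ≤ j) := fun hc => k3 (h.ideal_le _ _ ⟨i, j, (hB _ _ hp).1, k1, hc⟩)
      -- The obstruction to the hull at (i, b) rules out (x, y) = (a, j), and thereby a second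
      -- maximal source in the row or column that must stay free of them.
      have k7 : ¬ (x < z₁ ∧ y < z₂) := fun hc => by
        have := hxy z₁ z₂ hc.1 k1 hc.2 k2
        omega
      by_cases hci : c = i
      · left
        obtain ⟨rfl, rfl⟩ : c = i ∧ d = j := by omega
        obtain rfl : y = d := by omega
        refine ⟨x, c, y, hs, hp, by omega, fun t ht => ?_⟩
        have := hst ht hp'
        have := hst ht hp
        have hxa : x = a := by
          by_contra hc
          have := hmax x ⟨t, ht, hxi⟩
          omega
        omega
      · right
        obtain ⟨rfl, rfl⟩ : c = a ∧ d = b := by omega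
        obtain rfl : x = c := by omega
        refine ⟨x, y, d, hs, hp', by omega, fun t ht => ?_⟩
        have := hst ht hp'
        have := hst ht hp
        have g8 : ¬ (x < t ∧ t < i) := fun hc => by
          have := hmax t ⟨y, ht, hc.2⟩
          omega
        omega
    · left
      obtain ⟨x, y, hxi, hyj, hmxy, hxy⟩ := h.exists_northwest hpos
      have hjy : j ≤ y := by
        by_contra hc
        have := hxy i j hxi le_rfl (by omega) hp.1.2.2.1.le
        omega
      have hs : IsSource m e i₁ j₁ x y := by
        refine ⟨hmxy, by have := hp.1.2.1; omega, hyj, fun u v g1 g2 g3 g4 => ?_⟩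
        by_cases hu : i < u
        · exact hp.1.2.2.2 u v hu g2 (by omega) g4
        · exact hxy u v g1 (by omega) g3 (by omega)
      obtain ⟨c, d, g1, g2, g3⟩ := hs.exists_max
      have g5 := hst g1 hp
      have g6 : ¬ (c < i) := fun hc => hup ⟨c, d, g1, hc⟩
      obtain rfl : y = j := by omega
      exact ⟨x, i, y, hs, hp, hxi, fun t ht => hup ⟨x, t, ht, hxi⟩⟩
  · right
    push Not at hY
    obtain ⟨i', j', hp'⟩ := h.exists_maxSource hq
    obtain ⟨i, ⟨j, hp⟩, hmax⟩ := Nat.exists_max_of_bounded (N := i₁)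
      (S := fun a => ∃ b, IsMaxSource m e i₁ j₁ a b) ⟨i', j', hp'⟩
      (by rintro k ⟨b, h⟩; exact h.1.2.1.le)
    have he := h.eq_zero _ _ (hB _ _ hp).1
    -- With the band extended down to row i₁ and e(i, j₁) = 0, the positive gap at the end (i₁, j₁)
    -- forces e(i₁, j) > 0.
    have hband := h.band_le hB hp hp.1.2.1.le le_rfl (hB _ _ hp).2.2.2
    have h1 := hY i j hp
    have h2 := hq.2.1
    obtain ⟨x, y, hxi, hyj, hmxy, hxy⟩ := h.exists_northwest (x := i₁) (y := j) (by omega)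
    have hix : i ≤ x := by
      by_contra hc
      have := hxy i j (by omega) hp.1.2.1.le hyj le_rfl
      omega
    have hs : IsSource m e i₁ j₁ x y := by
      refine ⟨hmxy, hxi, by have := hp.1.2.2.1; omega, fun u v g1 g2 g3 g4 => ?_⟩
      by_cases hv : j < v
      · exact hp.1.2.2.2 u v (by omega) g2 hv g4
      · exact hxy u v g1 (by omega) g3 (by omega)
    obtain ⟨c, d, g1, g2, g3⟩ := hs.exists_max
    have g5 := hst g1 hp
    have g6 := hmax c ⟨d, g1⟩
    obtain rfl : x = i := by omega
    refine ⟨x, y, j, hs, hp, hyj, fun t ht => ?_⟩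
    have := hst ht hp
    have := hmax t ⟨y, ht⟩
    omega

/-- The possible positions of a move in a saturated situation. -/
lemma cases_of_minEnd (h : IsSaturated m m' e δ δ') (hq : IsMinEnd m e i₁ j₁) :
    (∃ i j, IsMaxSource m e i₁ j₁ i j ∧ (¬ δ i j ∨ 1 < m i j)) ∨
    (∃ i j, IsMaxSource m e i₁ j₁ i j ∧ δ i j ∧ m i j = 1 ∧ Hull e δ' i j₁) ∨
    (∃ i j, IsMaxSource m e i₁ j₁ i j ∧ δ i j ∧ m i j = 1 ∧ Hull e δ' i₁ j) ∨
    (∃ i₀ j₀ i₂ j₂, IsMaxSource m e i₁ j₁ i₀ j₀ ∧ IsMaxSource m e i₁ j₁ i₂ j₂ ∧ δ i₀ j₀ ∧ δ i₂ j₂ ∧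
      m i₀ j₀ = 1 ∧ m i₂ j₂ = 1 ∧ i₀ < i₂ ∧ j₂ < j₀ ∧ Hull e δ' i₂ j₀) ∨
    (∃ i₀ i₂ j, i₀ < i₂ ∧ i₂ < i₁ ∧ IsSource m e i₁ j₁ i₀ j ∧ δ i₂ j ∧ m i₂ j = 1 ∧
      ¬ Ideal δ i₀ j₁ ∧ ∀ x y, i₀ ≤ x → j ≤ y → x ≤ i₁ → y ≤ j₁ → 0 < m x y →
        (x = i₀ ∧ y = j) ∨ (x = i₁ ∧ y = j₁) ∨ (x = i₀ ∧ y = j₁) ∨ (x = i₁ ∧ y = j) ∨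
          (x = i₂ ∧ y = j)) ∨
    (∃ i j₀ j₂, j₀ < j₂ ∧ j₂ < j₁ ∧ IsSource m e i₁ j₁ i j₀ ∧ δ i j₂ ∧ m i j₂ = 1 ∧
      ¬ Ideal δ i₁ j₀ ∧ ∀ x y, i ≤ x → j₀ ≤ y → x ≤ i₁ → y ≤ j₁ → 0 < m x y →
        (x = i ∧ y = j₀) ∨ (x = i₁ ∧ y = j₁) ∨ (x = i ∧ y = j₁) ∨ (x = i₁ ∧ y = j₀) ∨
          (x = i ∧ y = j₂)) := by
  by_cases c1 : ∃ i j, IsMaxSource m e i₁ j₁ i j ∧ (¬ δ i j ∨ 1 < m i j)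
  · exact Or.inl c1
  by_cases c2 : ∃ i j, IsMaxSource m e i₁ j₁ i j ∧ δ i j ∧ m i j = 1 ∧ Hull e δ' i j₁
  · exact Or.inr (Or.inl c2)
  by_cases c3 : ∃ i j, IsMaxSource m e i₁ j₁ i j ∧ δ i j ∧ m i j = 1 ∧ Hull e δ' i₁ j
  · exact Or.inr (Or.inr (Or.inl c3))
  refine Or.inr (Or.inr (Or.inr ?_))
  have hB : AllBlocked m e δ δ' i₁ j₁ := by
    intro i j hij
    have h1 : δ i j := by
      by_contra hc
      exact c1 ⟨i, j, hij, Or.inl hc⟩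
    have h2 : m i j = 1 := by
      have : ¬ 1 < m i j := fun hc => c1 ⟨i, j, hij, Or.inr hc⟩
      have := hij.1.1
      omega
    exact ⟨h1, h2, fun hc => c2 ⟨i, j, hij, h1, h2, hc⟩, fun hc => c3 ⟨i, j, hij, h1, h2, hc⟩⟩
  by_cases c4 : ∃ i₀ j₀ i₂ j₂, IsMaxSource m e i₁ j₁ i₀ j₀ ∧ IsMaxSource m e i₁ j₁ i₂ j₂ ∧
      i₀ < i₂ ∧ Hull e δ' i₂ j₀
  · obtain ⟨i₀, j₀, i₂, j₂, h1, h2, h3, h4⟩ := c4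
    have h5 := hB _ _ h1
    have h6 := hB _ _ h2
    have h7 := h.staircase _ _ _ _ h5.1 h6.1
    exact Or.inl ⟨i₀, j₀, i₂, j₂, h1, h2, h5.1, h6.1, h5.2.1, h6.2.1, h3, by omega, h4⟩
  refine Or.inr ?_
  rcases h.exists_above_or_left hq hB (fun i j i' j' h1 h2 h3 h4 => c4 ⟨i, j, i', j', h1, h2, h3, h4⟩)
    with ⟨i, i₂, j, h1, h2, h3, h4⟩ | ⟨i, j, j₂, h1, h2, h3, h4⟩
  · left
    obtain ⟨i₀, g1, g2, g3, g4⟩ := h.exists_above hq hB h1 h2 h3 h4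
    exact ⟨i₀, i₂, j, g1, h2.1.2.1, g2, (hB _ _ h2).1, (hB _ _ h2).2.1, g3, g4⟩
  · right
    obtain ⟨j₀, g1, g2, g3, g4⟩ := h.transpose.exists_above hq.swap hB.swap h1.swap h2.swap h3
      (fun b hb => h4 b hb.swap)
    refine ⟨i, j₀, j₂, g1, h2.1.2.2.1, g2.swap, (hB _ _ h2).1, (hB _ _ h2).2.1,
      fun hc => g3 hc.swap, fun x y k1 k2 k3 k4 k5 => ?_⟩
    have := g4 y x k2 k1 k4 k3 k5
    omega

end IsSaturated

/-- The entries of the rectangle between a minimal end and a maximal source are at its corners. -/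
lemma IsMaxSource.corner {i j x y : ℕ} (hp : IsMaxSource m e i₁ j₁ i j)
    (hq : IsMinEnd m e i₁ j₁) (hm : 0 < m x y) (hix : i ≤ x) (hxi : x ≤ i₁) (hjy : j ≤ y)
    (hyj : y ≤ j₁) :
    (x = i ∧ y = j) ∨ (x = i₁ ∧ y = j₁) ∨ (x = i ∧ y = j₁) ∨ (x = i₁ ∧ y = j) := by
  rcases hq.eq_or_isSource hp.1 hm hix hxi hjy hyj with h | h | h | h
  · tauto
  · tauto
  · tauto
  · exact Or.inl (hp.2 x y h hix hjy)

end LineTwoFlags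

namespace LineTwoFlags

/-! ### Rank functions of decorated matrices -/

section Matrices

variable {q r : ℕ}

/-- The entries of a matrix, extended by zero. -/
def entry (M : Matrix (Fin q) (Fin r) ℕ) (x y : ℕ) : ℕ :=
  if h : x < q ∧ y < r then M ⟨x, h.1⟩ ⟨y, h.2⟩ else 0

/-- The rank function of a matrix: the sum of the entries strictly northwest of a position. -/
def cnt (M : Matrix (Fin q) (Fin r) ℕ) (x y : ℕ) : ℕ :=
  ∑ i : Fin q, ∑ j : Fin r, if (i : ℕ) < x ∧ (j : ℕ) < y then M i j else 0

/-- The circled positions, as a predicate on `ℕ × ℕ`. -/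
def Circled (Δ : Finset (Fin q × Fin r)) (x y : ℕ) : Prop :=
  ∃ p ∈ Δ, (p.1 : ℕ) = x ∧ (p.2 : ℕ) = y

@[simp]
lemma entry_coe (M : Matrix (Fin q) (Fin r) ℕ) (i : Fin q) (j : Fin r) : entry M i j = M i j := by
  simp [entry]

lemma entry_pos {M : Matrix (Fin q) (Fin r) ℕ} {x y : ℕ} (h : 0 < entry M x y) :
    ∃ (i : Fin q) (j : Fin r), x = i ∧ y = j ∧ 0 < M i j := by
  unfold entry at h
  split_ifs at h with hxy
  · exact ⟨⟨x, hxy.1⟩, ⟨y, hxy.2⟩, rfl, rfl, h⟩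
  · omega

@[simp]
lemma circled_coe {Δ : Finset (Fin q × Fin r)} {i : Fin q} {j : Fin r} :
    Circled Δ i j ↔ (i, j) ∈ Δ := by
  constructor
  · rintro ⟨⟨a, b⟩, h, h1, h2⟩
    rwa [← Fin.ext h1, ← Fin.ext h2]
  · exact fun h => ⟨_, h, rfl, rfl⟩

lemma ideal_circled {Δ : Finset (Fin q × Fin r)} {x y : ℕ} :
    Ideal (Circled Δ) x y ↔ ∃ p ∈ Δ, x ≤ p.1 ∧ y ≤ p.2 := by
  constructor
  · rintro ⟨a, b, ⟨p, hp, rfl, rfl⟩, h1, h2⟩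
    exact ⟨p, hp, h1, h2⟩
  · rintro ⟨p, hp, h1, h2⟩
    exact ⟨p.1, p.2, ⟨p, hp, rfl, rfl⟩, h1, h2⟩

lemma below_iff {Δ : Finset (Fin q × Fin r)} {i : Fin q} {j : Fin r} :
    Below (i, j) Δ ↔ Ideal (Circled Δ) i j := by
  rw [ideal_circled]
  rfl

lemma mem_maximalPositions {S : Finset (Fin q × Fin r)} {p : Fin q × Fin r} :
    p ∈ maximalPositions S ↔ p ∈ S ∧ ∀ s ∈ S, ¬ p < s := by
  simp [maximalPositions]

lemma ideal_maximalPositions {S : Finset (Fin q × Fin r)} {x y : ℕ} :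
    Ideal (Circled (maximalPositions S)) x y ↔ Ideal (Circled S) x y := by
  rw [ideal_circled, ideal_circled]
  constructor
  · rintro ⟨p, hp, h⟩
    exact ⟨p, (mem_maximalPositions.1 hp).1, h⟩
  · rintro ⟨p, hp, h⟩
    obtain ⟨s, hps, hs⟩ := S.exists_le_maximal hp
    refine ⟨s, mem_maximalPositions.2 ⟨hs.1, fun t ht hst => ?_⟩, ?_, ?_⟩
    · exact absurd (hs.2 ht hst.le) (not_le_of_gt hst)
    · exact h.1.trans hps.1
    · exact h.2.trans hps.2

lemma maximalPositions_eq_self {S : Finset (Fin q × Fin r)} (hS : ∀ p ∈ S, ∀ s ∈ S, ¬ p < s) :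
    maximalPositions S = S := by
  ext p
  rw [mem_maximalPositions]
  exact ⟨fun h => h.1, fun h => ⟨h, hS p h⟩⟩

lemma maximalPositions_nonempty {S : Finset (Fin q × Fin r)} (hS : S.Nonempty) :
    (maximalPositions S).Nonempty := by
  obtain ⟨p, hp⟩ := hS
  obtain ⟨a, b, ⟨p, hp, -⟩, -⟩ := ideal_maximalPositions.2 (ideal_circled.2 ⟨p, hp, le_rfl, le_rfl⟩)
  exact ⟨p, hp⟩

lemma cnt_succ_succ (M : Matrix (Fin q) (Fin r) ℕ) (x y : ℕ) :
    cnt M (x + 1) (y + 1) + cnt M x y = cnt M (x + 1) y + cnt M x (y + 1) + entry M x y := by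
  have h : entry M x y = ∑ i : Fin q, ∑ j : Fin r, if (i : ℕ) = x ∧ (j : ℕ) = y then M i j else 0 := by
    by_cases hxy : x < q ∧ y < r
    · rw [Fintype.sum_eq_single ⟨x, hxy.1⟩, Fintype.sum_eq_single ⟨y, hxy.2⟩]
      · simp [entry, hxy]
      · intro j hj
        rw [if_neg]
        rintro ⟨-, rfl⟩
        exact hj rfl
      · intro i hi
        refine Finset.sum_eq_zero fun j _ => if_neg ?_
        rintro ⟨rfl, -⟩
        exact hi rfl
    · rw [entry, dif_neg hxy]
      symm
      refine Finset.sum_eq_zero fun i _ => Finset.sum_eq_zero fun j _ => if_neg ?_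
      rintro ⟨rfl, rfl⟩
      exact hxy ⟨i.2, j.2⟩
  simp only [cnt, h, ← Finset.sum_add_distrib]
  refine Finset.sum_congr rfl fun i _ => Finset.sum_congr rfl fun j _ => ?_
  split_ifs <;> omega

lemma cnt_add (M N : Matrix (Fin q) (Fin r) ℕ) (x y : ℕ) :
    cnt (M + N) x y = cnt M x y + cnt N x y := by
  simp only [cnt, ← Finset.sum_add_distrib]
  refine Finset.sum_congr rfl fun i _ => Finset.sum_congr rfl fun j _ => ?_
  split_ifs <;> simp

lemma cnt_sum {ι : Type*} (s : Finset ι) (M : ι → Matrix (Fin q) (Fin r) ℕ) (x y : ℕ) :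
    cnt (∑ a ∈ s, M a) x y = ∑ a ∈ s, cnt (M a) x y := by
  classical
  induction s using Finset.induction_on with
  | empty => simp [cnt]
  | insert a s ha ih => rw [Finset.sum_insert ha, Finset.sum_insert ha, cnt_add, ih]

lemma E_apply (i a : Fin q) (j b : Fin r) : E i j a b = if i = a ∧ j = b then 1 else 0 := by
  simp [E, Matrix.single_apply]

lemma cnt_E (i : Fin q) (j : Fin r) (x y : ℕ) :
    cnt (E i j) x y = if (i : ℕ) < x ∧ (j : ℕ) < y then 1 else 0 := by
  rw [cnt, Fintype.sum_eq_single i, Fintype.sum_eq_single j]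
  · simp [E_apply]
  · intro b hb
    simp [E_apply, Ne.symm hb]
  · intro a ha
    simp [E_apply, Ne.symm ha]

lemma row_sum_E (i a : Fin q) (j : Fin r) : ∑ b, E i j a b = if i = a then 1 else 0 := by
  simp only [E_apply, ite_and]
  split_ifs <;> simp

lemma col_sum_E (i : Fin q) (j b : Fin r) : ∑ a, E i j a b = if j = b then 1 else 0 := by
  simp only [E_apply, and_comm (a := i = _), ite_and]
  split_ifs <;> simp

lemma cnt_zero_left (M : Matrix (Fin q) (Fin r) ℕ) (y : ℕ) : cnt M 0 y = 0 := by simp [cnt]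

lemma cnt_zero_right (M : Matrix (Fin q) (Fin r) ℕ) (x : ℕ) : cnt M x 0 = 0 := by simp [cnt]

lemma cnt_of_le_left (M : Matrix (Fin q) (Fin r) ℕ) {x : ℕ} (y : ℕ) (hx : q ≤ x) :
    cnt M x y = ∑ j : Fin r, if (j : ℕ) < y then ∑ i, M i j else 0 := by
  rw [cnt, Finset.sum_comm]
  refine Finset.sum_congr rfl fun j _ => ?_
  split_ifs with hj
  · exact Finset.sum_congr rfl fun i _ => if_pos ⟨i.2.trans_le hx, hj⟩
  · exact Finset.sum_eq_zero fun i _ => if_neg fun h => hj h.2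

lemma cnt_of_le_right (M : Matrix (Fin q) (Fin r) ℕ) (x : ℕ) {y : ℕ} (hy : r ≤ y) :
    cnt M x y = ∑ i : Fin q, if (i : ℕ) < x then ∑ j, M i j else 0 := by
  rw [cnt]
  refine Finset.sum_congr rfl fun i _ => ?_
  split_ifs with hi
  · exact Finset.sum_congr rfl fun j _ => if_pos ⟨hi, j.2.trans_le hy⟩
  · exact Finset.sum_eq_zero fun j _ => if_neg fun h => hi h.1

end Matrices

variable {n : ℕ} {b c : Composition n}

/-- The rank order on decorated matrices. -/
def RankLE (D D' : DecoratedMatrix b c) : Prop :=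
  (∀ x y, cnt D'.M x y ≤ cnt D.M x y) ∧
    ∀ x y, Ideal (Circled D.Δ) x y → cnt D.M x y = cnt D'.M x y → Ideal (Circled D'.Δ) x y

/-- The difference of the rank functions. -/
def gap (D D' : DecoratedMatrix b c) (x y : ℕ) : ℤ := cnt D.M x y - cnt D'.M x y

/-- Beyond the last row or column only the prescribed column or row sums enter, so the gap is
supported inside the grid. -/
lemma cnt_eq_of_le {D D' : DecoratedMatrix b c} {x y : ℕ} (h : b.length ≤ x ∨ c.length ≤ y) :
    cnt D.M x y = cnt D'.M x y := by
  rcases h with h | h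
  · simp only [cnt_of_le_left _ _ h, D.col_sum, D'.col_sum]
  · simp only [cnt_of_le_right _ _ h, D.row_sum, D'.row_sum]

lemma lt_of_gap_pos {D D' : DecoratedMatrix b c} {x y : ℕ} (h : 0 < gap D D' x y) :
    x < b.length ∧ y < c.length := by
  by_contra hc
  have := cnt_eq_of_le (D := D) (D' := D') (x := x) (y := y) (by omega)
  rw [gap, this] at h
  omega

lemma RankLE.rankGap {D D' : DecoratedMatrix b c} (h : RankLE D D') :
    RankGap (entry D.M) (entry D'.M) (gap D D') where
  nonneg x y := by have := h.1 x y; unfold gap; omega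
  zero_left y := by simp [gap, cnt_zero_left]
  zero_right x := by simp [gap, cnt_zero_right]
  succ_succ x y := by
    have := cnt_succ_succ D.M x y
    have := cnt_succ_succ D'.M x y
    unfold gap
    omega
  bounded := ⟨b.length + c.length, fun x y hxy => by have := lt_of_gap_pos hxy; omega⟩

lemma DecoratedMatrix.isStaircase (D : DecoratedMatrix b c) : IsStaircase (Circled D.Δ) := by
  rintro _ _ _ _ ⟨p, hp, rfl, rfl⟩ ⟨p', hp', rfl, rfl⟩
  by_cases h : p = p'
  · subst h; simp
  · have := D.northeast_southwest p hp p' hp' h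
    simp only [Fin.lt_def] at this
    tauto

lemma DecoratedMatrix.not_lt (D : DecoratedMatrix b c) : ∀ p ∈ D.Δ, ∀ s ∈ D.Δ, ¬ p < s := by
  intro p hp s hs hlt
  have h1 := D.northeast_southwest p hp s hs hlt.ne
  have h2 : p.1 ≤ s.1 ∧ p.2 ≤ s.2 := hlt.le
  rcases h1 with h1 | h1
  · exact absurd h2.2 (not_le_of_gt h1.2)
  · exact absurd h2.1 (not_le_of_gt h1.1)

/-- A decorated matrix with given matrix and circled positions generated by a given set. -/
lemma exists_decoratedMatrix (M : Matrix (Fin b.length) (Fin c.length) ℕ)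
    (hrow : ∀ i, ∑ j, M i j = b.blocksFun i) (hcol : ∀ j, ∑ i, M i j = c.blocksFun j)
    {S : Finset (Fin b.length × Fin c.length)} (hne : S.Nonempty)
    (hpos : ∀ p ∈ maximalPositions S, 0 < M p.1 p.2) :
    ∃ D : DecoratedMatrix b c, D.M = M ∧ D.Δ = maximalPositions S := by
  refine ⟨⟨M, hrow, hcol, maximalPositions S, maximalPositions_nonempty hne, ?_, hpos⟩, rfl, rfl⟩
  intro p hp p' hp' hpp'
  rw [mem_maximalPositions] at hp hp'
  have h1 := hp.2 p' hp'.1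
  have h2 := hp'.2 p hp.1
  have h3 : ¬ p ≤ p' := fun h => h1 (lt_of_le_of_ne h hpp')
  have h4 : ¬ p' ≤ p := fun h => h2 (lt_of_le_of_ne h hpp'.symm)
  rw [Prod.le_def] at h3 h4
  rcases lt_trichotomy p.1 p'.1 with h | h | h
  · exact Or.inl ⟨h, lt_of_not_ge fun hc => h3 ⟨h.le, hc⟩⟩
  · rcases le_total p.2 p'.2 with hc | hc
    · exact absurd ⟨h.le, hc⟩ h3
    · exact absurd ⟨h.ge, hc⟩ h4
  · exact Or.inr ⟨h, lt_of_not_ge fun hc => h4 ⟨h.le, hc⟩⟩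

/-- Replacing a part `A` of the matrix by a matrix `B` with the same row and column sums. -/
lemma exists_exchange (D : DecoratedMatrix b c) (A B : Matrix (Fin b.length) (Fin c.length) ℕ)
    (hrow : ∀ i, ∑ j, A i j = ∑ j, B i j) (hcol : ∀ j, ∑ i, A i j = ∑ i, B i j)
    (hA : ∀ i j, A i j ≤ D.M i j) :
    ∃ M : Matrix (Fin b.length) (Fin c.length) ℕ, (∀ i j, M i j + A i j = D.M i j + B i j) ∧
      M + A = D.M + B ∧ (∀ i, ∑ j, M i j = b.blocksFun i) ∧ ∀ j, ∑ i, M i j = c.blocksFun j := by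
  have h : ∀ i j, D.M i j + B i j - A i j + A i j = D.M i j + B i j := fun i j => by
    have := hA i j
    omega
  refine ⟨fun i j => D.M i j + B i j - A i j, h, ?_, fun i => ?_, fun j => ?_⟩
  · ext i j
    exact h i j
  · have h1 := Finset.sum_congr rfl fun j (_ : j ∈ Finset.univ) => h i j
    rw [Finset.sum_add_distrib, Finset.sum_add_distrib, hrow i, D.row_sum i] at h1
    exact Nat.add_right_cancel h1
  · have h1 := Finset.sum_congr rfl fun i (_ : i ∈ Finset.univ) => h i j
    rw [Finset.sum_add_distrib, Finset.sum_add_distrib, hcol j, D.col_sum j] at h1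
    exact Nat.add_right_cancel h1

open Classical in
/-- A measure that decreases along simple moves. -/
noncomputable def height (D : DecoratedMatrix b c) : ℕ :=
  (b.length * c.length + 1) * (∑ i : Fin b.length, ∑ j : Fin c.length, cnt D.M i j) +
    (Finset.univ.filter fun p : Fin b.length × Fin c.length => ¬ Below p D.Δ).card

lemma height_lt_of_cnt {D D₁ : DecoratedMatrix b c} (hle : ∀ x y, cnt D₁.M x y ≤ cnt D.M x y)
    (hlt : ∃ x y, cnt D₁.M x y < cnt D.M x y) : height D₁ < height D := by
  classical
  obtain ⟨x, y, hxy⟩ := hlt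
  have hr := lt_of_gap_pos (D := D) (D' := D₁) (x := x) (y := y) (by unfold gap; omega)
  have h1 : ∑ i : Fin b.length, ∑ j : Fin c.length, cnt D₁.M i j <
      ∑ i : Fin b.length, ∑ j : Fin c.length, cnt D.M i j := by
    refine Finset.sum_lt_sum (fun i _ => Finset.sum_le_sum fun j _ => hle i j)
      ⟨⟨x, hr.1⟩, Finset.mem_univ _, ?_⟩
    exact Finset.sum_lt_sum (fun j _ => hle _ j) ⟨⟨y, hr.2⟩, Finset.mem_univ _, hxy⟩
  -- The second summand of `height` stays below the weight `b.length * c.length + 1`, so one lost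
  -- unit of rank outweighs any change in it.
  have h2 : (Finset.univ.filter fun p : Fin b.length × Fin c.length => ¬ Below p D₁.Δ).card ≤
      b.length * c.length := by
    refine (Finset.card_le_univ _).trans ?_
    simp
  unfold height
  generalize ∑ i : Fin b.length, ∑ j : Fin c.length, cnt D₁.M i j = s at *
  generalize ∑ i : Fin b.length, ∑ j : Fin c.length, cnt D.M i j = t at *
  have h3 : (b.length * c.length + 1) * (s + 1) ≤ (b.length * c.length + 1) * t :=
    Nat.mul_le_mul_left _ h1
  rw [mul_add] at h3
  omega

lemma height_lt_of_below {D D₁ : DecoratedMatrix b c} (hM : D₁.M = D.M)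
    (hle : ∀ p, Below p D.Δ → Below p D₁.Δ) (hlt : ∃ p, Below p D₁.Δ ∧ ¬ Below p D.Δ) :
    height D₁ < height D := by
  classical
  unfold height
  rw [hM]
  refine Nat.add_lt_add_left (Finset.card_lt_card ?_) _
  rw [Finset.ssubset_iff_of_subset]
  · obtain ⟨p, h1, h2⟩ := hlt
    exact ⟨p, by simpa using h2, by simpa using h1⟩
  · intro p hp
    simp only [Finset.mem_filter, Finset.mem_univ, true_and] at hp ⊢
    exact fun h => hp (hle p h)

/-- An exchange with prescribed effect on the rank function leads to a decorated matrix which is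
closer to `D'`. -/
lemma exists_closer {D D' : DecoratedMatrix b c} (hD : RankLE D D')
    (A B : Matrix (Fin b.length) (Fin c.length) ℕ) (u : ℕ → ℕ → Prop)
    (hrow : ∀ i, ∑ j, A i j = ∑ j, B i j) (hcol : ∀ j, ∑ i, A i j = ∑ i, B i j)
    (hA : ∀ i j, A i j ≤ D.M i j)
    (hu : ∀ x y, u x y → cnt A x y = cnt B x y + 1)
    (hnu : ∀ x y, ¬ u x y → cnt A x y = cnt B x y)
    (hpos : ∀ x y, u x y → 0 < gap D D' x y) (hune : ∃ x y, u x y)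
    {S : Finset (Fin b.length × Fin c.length)} (hne : S.Nonempty)
    (hS : ∀ p ∈ maximalPositions S, A p.1 p.2 < D.M p.1 p.2 + B p.1 p.2)
    (hI : ∀ x y, Ideal (Circled S) x y →
      Ideal (Circled D'.Δ) x y ∨ (¬ u x y ∧ 0 < gap D D' x y) ∨ 2 ≤ gap D D' x y) :
    ∃ D₁ : DecoratedMatrix b c, D₁.M + A = D.M + B ∧ D₁.Δ = maximalPositions S ∧
      RankLE D₁ D' ∧ height D₁ < height D := by
  obtain ⟨M, hM, hMe, h1, h2⟩ := exists_exchange D A B hrow hcol hA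
  obtain ⟨D₁, rfl, hΔ⟩ := exists_decoratedMatrix M h1 h2 hne (fun p hp => by
    have := hM p.1 p.2
    have := hS p hp
    omega)
  have hc : ∀ x y, cnt D₁.M x y + cnt A x y = cnt D.M x y + cnt B x y := fun x y => by
    rw [← cnt_add, hMe, cnt_add]
  refine ⟨D₁, hMe, hΔ, ⟨fun x y => ?_, fun x y hx he => ?_⟩, height_lt_of_cnt (fun x y => ?_) ?_⟩
  · have h3 := hc x y
    by_cases h : u x y
    · have h4 := hu x y h
      have h5 := hpos x y h
      unfold gap at h5
      omega
    · have h4 := hnu x y h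
      have h5 := hD.1 x y
      omega
  · rw [hΔ, ideal_maximalPositions] at hx
    have h3 := hc x y
    rcases hI x y hx with h | h | h
    · exact h
    · have h4 := hnu x y h.1
      have h5 := h.2
      unfold gap at h5
      omega
    -- A gap of at least two stays positive when the rank drops by at most one.
    · exfalso
      unfold gap at h
      by_cases h' : u x y
      · have h4 := hu x y h'
        omega
      · have h4 := hnu x y h'
        omega
  · have h3 := hc x y
    by_cases h : u x y
    · have h4 := hu x y h
      omega
    · have h4 := hnu x y h
      omega
  · obtain ⟨x, y, h⟩ := hune
    refine ⟨x, y, ?_⟩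
    have h3 := hc x y
    have h4 := hu x y h
    omega

end LineTwoFlags

/-! ### Realizing moves (i)–(iv) inside the rank order -/

namespace LineTwoFlags

variable {n : ℕ} {b c : Composition n}

/-- A flip of two entries in a region with positive gap leads closer to `D'`. -/
lemma exists_flip {D D' : DecoratedMatrix b c} (hD : RankLE D D') {i₀ i₁ : Fin b.length}
    {j₀ j₁ : Fin c.length} (hi : i₀ < i₁) (hj : j₀ < j₁) (h₀ : 0 < D.M i₀ j₀) (h₁ : 0 < D.M i₁ j₁)
    (hpos : PosOn (gap D D') i₀ j₀ i₁ j₁)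
    {S : Finset (Fin b.length × Fin c.length)} (hne : S.Nonempty)
    (hS : ∀ p ∈ maximalPositions S, p = (i₀, j₁) ∨ p = (i₁, j₀) ∨
      (p ∈ D.Δ ∧ p ≠ (i₁, j₁) ∧ (p = (i₀, j₀) → 1 < D.M i₀ j₀)))
    (hI : ∀ x y, Ideal (Circled S) x y → Ideal (Circled D'.Δ) x y ∨
      (¬ ((i₀ : ℕ) < x ∧ x ≤ i₁ ∧ (j₀ : ℕ) < y ∧ y ≤ j₁) ∧ 0 < gap D D' x y)) :
    ∃ D₁ : DecoratedMatrix b c, IsFlip D D₁ i₀ i₁ j₀ j₁ ∧ D₁.Δ = maximalPositions S ∧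
      RankLE D₁ D' ∧ height D₁ < height D := by
  suffices hex : ∃ D₁ : DecoratedMatrix b c,
      D₁.M + (E i₀ j₀ + E i₁ j₁) = D.M + (E i₀ j₁ + E i₁ j₀) ∧ D₁.Δ = maximalPositions S ∧
        RankLE D₁ D' ∧ height D₁ < height D by
    obtain ⟨D₁, h1, h2⟩ := hex
    refine ⟨D₁, ?_, h2⟩
    rw [IsFlip, add_assoc, add_assoc]
    exact h1
  refine exists_closer hD (E i₀ j₀ + E i₁ j₁) (E i₀ j₁ + E i₁ j₀)
    (fun x y => (i₀ : ℕ) < x ∧ x ≤ i₁ ∧ (j₀ : ℕ) < y ∧ y ≤ j₁) ?_ ?_ ?_ ?_ ?_ ?_ ?_ hne ?_ ?_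
  · intro i
    simp only [Matrix.add_apply, Finset.sum_add_distrib, row_sum_E]
  · intro j
    simp only [Matrix.add_apply, Finset.sum_add_distrib, col_sum_E]
    exact add_comm _ _
  · intro i j
    simp only [Matrix.add_apply, E_apply]
    split_ifs with h3 h4 h4
    · exact absurd (h3.1.trans h4.1.symm) hi.ne
    · rw [← h3.1, ← h3.2]; omega
    · rw [← h4.1, ← h4.2]; omega
    · omega
  · intro x y h
    rw [Fin.lt_def] at hi hj
    simp only [cnt_add, cnt_E]
    split_ifs <;> omega
  · intro x y h
    rw [Fin.lt_def] at hi hj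
    simp only [cnt_add, cnt_E]
    split_ifs <;> omega
  · rintro x y ⟨h3, h4, h5, h6⟩
    exact hpos x y h3 h4 h5 h6
  · exact ⟨i₁, j₁, hi, le_rfl, hj, le_rfl⟩
  · intro p hp
    have hA : (E i₀ j₀ + E i₁ j₁) p.1 p.2 ≤ D.M p.1 p.2 := by
      simp only [Matrix.add_apply, E_apply]
      split_ifs with h3 h4 h4
      · exact absurd (h3.1.trans h4.1.symm) hi.ne
      · rw [← h3.1, ← h3.2]; omega
      · rw [← h4.1, ← h4.2]; omega
      · omega
    rcases hS p hp with rfl | rfl | ⟨h3, h4, h5⟩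
    · have : 0 < (E i₀ j₁ + E i₁ j₀) i₀ j₁ := by simp [E_apply]
      exact hA.trans_lt (Nat.lt_add_of_pos_right this)
    · have : 0 < (E i₀ j₁ + E i₁ j₀) i₁ j₀ := by simp [E_apply]
      exact hA.trans_lt (Nat.lt_add_of_pos_right this)
    · refine lt_of_lt_of_le ?_ (Nat.le_add_right _ _)
      have h6 := D.pos p h3
      obtain ⟨x, y⟩ := p
      simp only [Matrix.add_apply, E_apply]
      split_ifs with h7 h8 h8
      · exact absurd (h7.1.trans h8.1.symm) hi.ne
      · obtain ⟨rfl, rfl⟩ := h7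
        exact h5 rfl
      · obtain ⟨rfl, rfl⟩ := h8
        exact absurd rfl h4
      · exact h6
  · intro x y h
    rcases hI x y h with h | h
    · exact Or.inl h
    · exact Or.inr (Or.inl h)

/-- Circling one more position. -/
lemma exists_moveI {D D' : DecoratedMatrix b c} (hD : RankLE D D')
    (hne : ∃ x y, 0 < entry D.M x y ∧ Hull (gap D D') (Circled D'.Δ) x y ∧
      ¬ Ideal (Circled D.Δ) x y) :
    ∃ D₁, MoveI D D₁ ∧ RankLE D₁ D' ∧ height D₁ < height D := by
  -- The hull is closed under passing northwest, so least coordinate sum yields the emptiness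
  -- condition of move (i).
  obtain ⟨x, y, ⟨h1, h2, h3⟩, hmin⟩ := exists_min_sum (S := fun x y => 0 < entry D.M x y ∧
    Hull (gap D D') (Circled D'.Δ) x y ∧ ¬ Ideal (Circled D.Δ) x y) hne
  obtain ⟨i₁, j₁, rfl, rfl, hm⟩ := entry_pos h1
  obtain ⟨D₁, hM, hΔ⟩ := exists_decoratedMatrix D.M D.row_sum D.col_sum
    (S := D.Δ ∪ {(i₁, j₁)}) ⟨(i₁, j₁), by simp⟩ (fun p hp => by
      have := (mem_maximalPositions.1 hp).1
      rw [Finset.mem_union, Finset.mem_singleton] at this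
      rcases this with h | rfl
      · exact D.pos p h
      · exact hm)
  have hId : ∀ x y, Ideal (Circled D₁.Δ) x y ↔
      Ideal (Circled D.Δ) x y ∨ (x ≤ i₁ ∧ y ≤ j₁) := by
    intro x y
    rw [hΔ, ideal_maximalPositions, ideal_circled, ideal_circled]
    simp only [Finset.mem_union, Finset.mem_singleton, or_and_right, exists_or, exists_eq_left]
  refine ⟨D₁, ⟨i₁, j₁, fun h => h3 (below_iff.1 h), hm, ?_, hM, hΔ⟩, ⟨fun x y => ?_, fun x y hx he => ?_⟩,
    height_lt_of_below hM (fun p hp => ?_) ⟨(i₁, j₁), ?_, fun h => h3 (below_iff.1 h)⟩⟩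
  · intro i j hlt hb
    by_contra hc
    have hle : (i, j) ≤ (i₁, j₁) := hlt.le
    rw [Prod.mk_le_mk, Fin.le_def, Fin.le_def] at hle
    have h4 := hmin i j ⟨by rw [entry_coe]; omega, h2.mono hle.1 hle.2, fun h => hb (below_iff.2 h)⟩
    refine hlt.ne (Prod.ext (Fin.ext ?_) (Fin.ext ?_)) <;> simp only <;> omega
  · rw [hM]
    exact hD.1 x y
  · rw [hM] at he
    rcases (hId x y).1 hx with h | h
    · exact hD.2 x y h he
    · refine (h2 x y h.1 h.2).resolve_right ?_
      unfold gap
      omega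
  · obtain ⟨i, j⟩ := p
    rw [below_iff] at hp ⊢
    exact (hId _ _).2 (Or.inl hp)
  · rw [below_iff]
    exact (hId _ _).2 (Or.inr ⟨le_rfl, le_rfl⟩)

/-- The positions strictly between two corners of a rectangle, in terms of natural numbers. -/
lemma coords_of_lt {q r : ℕ} {i i' : Fin q} {j j' : Fin r} (h : (i, j) < (i', j')) :
    (i : ℕ) ≤ i' ∧ (j : ℕ) ≤ j' ∧ ¬ ((i : ℕ) = i' ∧ (j : ℕ) = j') := by
  refine ⟨h.le.1, h.le.2, fun hc => h.ne ?_⟩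
  rw [Fin.ext hc.1, Fin.ext hc.2]

lemma coords_ne {q r : ℕ} {i i' : Fin q} {j j' : Fin r} (h : (i, j) ≠ (i', j')) :
    ¬ ((i : ℕ) = i' ∧ (j : ℕ) = j') := by
  rintro ⟨h1, h2⟩
  exact h (by rw [Fin.ext h1, Fin.ext h2])

lemma ideal_union_singleton {q r : ℕ} {Δ : Finset (Fin q × Fin r)} {i : Fin q} {j : Fin r}
    {x y : ℕ} : Ideal (Circled (Δ ∪ {(i, j)})) x y ↔
      Ideal (Circled Δ) x y ∨ (x ≤ i ∧ y ≤ j) := by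
  rw [ideal_circled, ideal_circled]
  simp only [Finset.mem_union, Finset.mem_singleton, or_and_right, exists_or, exists_eq_left]

/-- Abbreviation for the saturated situation attached to a pair of decorated matrices. -/
def Saturated (D D' : DecoratedMatrix b c) : Prop :=
  IsSaturated (entry D.M) (entry D'.M) (gap D D') (Circled D.Δ) (Circled D'.Δ)

lemma exists_moveII {D D' : DecoratedMatrix b c} (hD : RankLE D D') (hs : Saturated D D')
    {x₁ y₁ x₀ y₀ : ℕ} (hq : IsMinEnd (entry D.M) (gap D D') x₁ y₁)
    (hp : IsMaxSource (entry D.M) (gap D D') x₁ y₁ x₀ y₀)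
    (h : ¬ Circled D.Δ x₀ y₀ ∨ 1 < entry D.M x₀ y₀) :
    ∃ D₁, MoveII D D₁ ∧ RankLE D₁ D' ∧ height D₁ < height D := by
  obtain ⟨i₁, j₁, rfl, rfl, h₁⟩ := entry_pos hq.1
  obtain ⟨i₀, j₀, rfl, rfl, h₀⟩ := entry_pos hp.1.1
  rw [circled_coe, entry_coe] at h
  have hi : i₀ < i₁ := hp.1.2.1
  have hj : j₀ < j₁ := hp.1.2.2.1
  have hq' : (i₁, j₁) ∉ D.Δ := fun hc => by
    have h1 := hs.eq_zero i₁ j₁ (circled_coe.2 hc)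
    have h2 := hq.2.1
    omega
  have hself := maximalPositions_eq_self D.not_lt
  obtain ⟨D₁, g1, g2, g3⟩ := exists_flip hD hi hj h₀ h₁ hp.1.2.2.2 D.nonempty
    (by
      rw [hself]
      rintro p hpΔ
      refine Or.inr (Or.inr ⟨hpΔ, fun hc => hq' (hc ▸ hpΔ), fun hc => ?_⟩)
      rcases h with h | h
      · exact absurd (hc ▸ hpΔ) h
      · exact h)
    (fun x y hx => Or.inl (hs.ideal_le x y hx))
  refine ⟨D₁, ⟨i₀, i₁, j₀, j₁, hi, hj, h₀, h₁, ?_, hq', ?_, h, g1, g2.trans hself⟩, g3⟩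
  · intro i j k1 k2 k3 k4
    by_contra hc
    have k5 := coords_of_lt k1
    have k6 := coords_of_lt k2
    have k7 := coords_ne k3
    have k8 := coords_ne k4
    have := hp.corner hq (x := i) (y := j) (by rw [entry_coe]; omega) (by omega) (by omega)
      (by omega) (by omega)
    omega
  · by_contra hc
    push Not at hc
    -- If both corners were circled, each position weakly northwest of (i₁, j₁) would be below Δ or
    -- in the rectangle of positive gap. Then (i₁, j₁) would be in the hull, against saturation.
    have k1 : Ideal (Circled D.Δ) i₀ j₁ := ⟨_, _, circled_coe.2 hc.1, le_rfl, le_rfl⟩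
    have k2 : Ideal (Circled D.Δ) i₁ j₀ := ⟨_, _, circled_coe.2 hc.2, le_rfl, le_rfl⟩
    refine hs.not_hull (circled_coe.2 hc.1) hq.1 (by exact hi.le) le_rfl
      (Or.inl (by exact (Fin.lt_def.1 hi).ne')) fun x y g1 g2 => ?_
    by_cases hx : x ≤ i₀
    · exact Or.inl (hs.ideal_le _ _ (k1.mono hx g2))
    · by_cases hy : y ≤ j₀
      · exact Or.inl (hs.ideal_le _ _ (k2.mono g1 hy))
      · exact Or.inr (hp.1.2.2.2 x y (by omega) g1 (by omega) g2)

/-- Positions weakly northwest of the corner lie outside the rectangle where the rank drops, so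
those not below Δ' keep a positive gap and the corner may be circled. Saturation turns the hull
condition into the required emptiness. -/
lemma exists_moveIIIa {D D' : DecoratedMatrix b c} (hD : RankLE D D') (hs : Saturated D D')
    {x₁ y₁ x₀ y₀ : ℕ} (hq : IsMinEnd (entry D.M) (gap D D') x₁ y₁)
    (hp : IsMaxSource (entry D.M) (gap D D') x₁ y₁ x₀ y₀)
    (hδ : Circled D.Δ x₀ y₀) (hm : entry D.M x₀ y₀ = 1)
    (hK : Hull (gap D D') (Circled D'.Δ) x₀ y₁) :
    ∃ D₁, MoveIIIa D D₁ ∧ RankLE D₁ D' ∧ height D₁ < height D := by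
  obtain ⟨i₁, j₁, rfl, rfl, h₁⟩ := entry_pos hq.1
  obtain ⟨i₀, j₀, rfl, rfl, h₀⟩ := entry_pos hp.1.1
  rw [entry_coe] at hm
  have hi : i₀ < i₁ := hp.1.2.1
  have hj : j₀ < j₁ := hp.1.2.2.1
  have hlt : (i₀, j₀) < (i₀, j₁) := Prod.mk_lt_mk_iff_right.2 hj
  obtain ⟨D₁, g1, g2, g3⟩ := exists_flip hD hi hj h₀ h₁ hp.1.2.2.2
    (S := D.Δ ∪ {(i₀, j₁)}) ⟨(i₀, j₁), by simp⟩
    (by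
      intro p hpm
      have k1 := mem_maximalPositions.1 hpm
      rw [Finset.mem_union, Finset.mem_singleton] at k1
      rcases k1.1 with k2 | k2
      · refine Or.inr (Or.inr ⟨k2, fun hc => ?_, fun hc => ?_⟩)
        · have h1 := hs.eq_zero i₁ j₁ (circled_coe.2 (hc ▸ k2))
          have h2 := hq.2.1
          omega
        · exact absurd (hc ▸ hlt) (k1.2 (i₀, j₁) (by simp))
      · exact Or.inl k2)
    (fun x y hx => by
      rcases ideal_union_singleton.1 hx with hx | hx
      · exact Or.inl (hs.ideal_le x y hx)
      · rcases hK x y hx.1 hx.2 with h | h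
        · exact Or.inl h
        · exact Or.inr ⟨by omega, h⟩)
  refine ⟨D₁, ⟨i₀, i₁, j₀, j₁, hi, hj, circled_coe.1 hδ, hm, h₁, ?_, ?_, g1, g2⟩, g3⟩
  · intro i j k1 k2 k3
    by_contra hc
    have k5 := coords_of_lt k1
    have k6 := coords_of_lt k2
    have k7 := coords_ne k3
    have hme : 0 < entry D.M i j := by rw [entry_coe]; omega
    have := hp.corner hq hme (by omega) (by omega) (by omega) (by omega)
    refine hs.not_hull hδ hme (by omega) (by omega) (by omega) (hK.mono (by omega) (by omega))
  · intro i j k1 k2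
    by_contra hc
    rw [Prod.mk_le_mk, Fin.le_def, Fin.le_def] at k1
    exact k2 (below_iff.2 (hs.sat i j (by rw [entry_coe]; omega) (hK.mono k1.1 k1.2)))

lemma exists_moveIIIb {D D' : DecoratedMatrix b c} (hD : RankLE D D') (hs : Saturated D D')
    {x₁ y₁ x₀ y₀ : ℕ} (hq : IsMinEnd (entry D.M) (gap D D') x₁ y₁)
    (hp : IsMaxSource (entry D.M) (gap D D') x₁ y₁ x₀ y₀)
    (hδ : Circled D.Δ x₀ y₀) (hm : entry D.M x₀ y₀ = 1)
    (hK : Hull (gap D D') (Circled D'.Δ) x₁ y₀) :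
    ∃ D₁, MoveIIIb D D₁ ∧ RankLE D₁ D' ∧ height D₁ < height D := by
  obtain ⟨i₁, j₁, rfl, rfl, h₁⟩ := entry_pos hq.1
  obtain ⟨i₀, j₀, rfl, rfl, h₀⟩ := entry_pos hp.1.1
  rw [entry_coe] at hm
  have hi : i₀ < i₁ := hp.1.2.1
  have hj : j₀ < j₁ := hp.1.2.2.1
  have hlt : (i₀, j₀) < (i₁, j₀) := Prod.mk_lt_mk_iff_left.2 hi
  obtain ⟨D₁, g1, g2, g3⟩ := exists_flip hD hi hj h₀ h₁ hp.1.2.2.2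
    (S := D.Δ ∪ {(i₁, j₀)}) ⟨(i₁, j₀), by simp⟩
    (by
      intro p hpm
      have k1 := mem_maximalPositions.1 hpm
      rw [Finset.mem_union, Finset.mem_singleton] at k1
      rcases k1.1 with k2 | k2
      · refine Or.inr (Or.inr ⟨k2, fun hc => ?_, fun hc => ?_⟩)
        · have h1 := hs.eq_zero i₁ j₁ (circled_coe.2 (hc ▸ k2))
          have h2 := hq.2.1
          omega
        · exact absurd (hc ▸ hlt) (k1.2 (i₁, j₀) (by simp))
      · exact Or.inr (Or.inl k2))
    (fun x y hx => by
      rcases ideal_union_singleton.1 hx with hx | hx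
      · exact Or.inl (hs.ideal_le x y hx)
      · rcases hK x y hx.1 hx.2 with h | h
        · exact Or.inl h
        · exact Or.inr ⟨by omega, h⟩)
  refine ⟨D₁, ⟨i₀, i₁, j₀, j₁, hi, hj, circled_coe.1 hδ, hm, h₁, ?_, ?_, g1, g2⟩, g3⟩
  · intro i j k1 k2 k3
    by_contra hc
    have k5 := coords_of_lt k1
    have k6 := coords_of_lt k2
    have k7 := coords_ne k3
    have hme : 0 < entry D.M i j := by rw [entry_coe]; omega
    have := hp.corner hq hme (by omega) (by omega) (by omega) (by omega)
    refine hs.not_hull hδ hme (by omega) (by omega) (by omega) (hK.mono (by omega) (by omega))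
  · intro i j k1 k2
    by_contra hc
    rw [Prod.mk_le_mk, Fin.le_def, Fin.le_def] at k1
    exact k2 (below_iff.2 (hs.sat i j (by rw [entry_coe]; omega) (hK.mono k1.1 k1.2)))

/-- The set Δ can be kept: the source lies above a circled position in its column, so it is not
circled itself. -/
lemma exists_moveIVb {D D' : DecoratedMatrix b c} (hD : RankLE D D') (hs : Saturated D D')
    {x₁ y₁ x₀ x₂ y : ℕ} (hq : IsMinEnd (entry D.M) (gap D D') x₁ y₁)
    (hp : IsSource (entry D.M) (gap D D') x₁ y₁ x₀ y) (h02 : x₀ < x₂) (h21 : x₂ < x₁)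
    (hδ : Circled D.Δ x₂ y) (hm : entry D.M x₂ y = 1) (hI : ¬ Ideal (Circled D.Δ) x₀ y₁)
    (hz : ∀ a b, x₀ ≤ a → y ≤ b → a ≤ x₁ → b ≤ y₁ → 0 < entry D.M a b →
        (a = x₀ ∧ b = y) ∨ (a = x₁ ∧ b = y₁) ∨ (a = x₀ ∧ b = y₁) ∨ (a = x₁ ∧ b = y) ∨
          (a = x₂ ∧ b = y)) :
    ∃ D₁, MoveIVb D D₁ ∧ RankLE D₁ D' ∧ height D₁ < height D := by
  obtain ⟨i₁, j₁, rfl, rfl, h₁⟩ := entry_pos hq.1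
  obtain ⟨i₀, j₀, rfl, rfl, h₀⟩ := entry_pos hp.1
  obtain ⟨⟨i₂, j⟩, h2, rfl, hj'⟩ := hδ
  obtain rfl : j = j₀ := Fin.ext hj'
  simp only [entry_coe] at hm
  have hi : i₀ < i₁ := hp.2.1
  have hj : j < j₁ := hp.2.2.1
  have hself := maximalPositions_eq_self D.not_lt
  obtain ⟨D₁, g1, g2, g3⟩ := exists_flip hD hi hj h₀ h₁ hp.2.2.2 D.nonempty
    (by
      rw [hself]
      rintro p hpΔ
      refine Or.inr (Or.inr ⟨hpΔ, fun hc => ?_, fun hc => ?_⟩)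
      · have h1 := hs.eq_zero i₁ j₁ (circled_coe.2 (hc ▸ hpΔ))
        have h2 := hq.2.1
        omega
      · exact absurd (hc ▸ Prod.mk_lt_mk_iff_left.2 h02) (D.not_lt p hpΔ _ h2))
    (fun x y hx => Or.inl (hs.ideal_le x y hx))
  refine ⟨D₁, ⟨i₀, i₁, i₂, j, j₁, h02, h21, hj, h₀, h₁, h2, hm, fun hc => hI (below_iff.1 hc), ?_,
    g1, g2.trans hself⟩, g3⟩
  intro a b k1 k2 k3 k4 k5
  by_contra hc
  have l1 := coords_of_lt k1
  have l2 := coords_of_lt k2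
  have l3 := coords_ne k3
  have l4 := coords_ne k4
  have l5 := coords_ne k5
  have := hz a b (by omega) (by omega) (by omega) (by omega) (by rw [entry_coe]; omega)
  simp only at this
  omega

lemma exists_moveIVc {D D' : DecoratedMatrix b c} (hD : RankLE D D') (hs : Saturated D D')
    {x₁ y₁ x y₀ y₂ : ℕ} (hq : IsMinEnd (entry D.M) (gap D D') x₁ y₁)
    (hp : IsSource (entry D.M) (gap D D') x₁ y₁ x y₀) (h02 : y₀ < y₂) (h21 : y₂ < y₁)
    (hδ : Circled D.Δ x y₂) (hm : entry D.M x y₂ = 1) (hI : ¬ Ideal (Circled D.Δ) x₁ y₀)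
    (hz : ∀ a b, x ≤ a → y₀ ≤ b → a ≤ x₁ → b ≤ y₁ → 0 < entry D.M a b →
        (a = x ∧ b = y₀) ∨ (a = x₁ ∧ b = y₁) ∨ (a = x ∧ b = y₁) ∨ (a = x₁ ∧ b = y₀) ∨
          (a = x ∧ b = y₂)) :
    ∃ D₁, MoveIVc D D₁ ∧ RankLE D₁ D' ∧ height D₁ < height D := by
  obtain ⟨i₁, j₁, rfl, rfl, h₁⟩ := entry_pos hq.1
  obtain ⟨i₀, j₀, rfl, rfl, h₀⟩ := entry_pos hp.1
  obtain ⟨⟨i, j₂⟩, h2, hi', rfl⟩ := hδ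
  obtain rfl : i = i₀ := Fin.ext hi'
  simp only [entry_coe] at hm
  have hi : i < i₁ := hp.2.1
  have hj : j₀ < j₁ := hp.2.2.1
  have hself := maximalPositions_eq_self D.not_lt
  obtain ⟨D₁, g1, g2, g3⟩ := exists_flip hD hi hj h₀ h₁ hp.2.2.2 D.nonempty
    (by
      rw [hself]
      rintro p hpΔ
      refine Or.inr (Or.inr ⟨hpΔ, fun hc => ?_, fun hc => ?_⟩)
      · have h1 := hs.eq_zero i₁ j₁ (circled_coe.2 (hc ▸ hpΔ))
        have h2 := hq.2.1
        omega
      · exact absurd (hc ▸ Prod.mk_lt_mk_iff_right.2 h02) (D.not_lt p hpΔ _ h2))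
    (fun x y hx => Or.inl (hs.ideal_le x y hx))
  refine ⟨D₁, ⟨i, i₁, j₀, j₁, j₂, hi, h02, h21, h₀, h₁, h2, hm, fun hc => hI (below_iff.1 hc), ?_,
    g1, g2.trans hself⟩, g3⟩
  intro a b k1 k2 k3 k4 k5
  by_contra hc
  have l1 := coords_of_lt k1
  have l2 := coords_of_lt k2
  have l3 := coords_ne k3
  have l4 := coords_ne k4
  have l5 := coords_ne k5
  have := hz a b (by omega) (by omega) (by omega) (by omega) (by rw [entry_coe]; omega)
  simp only at this
  omega

/-- The rank drops by one on the union of the rectangles spanned by the two sources with the common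
end. The newly circled corner lies outside this union, and it dominates both sources, so their
simple entries may be removed. -/
lemma exists_moveIVa {D D' : DecoratedMatrix b c} (hD : RankLE D D') (hs : Saturated D D')
    {x₁ y₁ x₀ y₀ x₂ y₂ : ℕ} (hq : IsMinEnd (entry D.M) (gap D D') x₁ y₁)
    (hp : IsMaxSource (entry D.M) (gap D D') x₁ y₁ x₀ y₀)
    (hp₂ : IsMaxSource (entry D.M) (gap D D') x₁ y₁ x₂ y₂)
    (hδ : Circled D.Δ x₀ y₀) (hδ₂ : Circled D.Δ x₂ y₂) (hm : entry D.M x₀ y₀ = 1)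
    (hm₂ : entry D.M x₂ y₂ = 1) (hx : x₀ < x₂) (hy : y₂ < y₀)
    (hK : Hull (gap D D') (Circled D'.Δ) x₂ y₀) :
    ∃ D₁, MoveIVa D D₁ ∧ RankLE D₁ D' ∧ height D₁ < height D := by
  obtain ⟨i₁, j₁, rfl, rfl, h₁⟩ := entry_pos hq.1
  obtain ⟨i₀, j₀, rfl, rfl, h₀⟩ := entry_pos hp.1.1
  obtain ⟨i₂, j₂, rfl, rfl, h₂⟩ := entry_pos hp₂.1.1
  rw [entry_coe] at hm hm₂
  rw [circled_coe] at hδ hδ₂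
  have hx1 : (i₂ : ℕ) < i₁ := hp₂.1.2.1
  have hy1 : (j₀ : ℕ) < j₁ := hp.1.2.2.1
  have hA : ∀ i j, (E i₀ j₀ + E i₁ j₁ + E i₂ j₂) i j ≤ D.M i j := by
    intro i j
    simp only [Matrix.add_apply, E_apply, Fin.ext_iff]
    by_cases c1 : (i₀ : ℕ) = i ∧ (j₀ : ℕ) = j
    · rw [← Fin.ext c1.1, ← Fin.ext c1.2]
      split_ifs <;> omega
    · by_cases c2 : (i₁ : ℕ) = i ∧ (j₁ : ℕ) = j
      · rw [← Fin.ext c2.1, ← Fin.ext c2.2]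
        split_ifs <;> omega
      · by_cases c3 : (i₂ : ℕ) = i ∧ (j₂ : ℕ) = j
        · rw [← Fin.ext c3.1, ← Fin.ext c3.2]
          split_ifs <;> omega
        · simp [c1, c2, c3]
  obtain ⟨D₁, g1, g2, g3⟩ := exists_closer hD (E i₀ j₀ + E i₁ j₁ + E i₂ j₂)
    (E i₁ j₂ + E i₂ j₀ + E i₀ j₁)
    (fun x y => ((i₀ : ℕ) < x ∧ x ≤ i₁ ∧ (j₀ : ℕ) < y ∧ y ≤ j₁) ∨
      ((i₂ : ℕ) < x ∧ x ≤ i₁ ∧ (j₂ : ℕ) < y ∧ y ≤ j₁))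
    (by
      intro i
      simp only [Matrix.add_apply, Finset.sum_add_distrib, row_sum_E]
      ring)
    (by
      intro i
      simp only [Matrix.add_apply, Finset.sum_add_distrib, col_sum_E]
      ring) hA
    (by
      intro x y h
      simp only [cnt_add, cnt_E]
      split_ifs <;> omega)
    (by
      intro x y h
      simp only [cnt_add, cnt_E]
      split_ifs <;> omega)
    (by
      rintro x y (h | h)
      · exact hp.1.2.2.2 x y h.1 h.2.1 h.2.2.1 h.2.2.2
      · exact hp₂.1.2.2.2 x y h.1 h.2.1 h.2.2.1 h.2.2.2)
    ⟨i₁, j₁, by omega⟩ (S := D.Δ ∪ {(i₂, j₀)}) ⟨(i₂, j₀), by simp⟩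
    (by
      intro p hpm
      have k1 := mem_maximalPositions.1 hpm
      rw [Finset.mem_union, Finset.mem_singleton] at k1
      rcases k1.1 with k2 | rfl
      · refine lt_of_lt_of_le ?_ (Nat.le_add_right _ _)
        have k3 := D.pos p k2
        have k4 := k1.2 (i₂, j₀) (by simp)
        have n0 : p ≠ (i₀, j₀) := by
          rintro rfl
          exact k4 (Prod.mk_lt_mk_iff_left.2 hx)
        have n2 : p ≠ (i₂, j₂) := by
          rintro rfl
          exact k4 (Prod.mk_lt_mk_iff_right.2 hy)
        have n1 : p ≠ (i₁, j₁) := by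
          rintro rfl
          have h1 := hs.eq_zero i₁ j₁ (circled_coe.2 k2)
          have h2 := hq.2.1
          omega
        obtain ⟨a, d⟩ := p
        have n0 := coords_ne n0
        have n1 := coords_ne n1
        have n2 := coords_ne n2
        simp only [Matrix.add_apply, E_apply, Fin.ext_iff]
        rw [if_neg (by omega), if_neg (by omega), if_neg (by omega)]
        exact k3
      · refine lt_of_le_of_lt (hA _ _) (Nat.lt_add_of_pos_right ?_)
        simp [E_apply])
    (by
      intro x y h
      rcases ideal_union_singleton.1 h with h | h
      · exact Or.inl (hs.ideal_le x y h)
      · rcases hK x y h.1 h.2 with h' | h'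
        · exact Or.inl h'
        · exact Or.inr (Or.inl ⟨by omega, h'⟩))
  refine ⟨D₁, ⟨i₀, i₁, i₂, j₀, j₁, j₂, hx, hx1, hy, hy1, hδ, hδ₂, hm, hm₂, h₁, ?_, ?_, g2⟩, g3⟩
  · intro a d k1 k2 k3 k4 k5
    by_contra hc
    have l1 := coords_of_lt k1
    have l2 := coords_of_lt k2
    have l4 := coords_ne k4
    have l5 := coords_ne k5
    have hme : 0 < entry D.M a d := by rw [entry_coe]; omega
    have k6 : ¬ ((a : ℕ) ≤ i₂ ∧ (d : ℕ) ≤ j₀) := fun hle =>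
      k3 (below_iff.2 (hs.sat a d hme (hK.mono hle.1 hle.2)))
    by_cases k7 : (i₂ : ℕ) < a
    · have := hp₂.corner hq hme (by omega) (by omega) (by omega) (by omega)
      rcases this with h | h | h | h <;> omega
    · have := hp.corner hq hme (by omega) (by omega) (by omega) (by omega)
      rcases this with h | h | h | h <;> omega
  · rw [add_assoc, add_assoc, ← add_assoc (E i₀ j₀), g1, ← add_assoc, ← add_assoc]

end LineTwoFlags

/-! ### The cyclic move (v) and the induction on height -/

namespace LineTwoFlags

variable {n : ℕ} {b c : Composition n}

/-- A staircase can be listed from northeast to southwest. -/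
lemma exists_enumeration {q r : ℕ} {X : Finset (Fin q × Fin r)} (hne : X.Nonempty)
    (hX : ∀ p ∈ X, ∀ p' ∈ X, p ≠ p' → (p.1 < p'.1 ∧ p'.2 < p.2) ∨ (p'.1 < p.1 ∧ p.2 < p'.2)) :
    ∃ (u : ℕ) (i : Fin (u + 1) → Fin q) (j : Fin (u + 1) → Fin r),
      StrictMono i ∧ StrictAnti j ∧ ∀ p, p ∈ X ↔ ∃ s, p = (i s, j s) := by
  obtain ⟨u, hu⟩ : ∃ u, (X.image Prod.fst).card = u + 1 :=
    Nat.exists_eq_succ_of_ne_zero (Finset.card_ne_zero.2 (hne.image _))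
  have hmem : ∀ s : Fin (u + 1), ∃ y, ((X.image Prod.fst).orderEmbOfFin hu s, y) ∈ X := by
    intro s
    obtain ⟨⟨x, y⟩, h1, h2⟩ := Finset.mem_image.1 (Finset.orderEmbOfFin_mem (X.image Prod.fst) hu s)
    exact ⟨y, h2 ▸ h1⟩
  choose j hj using hmem
  have hmono := ((X.image Prod.fst).orderEmbOfFin hu).strictMono
  refine ⟨u, (X.image Prod.fst).orderEmbOfFin hu, j, hmono, fun s t hst => ?_, fun p => ⟨fun hp => ?_, ?_⟩⟩
  · have h1 := hmono hst
    rcases hX _ (hj s) _ (hj t) (fun h => h1.ne (congrArg Prod.fst h)) with h | h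
    · exact h.2
    · exact absurd h.1 h1.asymm
  · have h1 : p.1 ∈ Set.range ((X.image Prod.fst).orderEmbOfFin hu) := by
      rw [Finset.range_orderEmbOfFin]
      exact Finset.mem_coe.2 (Finset.mem_image_of_mem _ hp)
    obtain ⟨s, hs⟩ := h1
    refine ⟨s, ?_⟩
    by_contra hc
    have := hX _ hp _ (hj s) hc
    simp only [hs, lt_self_iff_false, false_and, or_self] at this
  · rintro ⟨s, rfl⟩
    exact hj s

/-- The effect of a cyclic exchange on the rank function. -/
lemma cycle_count {x y i₀ j₀ : ℕ} :
    ∀ (u : ℕ) (i j : Fin (u + 1) → ℕ), StrictMono i → StrictAnti j →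
    i₀ < i 0 → j₀ < j (Fin.last u) → ∀ t : ℕ, ((∃ s, x ≤ i s ∧ y ≤ j s) → t = 1) →
    ((∀ s, ¬ (x ≤ i s ∧ y ≤ j s)) → t = 0) →
    1 + ∑ s, (if i s < x ∧ j s < y then 1 else 0) =
      (if j 0 < y then 1 else 0) +
        ∑ s : Fin u, (if i s.castSucc < x ∧ j s.succ < y then 1 else 0) +
        (if i (Fin.last u) < x then 1 else 0) + t := by
  -- `t` is 1 or 0 according to whether (x, y) is weakly northwest of the staircase. The conditions
  -- i₀ < x and j₀ < y have already been simplified away from the summands. The induction drops the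
  -- last step of the staircase.
  intro u
  induction u with
  | zero =>
    intro i j hi hj h1 h2 t ht ht'
    have h3 : (∀ s : Fin 1, ¬ (x ≤ i s ∧ y ≤ j s)) ↔ ¬ (x ≤ i 0 ∧ y ≤ j 0) := by simp
    have ht0 : (x ≤ i 0 ∧ y ≤ j 0) → t = 1 := fun h => ht ⟨0, h⟩
    have ht1 := fun h => ht' (h3.2 h)
    have h4 : ∑ s : Fin (0 + 1), (if i s < x ∧ j s < y then 1 else 0) =
        if i 0 < x ∧ j 0 < y then 1 else 0 := Fin.sum_univ_one _
    rw [h4, Fin.sum_univ_zero]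
    simp only [Fin.last_zero] at *
    split_ifs <;> omega
  | succ u ih =>
    intro i j hi hj h1 h2 t ht ht'
    have hj' : j (Fin.last (u + 1)) < j (Fin.last u).castSucc := hj (Fin.castSucc_lt_last _)
    have hi' : i (Fin.last u).castSucc < i (Fin.last (u + 1)) := hi (Fin.castSucc_lt_last _)
    have key : ∀ t : ℕ, ((∃ s : Fin (u + 1), x ≤ i s.castSucc ∧ y ≤ j s.castSucc) → t = 1) →
        ((∀ s : Fin (u + 1), ¬ (x ≤ i s.castSucc ∧ y ≤ j s.castSucc)) → t = 0) →
        1 + ∑ s : Fin (u + 1), (if i s.castSucc < x ∧ j s.castSucc < y then 1 else 0) =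
          (if j 0 < y then 1 else 0) +
            ∑ s : Fin u, (if i s.castSucc.castSucc < x ∧ j s.castSucc.succ < y then 1 else 0) +
            (if i (Fin.last u).castSucc < x then 1 else 0) + t := ih (fun s => i s.castSucc) (fun s => j s.castSucc)
      (fun s t hst => hi (Fin.castSucc_lt_castSucc_iff.2 hst))
      (fun s t hst => hj (Fin.castSucc_lt_castSucc_iff.2 hst)) h1 (h2.trans hj')
    have hle : ∀ s : Fin (u + 1), i s.castSucc ≤ i (Fin.last u).castSucc := fun s =>
      hi.monotone (Fin.castSucc_le_castSucc_iff.2 (Fin.le_last s))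
    rw [Fin.sum_univ_castSucc, Fin.sum_univ_castSucc (n := u)
      (f := fun s => if i s.castSucc < x ∧ j s.succ < y then 1 else 0)]
    rw [show (Fin.last u).succ = Fin.last (u + 1) from rfl]
    by_cases hQ : ∃ s : Fin (u + 1), x ≤ i s.castSucc ∧ y ≤ j s.castSucc
    · obtain ⟨s, hs⟩ := hQ
      have k1 := key 1 (fun _ => rfl) (fun hc => absurd hs (hc s))
      have k2 := ht ⟨s.castSucc, hs⟩
      have k3 := hle s
      have k4 : ¬ (i (Fin.last u).castSucc < x) := by omega
      have k5 : ¬ (i (Fin.last (u + 1)) < x) := by omega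
      split_ifs at k1 ⊢ <;> omega
    · have k1 := key 0 (fun hc => absurd hc hQ) (fun _ => rfl)
      have k2 : ¬ (x ≤ i (Fin.last u).castSucc ∧ y ≤ j (Fin.last u).castSucc) :=
        fun hc => hQ ⟨_, hc⟩
      have k3 : (x ≤ i (Fin.last (u + 1)) ∧ y ≤ j (Fin.last (u + 1))) → t = 1 :=
        fun hc => ht ⟨_, hc⟩
      have k4 : ¬ (x ≤ i (Fin.last (u + 1)) ∧ y ≤ j (Fin.last (u + 1))) → t = 0 := by
        intro hc
        refine ht' fun s => ?_
        induction s using Fin.lastCases with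
        | last => exact hc
        | cast s => exact fun h => hQ ⟨s, h⟩
      split_ifs at k1 ⊢ <;> omega

lemma ideal_union {q r : ℕ} {S T : Finset (Fin q × Fin r)} {x y : ℕ} :
    Ideal (Circled (S ∪ T)) x y ↔ Ideal (Circled S) x y ∨ Ideal (Circled T) x y := by
  simp only [ideal_circled, Finset.mem_union, or_and_right, exists_or]

lemma exists_moveV {D D' : DecoratedMatrix b c} (hD : RankLE D D')
    (hpos : ∃ x y, Circled D.Δ x y ∧ 0 < gap D D' x y) :
    ∃ D₁, MoveV D D₁ ∧ RankLE D₁ D' ∧ height D₁ < height D := by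
  classical
  have hI : ∀ x y, Ideal (Circled D.Δ) x y → gap D D' x y = 0 → Ideal (Circled D'.Δ) x y := by
    intro x y h1 h2
    refine hD.2 x y h1 ?_
    unfold gap at h2
    omega
  obtain ⟨x₀, y₀, hm, hX, hempty, hge⟩ := hD.rankGap.exists_pivot D.isStaircase hI hpos
  obtain ⟨i₀, j₀, rfl, rfl, h₀⟩ := entry_pos hm
  -- The cycle runs through all circled positions that the pivot reaches through positive gaps.
  obtain ⟨X, hXdef⟩ : ∃ X, X = D.Δ.filter
    fun p => i₀ < p.1 ∧ j₀ < p.2 ∧ PosOn (gap D D') i₀ j₀ p.1 p.2 := ⟨_, rfl⟩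
  have hXmem : ∀ p, p ∈ X ↔ p ∈ D.Δ ∧ i₀ < p.1 ∧ j₀ < p.2 ∧ PosOn (gap D D') i₀ j₀ p.1 p.2 := by
    intro p
    rw [hXdef, Finset.mem_filter]
  have hXne : X.Nonempty := by
    obtain ⟨a, d, ⟨p, hp, rfl, rfl⟩, h1, h2, h3⟩ := hX
    exact ⟨p, (hXmem p).2 ⟨hp, h1, h2, h3⟩⟩
  obtain ⟨u, i, j, hi, hj, hij⟩ := exists_enumeration hXne fun p hp p' hp' hne =>
    D.northeast_southwest p ((hXmem p).1 hp).1 p' ((hXmem p').1 hp').1 hne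
  have hs : ∀ s, (i s, j s) ∈ D.Δ ∧ i₀ < i s ∧ j₀ < j s ∧ PosOn (gap D D') i₀ j₀ (i s) (j s) :=
    fun s => (hXmem _).1 ((hij _).2 ⟨s, rfl⟩)
  have hcirc : ∀ s, Circled D.Δ (i s) (j s) := fun s => circled_coe.2 (hs s).1
  have hsum : ∀ a d, (∑ s, E (i s) (j s)) a d = if (a, d) ∈ X then 1 else 0 := by
    intro a d
    rw [Matrix.sum_apply]
    split_ifs with h
    · obtain ⟨s, hs'⟩ := (hij _).1 h
      rw [Prod.mk.injEq] at hs'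
      rw [Fintype.sum_eq_single s, E_apply, if_pos ⟨hs'.1.symm, hs'.2.symm⟩]
      intro t ht
      rw [E_apply, if_neg]
      rintro ⟨h1, -⟩
      exact ht (hi.injective (h1.trans hs'.1))
    · refine Finset.sum_eq_zero fun s _ => ?_
      rw [E_apply, if_neg]
      rintro ⟨rfl, rfl⟩
      exact h ((hij _).2 ⟨s, rfl⟩)
  have hA : ∀ a d, (E i₀ j₀ + ∑ s, E (i s) (j s)) a d ≤ D.M a d := by
    intro a d
    rw [Matrix.add_apply, hsum, E_apply]
    by_cases h1 : i₀ = a ∧ j₀ = d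
    · obtain ⟨rfl, rfl⟩ := h1
      rw [if_pos ⟨rfl, rfl⟩, if_neg fun h => lt_irrefl _ ((hXmem _).1 h).2.1]
      exact h₀
    · rw [if_neg h1]
      split_ifs with h2
      · have := D.pos _ ((hXmem _).1 h2).1
        simp only at this
        omega
      · omega
  have hcnt : ∀ x y, cnt (E i₀ j₀ + ∑ s, E (i s) (j s)) x y =
      (if (i₀ : ℕ) < x ∧ (j₀ : ℕ) < y then 1 else 0) +
        ∑ s, (if (i s : ℕ) < x ∧ (j s : ℕ) < y then 1 else 0) := by
    intro x y
    rw [cnt_add, cnt_sum, cnt_E]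
    simp only [cnt_E]
  have hcnt' : ∀ x y, cnt (E i₀ (j 0) + ∑ s : Fin u, E (i s.castSucc) (j s.succ) +
      E (i (Fin.last u)) j₀) x y = (if (i₀ : ℕ) < x ∧ (j 0 : ℕ) < y then 1 else 0) +
        ∑ s : Fin u, (if (i s.castSucc : ℕ) < x ∧ (j s.succ : ℕ) < y then 1 else 0) +
        (if (i (Fin.last u) : ℕ) < x ∧ (j₀ : ℕ) < y then 1 else 0) := by
    intro x y
    rw [cnt_add, cnt_add, cnt_sum, cnt_E, cnt_E]
    simp only [cnt_E]
  suffices hex : ∃ D₁ : DecoratedMatrix b c, D₁.M + (E i₀ j₀ + ∑ s, E (i s) (j s)) =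
      D.M + (E i₀ (j 0) + ∑ s : Fin u, E (i s.castSucc) (j s.succ) + E (i (Fin.last u)) j₀) ∧
      D₁.Δ = maximalPositions
        ((D.Δ \ ({(i₀, j₀)} ∪ Finset.univ.image fun s => (i s, j s))) ∪
          {(i₀, j 0), (i (Fin.last u), j₀)}) ∧
        RankLE D₁ D' ∧ height D₁ < height D by
    obtain ⟨D₁, g1, g2, g3⟩ := hex
    refine ⟨D₁, ⟨u, i₀, j₀, i, j, hi, hj, (hs 0).2.1, (hs _).2.2.1, fun s => (hs s).1, h₀, ?_, ?_, ?_⟩,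
      g3⟩
    · intro x y s k1 k2 k3
      by_contra hc
      have k4 := coords_of_lt k1
      have := hempty x y (i s) (j s) (hcirc s) (hs s).2.1 (hs s).2.2.1 (hs s).2.2.2 k4.1 k4.2.1 k2 k3
        (by rw [entry_coe]; omega)
      omega
    · rw [add_assoc, g1, ← add_assoc, ← add_assoc]
    · convert g2
  refine exists_closer hD _ _
    (fun x y => (i₀ : ℕ) < x ∧ (j₀ : ℕ) < y ∧ ∃ s, x ≤ i s ∧ y ≤ j s) ?_ ?_ hA ?_ ?_ ?_ ?_ ?_ ?_ ?_
  · intro a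
    simp only [Matrix.add_apply, Finset.sum_add_distrib, Matrix.sum_apply]
    rw [Finset.sum_comm, Finset.sum_comm (t := (Finset.univ : Finset (Fin u)))]
    simp only [row_sum_E]
    rw [Fin.sum_univ_castSucc, add_assoc]
  · intro a
    simp only [Matrix.add_apply, Finset.sum_add_distrib, Matrix.sum_apply]
    rw [Finset.sum_comm, Finset.sum_comm (t := (Finset.univ : Finset (Fin u)))]
    simp only [col_sum_E]
    rw [Fin.sum_univ_succ]
    ring
  · rintro x y ⟨h1, h2, h3⟩
    rw [hcnt, hcnt']
    have := cycle_count (x := x) (y := y) (i₀ := i₀) (j₀ := j₀) u (fun s => i s) (fun s => j s) (fun s t h => hi h)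
      (fun s t h => hj h) (hs 0).2.1 (hs _).2.2.1 1 (fun _ => rfl)
      (fun hc => absurd h3.choose_spec (hc _))
    simpa only [h1, h2, true_and, and_true, and_self, if_true] using this
  · intro x y h
    rw [hcnt, hcnt']
    by_cases h1 : (i₀ : ℕ) < x
    · by_cases h2 : (j₀ : ℕ) < y
      · have h3 : ¬ ∃ s, x ≤ i s ∧ y ≤ j s := fun h3 => h ⟨h1, h2, h3⟩
        have := cycle_count (x := x) (y := y) (i₀ := i₀) (j₀ := j₀) u (fun s => i s) (fun s => j s) (fun s t h => hi h)
          (fun s t h => hj h) (hs 0).2.1 (hs _).2.2.1 0 (fun hc => absurd hc h3) (fun _ => rfl)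
        simpa only [h1, h2, true_and, and_true, and_self, if_true, add_zero] using this
      · have h4 : ∀ s, ¬ ((j s : ℕ) < y) := fun s h5 => h2 ((Fin.lt_def.1 (hs s).2.2.1).trans h5)
        simp [h2, h4]
    · have h4 : ∀ s, ¬ ((i s : ℕ) < x) := fun s h5 => h1 ((Fin.lt_def.1 (hs s).2.1).trans h5)
      simp [h1, h4]
  · rintro x y ⟨h1, h2, s, h3⟩
    exact (hs s).2.2.2 x y h1 h3.1 h2 h3.2
  · exact ⟨i 0, j 0, (hs 0).2.1, (hs 0).2.2.1, 0, le_rfl, le_rfl⟩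
  · exact ⟨(i₀, j 0), by simp⟩
  · intro p hp
    have h1 := (mem_maximalPositions.1 hp).1
    rw [Finset.mem_union, Finset.mem_sdiff, Finset.mem_union, Finset.mem_singleton,
      Finset.mem_insert, Finset.mem_singleton] at h1
    rcases h1 with ⟨h1, h2⟩ | rfl | rfl
    · refine lt_of_lt_of_le ?_ (Nat.le_add_right _ _)
      have h3 : p ∉ X := fun hpX => by
        obtain ⟨s, rfl⟩ := (hij p).1 hpX
        exact h2 (Or.inr (Finset.mem_image_of_mem _ (Finset.mem_univ s)))
      rw [Matrix.add_apply, hsum, if_neg h3, E_apply, if_neg]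
      · exact D.pos p h1
      · rintro ⟨rfl, rfl⟩
        exact h2 (Or.inl rfl)
    · refine lt_of_le_of_lt (hA _ _) (Nat.lt_add_of_pos_right ?_)
      simp [E_apply]
    · refine lt_of_le_of_lt (hA _ _) (Nat.lt_add_of_pos_right ?_)
      simp [E_apply]
  · intro x y h
    have h2 : Ideal (Circled (D.Δ \ ({(i₀, j₀)} ∪ Finset.univ.image fun s => (i s, j s)))) x y ∨
        (x ≤ i₀ ∧ y ≤ j 0) ∨ (x ≤ i (Fin.last u) ∧ y ≤ j₀) := by
      rw [ideal_union] at h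
      refine h.imp id ?_
      rw [ideal_circled]
      simp
    have hid : Ideal (Circled D.Δ) x y := by
      rcases h2 with h2 | h2 | h2
      · rw [ideal_circled] at h2 ⊢
        obtain ⟨p, hp, h3⟩ := h2
        exact ⟨p, (Finset.mem_sdiff.1 hp).1, h3⟩
      · exact ⟨_, _, hcirc 0, h2.1.trans (Fin.lt_def.1 (hs 0).2.1).le, h2.2⟩
      · exact ⟨_, _, hcirc (Fin.last u), h2.1, h2.2.trans (Fin.lt_def.1 (hs _).2.2.1).le⟩
    by_cases hid' : Ideal (Circled D'.Δ) x y
    · exact Or.inl hid'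
    have hgp : 0 < gap D D' x y :=
      lt_of_le_of_ne (hD.rankGap.nonneg _ _) fun h0 => hid' (hI x y hid h0.symm)
    by_cases hu : (i₀ : ℕ) < x ∧ (j₀ : ℕ) < y ∧ ∃ s, x ≤ i s ∧ y ≤ j s
    · obtain ⟨k1, k2, s, k3, k4⟩ := hu
      refine Or.inr (Or.inr ?_)
      -- Where the rank drops the two new circles are out of reach. The position is then below a
      -- remaining circled position, one not reached by the pivot, and the choice of the pivot
      -- provides a gap of at least two.
      rcases h2 with h2 | h2 | h2
      · obtain ⟨p, hp, h3, h4⟩ := ideal_circled.1 h2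
        rw [Finset.mem_sdiff, Finset.mem_union] at hp
        refine hge x y (i s) (j s) p.1 p.2 (hcirc s) (hs s).2.1 (hs s).2.2.1 (hs s).2.2.2
          (circled_coe.2 hp.1) (fun hc => hp.2 (Or.inr ?_)) k1 k2 k3 k4 h3 h4 hid'
        obtain ⟨t, rfl⟩ := (hij p).1 ((hXmem p).2 ⟨hp.1, k1.trans_le h3, k2.trans_le h4, hc⟩)
        exact Finset.mem_image_of_mem _ (Finset.mem_univ t)
      · omega
      · omega
    · exact Or.inr (Or.inl ⟨hu, hgp⟩)

/-- Failure of both (i) and (v) is precisely what makes the pair saturated; any positive gap then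
leads to one of the moves (ii)–(iv). -/
lemma RankLE.exists_simpleMove {D D' : DecoratedMatrix b c} (hD : RankLE D D') (hne : D ≠ D') :
    ∃ D₁, SimpleMove D D₁ ∧ RankLE D₁ D' ∧ height D₁ < height D := by
  by_cases h1 : ∃ x y, 0 < entry D.M x y ∧ Hull (gap D D') (Circled D'.Δ) x y ∧
      ¬ Ideal (Circled D.Δ) x y
  · obtain ⟨D₁, h, h'⟩ := exists_moveI hD h1
    exact ⟨D₁, Or.inl h, h'⟩
  by_cases h2 : ∃ x y, Circled D.Δ x y ∧ 0 < gap D D' x y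
  · obtain ⟨D₁, h, h'⟩ := exists_moveV hD h2
    exact ⟨D₁, Or.inr (Or.inr (Or.inr (Or.inr h))), h'⟩
  push Not at h1 h2
  have hz : ∀ x y, Circled D.Δ x y → gap D D' x y = 0 := fun x y h =>
    le_antisymm (h2 x y h) (hD.rankGap.nonneg x y)
  have hle : ∀ x y, Ideal (Circled D.Δ) x y → Ideal (Circled D'.Δ) x y := by
    rintro x y ⟨a, d, g1, g2, g3⟩
    refine (hD.2 a d ⟨a, d, g1, le_rfl, le_rfl⟩ ?_).mono g2 g3
    have := hz a d g1
    unfold gap at this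
    omega
  have hs : Saturated D D' :=
    { hD.rankGap with
      staircase := D.isStaircase
      pos := by
        rintro _ _ ⟨p, hp, rfl, rfl⟩
        rw [entry_coe]
        exact D.pos p hp
      pos' := by
        rintro _ _ ⟨p, hp, rfl, rfl⟩
        rw [entry_coe]
        exact D'.pos p hp
      eq_zero := hz
      ideal_le := hle
      sat := h1 }
  by_cases h3 : ∃ x y, 0 < gap D D' x y
  · obtain ⟨i₁, j₁, hq⟩ := hs.exists_minEnd h3
    rcases hs.cases_of_minEnd hq with ⟨i, j, g1, g2⟩ | ⟨i, j, g1, g2, g3, g4⟩ |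
      ⟨i, j, g1, g2, g3, g4⟩ | ⟨i₀, j₀, i₂, j₂, g1, g2, g3, g4, g5, g6, g7, g8, g9⟩ |
      ⟨i₀, i₂, j, g1, g2, g3, g4, g5, g6, g7⟩ | ⟨i, j₀, j₂, g1, g2, g3, g4, g5, g6, g7⟩
    · obtain ⟨D₁, h, h'⟩ := exists_moveII hD hs hq g1 g2
      exact ⟨D₁, Or.inr (Or.inl h), h'⟩
    · obtain ⟨D₁, h, h'⟩ := exists_moveIIIa hD hs hq g1 g2 g3 g4
      exact ⟨D₁, Or.inr (Or.inr (Or.inl (Or.inl h))), h'⟩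
    · obtain ⟨D₁, h, h'⟩ := exists_moveIIIb hD hs hq g1 g2 g3 g4
      exact ⟨D₁, Or.inr (Or.inr (Or.inl (Or.inr h))), h'⟩
    · obtain ⟨D₁, h, h'⟩ := exists_moveIVa hD hs hq g1 g2 g3 g4 g5 g6 g7 g8 g9
      exact ⟨D₁, Or.inr (Or.inr (Or.inr (Or.inl (Or.inl h)))), h'⟩
    · obtain ⟨D₁, h, h'⟩ := exists_moveIVb hD hs hq g3 g1 g2 g4 g5 g6 g7
      exact ⟨D₁, Or.inr (Or.inr (Or.inr (Or.inl (Or.inr (Or.inl h))))), h'⟩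
    · obtain ⟨D₁, h, h'⟩ := exists_moveIVc hD hs hq g3 g1 g2 g4 g5 g6 g7
      exact ⟨D₁, Or.inr (Or.inr (Or.inr (Or.inl (Or.inr (Or.inr h))))), h'⟩
  -- Zero gap makes the matrices equal, saturation then makes the ideals equal, and a staircase is
  -- recovered from its ideal as the set of maximal elements.
  · exfalso
    push Not at h3
    have h0 : ∀ x y, gap D D' x y = 0 := fun x y =>
      le_antisymm (h3 x y) (hD.rankGap.nonneg x y)
    have hM : ∀ x y, entry D.M x y = entry D'.M x y := by
      intro x y
      have := hD.rankGap.succ_succ x y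
      simp only [h0] at this
      omega
    have hge : ∀ x y, Ideal (Circled D'.Δ) x y → Ideal (Circled D.Δ) x y := by
      rintro x y ⟨a, d, g1, g2, g3⟩
      refine (h1 a d ?_ (Ideal.hull ⟨a, d, g1, le_rfl, le_rfl⟩)).mono g2 g3
      rw [hM]
      exact hs.pos' a d g1
    have hsub : ∀ {D D' : DecoratedMatrix b c},
        (∀ x y, Ideal (Circled D.Δ) x y ↔ Ideal (Circled D'.Δ) x y) → D.Δ ⊆ D'.Δ := by
      intro D D' hiff p hp
      obtain ⟨s, hs, k1, k2⟩ := ideal_circled.1 ((hiff p.1 p.2).1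
        (ideal_circled.2 ⟨p, hp, le_rfl, le_rfl⟩))
      obtain ⟨t, ht, k3, k4⟩ := ideal_circled.1 ((hiff s.1 s.2).2
        (ideal_circled.2 ⟨s, hs, le_rfl, le_rfl⟩))
      have hpt : p = t := by
        by_contra hc
        exact D.not_lt p hp t ht (lt_of_le_of_ne ⟨k1.trans k3, k2.trans k4⟩ hc)
      subst hpt
      have hps : p = s := Prod.ext (le_antisymm k1 k3) (le_antisymm k2 k4)
      exact hps ▸ hs
    have hiff := fun x y => (⟨hle x y, hge x y⟩ :
      Ideal (Circled D.Δ) x y ↔ Ideal (Circled D'.Δ) x y)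
    refine hne (DecoratedMatrix.ext ?_ ?_)
    · ext i j
      rw [← entry_coe D.M, hM, entry_coe]
    · exact subset_antisymm (hsub hiff) (hsub fun x y => (hiff x y).symm)

theorem RankLE.moveLE {D D' : DecoratedMatrix b c} (hD : RankLE D D') : MoveLE D D' := by
  induction hh : height D using Nat.strong_induction_on generalizing D with
  | _ h ih =>
    by_cases hne : D = D'
    · subst hne
      exact Relation.ReflTransGen.refl
    · obtain ⟨D₁, h1, h2, h3⟩ := hD.exists_simpleMove hne
      exact Relation.ReflTransGen.head h1 (ih _ (hh ▸ h3) h2 rfl)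

end LineTwoFlags

namespace LineTwoFlags

open Module

/-! ### Labelled bases -/

section LowerSpan

variable {k V ι : Type*} [Field k] [AddCommGroup V] [Module k V] {q : ℕ}

/-- The span of the vectors whose label is less than `x`. -/
def lowerSpan (k : Type*) [Field k] [Module k V] (v : ι → V) (ρ : ι → Fin q) (x : ℕ) :
    Submodule k V :=
  Submodule.span k (v '' {z | (ρ z : ℕ) < x})

lemma mem_lowerSpan (v : ι → V) {ρ : ι → Fin q} {x : ℕ} {z : ι} (h : (ρ z : ℕ) < x) :
    v z ∈ lowerSpan k v ρ x :=
  Submodule.subset_span ⟨z, h, rfl⟩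

lemma lowerSpan_mono (v : ι → V) (ρ : ι → Fin q) : Monotone (lowerSpan k v ρ) := fun _ _ h =>
  Submodule.span_mono (Set.image_mono fun _ hz => lt_of_lt_of_le hz h)

lemma lowerSpan_zero (v : ι → V) (ρ : ι → Fin q) : lowerSpan k v ρ 0 = ⊥ := by
  simp [lowerSpan]

lemma lowerSpan_last (v : ι → V) (ρ : ι → Fin q) :
    lowerSpan k v ρ q = Submodule.span k (Set.range v) := by
  rw [lowerSpan, show {z | (ρ z : ℕ) < q} = Set.univ from Set.eq_univ_of_forall fun z => (ρ z).2,
    Set.image_univ]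

lemma finrank_lowerSpan_le [Fintype ι] (v : ι → V) (ρ : ι → Fin q) (x : ℕ) :
    finrank k (lowerSpan k v ρ x) ≤ ({z | (ρ z : ℕ) < x} : Finset ι).card := by
  classical
  have h := finrank_span_finset_le_card (R := k) (({z | (ρ z : ℕ) < x} : Finset ι).image v)
  rw [Finset.coe_image, Finset.coe_filter] at h
  simp only [Finset.mem_univ, true_and] at h
  exact h.trans Finset.card_image_le

lemma finrank_lowerSpan [Fintype ι] {v : ι → V} (hv : LinearIndependent k v) (ρ : ι → Fin q)
    (x : ℕ) : finrank k (lowerSpan k v ρ x) = ({z | (ρ z : ℕ) < x} : Finset ι).card := by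
  classical
  rw [lowerSpan, Set.image_eq_range, ← Fintype.card_subtype]
  exact (finrank_span_eq_card (hv.comp (Subtype.val : {z | (ρ z : ℕ) < x} → ι)
    Subtype.val_injective)).trans (Fintype.card_congr (Equiv.refl _))

end LowerSpan

section Frames

variable {n : ℕ} {b c : Composition n} {ι k : Type*} [Field k]

lemma lowerSpan_comp {v : ι → Fin n → k} {ρ : ι → Fin b.length} {σ : Fin n ≃ ι}
    (hσ : ∀ (m : Fin n) (x : ℕ), (ρ (σ m) : ℕ) < x ↔ (m : ℕ) < b.sizeUpTo x) (x : ℕ) :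
    lowerSpan k v ρ x = Submodule.span k ((v ∘ σ) '' {m | (m : ℕ) < b.sizeUpTo x}) := by
  rw [lowerSpan, Set.image_comp]
  congr 2
  ext z
  obtain ⟨m, rfl⟩ := σ.surjective z
  simp [hσ]

lemma isFrame_comp {X : TripleFlag k b c} {a : Fin n → k} {G H : ι → Fin n → k}
    (hG : LinearIndependent k G) (hH : LinearIndependent k H) {ρ : ι → Fin b.length}
    {κ : ι → Fin c.length} {σ τ : Fin n ≃ ι}
    (hσ : ∀ (m : Fin n) (x : ℕ), (ρ (σ m) : ℕ) < x ↔ (m : ℕ) < b.sizeUpTo x)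
    (hτ : ∀ (m : Fin n) (x : ℕ), (κ (τ m) : ℕ) < x ↔ (m : ℕ) < c.sizeUpTo x)
    (hA : X.line.submodule = Submodule.span k {a})
    (hB : ∀ i : Fin (b.length + 1), X.fst.space i = lowerSpan k G ρ i)
    (hC : ∀ j : Fin (c.length + 1), X.snd.space j = lowerSpan k H κ j) :
    IsFrame X a (G ∘ σ) (H ∘ τ) where
  line := hA
  fst_indep := hG.comp _ σ.injective
  snd_indep := hH.comp _ τ.injective
  fst i := (hB i).trans (lowerSpan_comp hσ i)
  snd j := (hC j).trans (lowerSpan_comp hτ j)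

end Frames

section Labelling

variable {n : ℕ} {b c : Composition n} {ι : Type*} [Fintype ι]

/-- The number of indices with a given label is the corresponding block size. -/
def IsLabelling (b : Composition n) (ρ : ι → Fin b.length) : Prop :=
  ∀ i, ({z | ρ z = i} : Finset ι).card = b.blocksFun i

lemma IsLabelling.card_lt {ρ : ι → Fin b.length} (hρ : IsLabelling b ρ) (x : ℕ) :
    ({z | (ρ z : ℕ) < x} : Finset ι).card = b.sizeUpTo x := by
  classical
  have key : ∀ x ≤ b.length, ({z | (ρ z : ℕ) < x} : Finset ι).card = b.sizeUpTo x := by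
    intro x
    induction x with
    | zero => simp
    | succ x ih =>
      intro hx
      have h1 := b.sizeUpTo_succ' ⟨x, hx⟩
      simp only at h1
      rw [h1, ← ih (by omega), ← hρ ⟨x, hx⟩, ← Finset.card_union_of_disjoint]
      · congr 1
        ext z
        simp only [Finset.mem_filter, Finset.mem_univ, true_and, Finset.mem_union, Fin.ext_iff]
        omega
      · rw [Finset.disjoint_filter]
        intro z _ h h'
        rw [h'] at h
        exact lt_irrefl _ h
  rcases le_total x b.length with h | h
  · exact key x h
  · rw [b.sizeUpTo_ofLength_le x h]
    refine Eq.trans ?_ ((key _ le_rfl).trans b.sizeUpTo_length)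
    congr 1
    ext z
    have := (ρ z).2
    simp only [Finset.mem_filter, Finset.mem_univ, true_and]
    omega

lemma IsLabelling.card {ρ : ι → Fin b.length} (hρ : IsLabelling b ρ) : Fintype.card ι = n := by
  refine Eq.trans ?_ ((hρ.card_lt _).trans b.sizeUpTo_length)
  rw [Finset.filter_true_of_mem fun z _ => (ρ z).2, Finset.card_univ]

/-- Frames are indexed by `Fin n` in the order of the flag; sorting the labels turns a labelled
basis into such a frame. -/
lemma IsLabelling.exists_sort {ρ : ι → Fin b.length} (hρ : IsLabelling b ρ) :
    ∃ σ : Fin n ≃ ι, ∀ (m : Fin n) (x : ℕ), (ρ (σ m) : ℕ) < x ↔ (m : ℕ) < b.sizeUpTo x := by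
  have e : Fin n ≃ ι := (Fintype.equivFinOfCardEq hρ.card).symm
  let f : Fin n → ℕ := fun m => ρ (e m)
  refine ⟨(Tuple.sort f).trans e, fun m x => ?_⟩
  rw [← hρ.card_lt]
  have h : (Finset.univ.filter fun m => (f ∘ Tuple.sort f) m < x).card =
      ({z | (ρ z : ℕ) < x} : Finset ι).card := by
    refine Finset.card_equiv ((Tuple.sort f).trans e) fun m => ?_
    simp [f]
  rw [← h]
  exact (Tuple.lt_card_lt_iff_apply_lt_of_monotone (Tuple.monotone_sort f)).symm

variable {k : Type*} [Field k]

/-- Comparison of flags by counting dimensions. -/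
lemma lowerSpan_eq {u w : ι → Fin n → k} {ρ ρ' : ι → Fin b.length} (hρ : IsLabelling b ρ)
    (hρ' : IsLabelling b ρ') (h : ∀ z, u z ∈ lowerSpan k w ρ (ρ' z + 1))
    (hu : LinearIndependent k u) (x : ℕ) : lowerSpan k u ρ' x = lowerSpan k w ρ x := by
  refine Submodule.eq_of_le_of_finrank_le ?_ ?_
  · refine Submodule.span_le.2 ?_
    rintro _ ⟨z, hz, rfl⟩
    exact lowerSpan_mono w ρ hz (h z)
  · rw [finrank_lowerSpan hu, hρ'.card_lt, ← hρ.card_lt]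
    exact finrank_lowerSpan_le w ρ x

lemma linearIndependent_of_top_le {u : ι → Fin n → k} (hc : Fintype.card ι = n)
    (h : ⊤ ≤ Submodule.span k (Set.range u)) : LinearIndependent k u :=
  linearIndependent_of_top_le_span_of_card_eq_finrank h (by simp [hc])

lemma top_le_span_range {u : ι → Fin n → k} (hc : Fintype.card ι = n)
    (h : LinearIndependent k u) : ⊤ ≤ Submodule.span k (Set.range u) :=
  (h.span_eq_top_of_card_eq_finrank' (by simp [hc])).ge

/-- The flag given by a labelled basis. -/
def flagOf {v : ι → Fin n → k} (hv : LinearIndependent k v) {ρ : ι → Fin b.length}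
    (hρ : IsLabelling b ρ) : PartialFlag k b where
  space i := lowerSpan k v ρ i
  mono := fun _ _ h => lowerSpan_mono v ρ h
  bot := lowerSpan_zero v ρ
  top := by
    rw [Fin.val_last, lowerSpan_last]
    exact top_le_iff.1 (top_le_span_range hρ.card hv)
  finrank_succ i := by
    rw [finrank_lowerSpan hv, finrank_lowerSpan hv, hρ.card_lt, hρ.card_lt, Fin.val_succ,
      b.sizeUpTo_succ']
    rfl

lemma isLabelling_row {M : Matrix (Fin b.length) (Fin c.length) ℕ}
    (hM : ∀ i, ∑ j, M i j = b.blocksFun i) {p : ι → Fin b.length × Fin c.length}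
    (hp : ∀ d, ({z | p z = d} : Finset ι).card = M d.1 d.2) :
    IsLabelling b fun z => (p z).1 := by
  classical
  intro i
  rw [← hM i, Finset.card_eq_sum_card_fiberwise (f := fun z => (p z).2) (t := Finset.univ)
    (fun _ _ => Finset.mem_coe.2 (Finset.mem_univ _))]
  refine Finset.sum_congr rfl fun j _ => ?_
  rw [← hp (i, j), Finset.filter_filter]
  congr 1
  ext z
  simp [Prod.ext_iff]

lemma isLabelling_col {M : Matrix (Fin b.length) (Fin c.length) ℕ}
    (hM : ∀ j, ∑ i, M i j = c.blocksFun j) {p : ι → Fin b.length × Fin c.length}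
    (hp : ∀ d, ({z | p z = d} : Finset ι).card = M d.1 d.2) :
    IsLabelling c fun z => (p z).2 := by
  classical
  intro j
  rw [← hM j, Finset.card_eq_sum_card_fiberwise (f := fun z => (p z).1) (t := Finset.univ)
    (fun _ _ => Finset.mem_coe.2 (Finset.mem_univ _))]
  refine Finset.sum_congr rfl fun i _ => ?_
  rw [← hp (i, j), Finset.filter_filter]
  congr 1
  ext z
  simp [Prod.ext_iff, and_comm]

lemma card_sigma_fiber {α : Type*} [Fintype α] [DecidableEq α] (m : α → ℕ) (d : α) :
    ({z | z.1 = d} : Finset (Σ p : α, Fin (m p))).card = m d := by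
  rw [← Fintype.card_subtype, Fintype.card_congr (Equiv.sigmaSubtype d), Fintype.card_fin]

/-- Bases adapted to two flags, together with a vector in general position relative to a set of
positions, give points of the orbit. -/
lemma mem_orbit_of_labelled (D : DecoratedMatrix b c) {X : TripleFlag k b c} {u : ι → Fin n → k}
    (hu : LinearIndependent k u) {p : ι → Fin b.length × Fin c.length}
    (hp : ∀ d, ({z | p z = d} : Finset ι).card = D.M d.1 d.2)
    (hB : ∀ i : Fin (b.length + 1), X.fst.space i = lowerSpan k u (fun z => (p z).1) i)
    (hC : ∀ j : Fin (c.length + 1), X.snd.space j = lowerSpan k u (fun z => (p z).2) j)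
    {S : Finset ι} {f : ι → k} (hf : ∀ z ∈ S, f z ≠ 0)
    (hA : X.line.submodule = Submodule.span k {∑ z ∈ S, f z • u z})
    (hΔ : D.Δ = maximalPositions (S.image p)) : X ∈ orbit k D := by
  classical
  have hrow := isLabelling_row D.row_sum hp
  have hcol := isLabelling_col D.col_sum hp
  have h1 : ∀ z ∈ S, ∃ d ∈ D.Δ, p z ≤ d := by
    intro z hz
    have h2 : Ideal (Circled (S.image p)) (p z).1 (p z).2 :=
      ideal_circled.2 ⟨p z, Finset.mem_image_of_mem _ hz, le_rfl, le_rfl⟩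
    rw [← ideal_maximalPositions, ← hΔ, ideal_circled] at h2
    obtain ⟨d, hd, h3, h4⟩ := h2
    exact ⟨d, hd, h3, h4⟩
  have h2 : ∀ d ∈ D.Δ, ∃ z ∈ S, p z = d := by
    intro d hd
    rw [hΔ, mem_maximalPositions] at hd
    exact Finset.mem_image.1 hd.1
  have : Nonempty (Fin b.length × Fin c.length) := ⟨D.nonempty.choose⟩
  have : Nonempty ι := ⟨(h2 _ D.nonempty.choose_spec).choose⟩
  -- Each summand z is assigned a maximal position `dd z` weakly southeast of its own, and `R d` is
  -- a summand sitting at d itself. Replacing `u (R d)` by the sum of all terms assigned to d is an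
  -- invertible change of basis, since the coefficient of `u (R d)` is nonzero, and it preserves
  -- both flags, since these terms sit at positions ≤ d.
  choose! dd hdd hle using h1
  choose! R hRS hR using h2
  have hddR : ∀ d ∈ D.Δ, dd (R d) = d := by
    intro d hd
    have h3 := hle _ (hRS d hd)
    rw [hR d hd] at h3
    by_contra hne
    exact D.not_lt d hd _ (hdd _ (hRS d hd)) (lt_of_le_of_ne h3 (Ne.symm hne))
  let u' : ι → Fin n → k := fun z =>
    if p z ∈ D.Δ ∧ z = R (p z) then ∑ y ∈ S with dd y = p z, f y • u y else u z
  have hu'R : ∀ d ∈ D.Δ, u' (R d) = ∑ y ∈ S with dd y = d, f y • u y := by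
    intro d hd
    have h3 : p (R d) ∈ D.Δ ∧ R d = R (p (R d)) := by rw [hR d hd]; exact ⟨hd, rfl⟩
    simp only [u', if_pos h3, hR d hd]
  have hspan : ⊤ ≤ Submodule.span k (Set.range u') := by
    refine (top_le_span_range hrow.card hu).trans (Submodule.span_le.2 ?_)
    have h3 : ∀ z, ¬ (p z ∈ D.Δ ∧ z = R (p z)) → u z ∈ Submodule.span k (Set.range u') := by
      intro z hz
      refine Submodule.subset_span ⟨z, ?_⟩
      simp only [u', if_neg hz]
    rintro _ ⟨z, rfl⟩
    by_cases hz : p z ∈ D.Δ ∧ z = R (p z)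
    · have hzS : z ∈ S := by rw [hz.2]; exact hRS _ hz.1
      have hzd : dd z = p z := by
        conv_lhs => rw [hz.2]
        exact hddR _ hz.1
      have h4 : u' z = ∑ y ∈ S with dd y = p z, f y • u y := by simp only [u', if_pos hz]
      have h5 : z ∈ ({y ∈ S | dd y = p z} : Finset ι) := by simp [hzS, hzd]
      rw [← Finset.add_sum_erase _ _ h5] at h4
      have h6 : ∑ y ∈ ({y ∈ S | dd y = p z} : Finset ι).erase z, f y • u y ∈
          Submodule.span k (Set.range u') := by
        refine Submodule.sum_mem _ fun y hy => Submodule.smul_mem _ _ (h3 y ?_)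
        rintro ⟨hy1, hy2⟩
        simp only [Finset.mem_erase, Finset.mem_filter] at hy
        refine hy.1 ?_
        have h7 : dd y = p y := by
          conv_lhs => rw [hy2]
          exact hddR _ hy1
        rw [hy2, hz.2, ← h7, hy.2.2]
      have h7 : f z • u z ∈ Submodule.span k (Set.range u') := by
        rw [← add_sub_cancel_right (f z • u z) _, ← h4]
        exact Submodule.sub_mem _ (Submodule.subset_span ⟨z, rfl⟩) h6
      exact (Submodule.smul_mem_iff _ (hf z hzS)).1 h7
    · exact h3 z hz
  have hu' := linearIndependent_of_top_le hrow.card hspan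
  have hB' : ∀ x, lowerSpan k u' (fun z => (p z).1) x = lowerSpan k u (fun z => (p z).1) x := by
    refine lowerSpan_eq hrow hrow (fun z => ?_) hu'
    by_cases hz : p z ∈ D.Δ ∧ z = R (p z)
    · simp only [u', if_pos hz]
      refine Submodule.sum_mem _ fun y hy => Submodule.smul_mem _ _ (mem_lowerSpan u ?_)
      rw [Finset.mem_filter] at hy
      have h3 := (hle y hy.1).1
      rw [hy.2] at h3
      exact Nat.lt_succ_of_le h3
    · simp only [u', if_neg hz]
      exact mem_lowerSpan u (Nat.lt_succ_self _)
  have hC' : ∀ x, lowerSpan k u' (fun z => (p z).2) x = lowerSpan k u (fun z => (p z).2) x := by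
    refine lowerSpan_eq hcol hcol (fun z => ?_) hu'
    by_cases hz : p z ∈ D.Δ ∧ z = R (p z)
    · simp only [u', if_pos hz]
      refine Submodule.sum_mem _ fun y hy => Submodule.smul_mem _ _ (mem_lowerSpan u ?_)
      rw [Finset.mem_filter] at hy
      have h3 := (hle y hy.1).2
      rw [hy.2] at h3
      exact Nat.lt_succ_of_le h3
    · simp only [u', if_neg hz]
      exact mem_lowerSpan u (Nat.lt_succ_self _)
  have hsum : ∑ z ∈ S, f z • u z = ∑ d ∈ D.Δ, u' (R d) := by
    rw [Finset.sum_congr rfl hu'R]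
    exact (Finset.sum_fiberwise_of_maps_to hdd _).symm
  have he : ∀ d : Fin b.length × Fin c.length, ∃ e : Fin (D.M d.1 d.2) ≃ {z // p z = d},
      ∀ (l : Fin (D.M d.1 d.2)), d ∈ D.Δ → ((e l : ι) = R d ↔ (l : ℕ) = 0) := by
    intro d
    have e₀ : Fin (D.M d.1 d.2) ≃ {z // p z = d} :=
      (Fintype.equivFinOfCardEq (by rw [Fintype.card_subtype, hp])).symm
    by_cases hd : d ∈ D.Δ
    · let z₀ : {z // p z = d} := ⟨R d, hR d hd⟩
      let l₀ : Fin (D.M d.1 d.2) := ⟨0, D.pos d hd⟩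
      -- The transposition gives `R d` the index 0 in its block, as `orbit` demands.
      refine ⟨e₀.trans (Equiv.swap (e₀ l₀) z₀), fun l _ => ?_⟩
      refine (Subtype.ext_iff (a2 := z₀)).symm.trans ?_
      rw [Equiv.trans_apply, Equiv.swap_apply_eq_iff, Equiv.swap_apply_right, e₀.apply_eq_iff_eq, Fin.ext_iff]
    · exact ⟨e₀, fun l h => absurd h hd⟩
  choose e he using he
  let ε : (Σ d : Fin b.length × Fin c.length, Fin (D.M d.1 d.2)) ≃ ι :=
    (Equiv.sigmaCongrRight e).trans (Equiv.sigmaFiberEquiv p)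
  have hε : ∀ z, p (ε z) = z.1 := fun z => (e z.1 z.2).2
  have hεR : ∀ z, z.1 ∈ D.Δ → (ε z = R z.1 ↔ (z.2 : ℕ) = 0) := fun z hz => he z.1 z.2 hz
  let v := (Basis.mk hu' hspan).reindex ε.symm
  have hv : ∀ z, v z = u' (ε z) := fun z => by simp [v]
  refine ⟨v, fun i => ?_, fun j => ?_, ?_⟩
  · rw [hB, ← hB', lowerSpan]
    congr 1
    ext w
    constructor
    · rintro ⟨z, hz, rfl⟩
      refine ⟨ε.symm z, ?_, by rw [hv, ε.apply_symm_apply]⟩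
      rw [Set.mem_ofPred_eq, ← hε, ε.apply_symm_apply]
      exact hz
    · rintro ⟨z, hz, rfl⟩
      exact ⟨ε z, by rw [Set.mem_ofPred_eq, hε]; exact hz, (hv z).symm⟩
  · rw [hC, ← hC', lowerSpan]
    congr 1
    ext w
    constructor
    · rintro ⟨z, hz, rfl⟩
      refine ⟨ε.symm z, ?_, by rw [hv, ε.apply_symm_apply]⟩
      rw [Set.mem_ofPred_eq, ← hε, ε.apply_symm_apply]
      exact hz
    · rintro ⟨z, hz, rfl⟩
      exact ⟨ε z, by rw [Set.mem_ofPred_eq, hε]; exact hz, (hv z).symm⟩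
  · rw [hA, hsum]
    congr 2
    refine Finset.sum_bij (fun d _ => ε.symm (R d)) (fun d hd => ?_) (fun d hd d' hd' h => ?_)
      (fun z hz => ?_) (fun d hd => ?_)
    · have h3 : (ε.symm (R d)).1 = d := by rw [← hε, ε.apply_symm_apply, hR d hd]
      refine Finset.mem_filter.2 ⟨Finset.mem_univ _, by rwa [h3], ?_⟩
      exact (hεR (ε.symm (R d)) (by rwa [h3])).1 (by rw [ε.apply_symm_apply, h3])
    · rw [ε.symm.apply_eq_iff_eq] at h
      rw [← hR d hd, ← hR d' hd', h]
    · simp only [Finset.mem_filter, Finset.mem_univ, true_and] at hz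
      exact ⟨z.1, hz.1, by rw [← (hεR z hz.1).2 hz.2, ε.symm_apply_apply]⟩
    · rw [hv, ε.apply_symm_apply]

end Labelling

end LineTwoFlags

namespace LineTwoFlags

open Module

variable {n : ℕ} {b c : Composition n} {k : Type*} [Field k]

/-! ### Degenerations along lines -/

/-- A triple lies in the closure of a set if it is the limit of a family of elements of the set whose
frames move along a line. -/
lemma mem_zariskiClosure_of_line [Infinite k] {F : Set (TripleFlag k b c)} {X : TripleFlag k b c}
    {a₀ a₁ : Fin n → k} {g₀ g₁ h₀ h₁ : Fin n → Fin n → k} (hX : IsFrame X a₀ g₀ h₀)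
    (hF : ∀ t : k, t ≠ 0 → ∃ Y ∈ F, IsFrame Y (a₀ + t • a₁) (g₀ + t • g₁) (h₀ + t • h₁)) :
    X ∈ zariskiClosure F := by
  rintro Z ⟨⟨S, hS⟩, hFZ⟩
  rw [hS X _ _ _ hX]
  intro P hP
  let α := frameCoords a₀ g₀ h₀
  let β := frameCoords a₁ g₁ h₁
  -- The equation restricted to the line of frames: a polynomial in t with a root at each t ≠ 0,
  -- hence zero over an infinite field.
  let Q : Polynomial k :=
    MvPolynomial.aeval (fun i => Polynomial.C (α i) + Polynomial.C (β i) * Polynomial.X) P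
  have hQ : ∀ t, Q.eval t = MvPolynomial.eval (fun i => α i + β i * t) P := by
    intro t
    simp only [Q]
    rw [← Polynomial.coe_evalRingHom, MvPolynomial.aeval_def, MvPolynomial.hom_eval₂]
    have h1 : (Polynomial.evalRingHom t).comp (algebraMap k (Polynomial k)) = RingHom.id k := by
      ext x
      simp
    rw [h1]
    simp only [Polynomial.coe_evalRingHom, Polynomial.eval_add, Polynomial.eval_mul,
      Polynomial.eval_C, Polynomial.eval_X]
    rfl
  have hQ0 : Q = 0 := by
    refine Polynomial.eq_zero_of_infinite_isRoot Q ?_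
    refine (Set.finite_singleton (0 : k)).infinite_compl.mono fun t ht => ?_
    obtain ⟨Y, hY, hfr⟩ := hF t ht
    have h2 := (hS Y _ _ _ hfr).1 (hFZ hY) P hP
    change Q.eval t = 0
    rw [hQ, ← h2]
    congr 2
    funext i
    rcases i with i | i | i <;> simp [α, β, frameCoords, mul_comm]
  have h3 := hQ 0
  rw [hQ0, Polynomial.eval_zero] at h3
  rw [h3]
  congr 2
  funext i
  simp [α]

lemma DegLE.refl (D : DecoratedMatrix b c) : DegLE k D D := fun _ hX _ hZ => hZ.2 hX

lemma DegLE.trans {D₁ D₂ D₃ : DecoratedMatrix b c} (h₁ : DegLE k D₁ D₂) (h₂ : DegLE k D₂ D₃) :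
    DegLE k D₁ D₃ := fun _ hX _ hZ => h₁ hX _ ⟨hZ.1, fun _ hY => h₂ hY _ hZ⟩

/-- The indices of the basis vectors at the positions of a decorated matrix. -/
abbrev Index (D : DecoratedMatrix b c) : Type :=
  Σ p : Fin b.length × Fin c.length, Fin (D.M p.1 p.2)

/-- The indices of the basis vectors whose sum spans the line. -/
def marked (D : DecoratedMatrix b c) : Finset (Index D) := {z | z.1 ∈ D.Δ ∧ (z.2 : ℕ) = 0}

lemma mem_marked {D : DecoratedMatrix b c} {z : Index D} :
    z ∈ marked D ↔ z.1 ∈ D.Δ ∧ (z.2 : ℕ) = 0 := by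
  simp [marked]

/-- To degenerate the orbit of `D'` to that of `D`, it suffices to move the second flag and the line
along lines, and to give bases of the required type for the generic members of the family. -/
lemma degLE_of_family [Infinite k] {D D' : DecoratedMatrix b c} {κ : Index D → Fin c.length}
    {S : Finset (Index D)} (hM : ∀ d, ({z | (z.1.1, κ z) = d} : Finset (Index D)).card = D'.M d.1 d.2)
    (hΔ : D'.Δ = maximalPositions (S.image fun z => (z.1.1, κ z)))
    (h : ∀ v : Basis (Index D) k (Fin n → k), ∃ (a₁ : Fin n → k) (w : Index D → Fin n → k),
      ∀ t : k, t ≠ 0 → ∃ (u : Index D → Fin n → k) (f : Index D → k), (∀ z ∈ S, f z ≠ 0) ∧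
        (∀ z, u z ∈ lowerSpan k v (fun z => z.1.1) (z.1.1 + 1)) ∧
        (∀ z, u z ∈ lowerSpan k (fun z => v z + t • w z) (fun z => z.1.2) (κ z + 1)) ∧
        (∀ z, v z ∈ Submodule.span k (Set.range u)) ∧
        ∑ z ∈ marked D, v z + t • a₁ = ∑ z ∈ S, f z • u z) :
    DegLE k D D' := by
  classical
  rintro X ⟨v, hB, hC, hA⟩
  obtain ⟨a₁, w, hfam⟩ := h v
  have hp := card_sigma_fiber fun p : Fin b.length × Fin c.length => D.M p.1 p.2
  have hrow := isLabelling_row D.row_sum hp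
  have hcol := isLabelling_col D.col_sum hp
  have hcol' := isLabelling_col D'.col_sum hM
  obtain ⟨σ, hσ⟩ := hrow.exists_sort
  obtain ⟨τ, hτ⟩ := hcol.exists_sort
  have hX := isFrame_comp v.linearIndependent v.linearIndependent hσ hτ hA hB hC
  refine mem_zariskiClosure_of_line (a₁ := a₁) (g₁ := 0) (h₁ := w ∘ τ) hX fun t ht => ?_
  obtain ⟨u, f, hf, hu1, hu2, hspan, ha⟩ := hfam t ht
  have hspan' : ⊤ ≤ Submodule.span k (Set.range u) := by
    rw [← v.span_eq]
    refine Submodule.span_le.2 ?_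
    rintro _ ⟨z, rfl⟩
    exact hspan z
  have hu := linearIndependent_of_top_le hrow.card hspan'
  -- The basis `u` keeps the rows of `D` but has columns `κ`. Counting dimensions turns the
  -- containments into equalities of flags.
  have hB' := lowerSpan_eq hrow hrow hu1 hu
  have hC' := lowerSpan_eq hcol hcol' hu2 hu
  have hH : LinearIndependent k fun z => v z + t • w z := by
    refine linearIndependent_of_top_le hrow.card ?_
    rw [← lowerSpan_last _ (fun z : Index D => z.1.2), ← hC', lowerSpan_last]
    exact hspan'
  have hne : ∑ z ∈ S, f z • u z ≠ 0 := by
    intro h0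
    obtain ⟨d, hd⟩ := D'.nonempty
    rw [hΔ, mem_maximalPositions] at hd
    obtain ⟨z, hz, -⟩ := Finset.mem_image.1 hd.1
    exact hf z hz (linearIndependent_iff'.1 hu S f h0 z hz)
  let Y : TripleFlag k b c :=
    ⟨Projectivization.mk k _ hne, flagOf v.linearIndependent hrow, flagOf hH hcol⟩
  refine ⟨Y, mem_orbit_of_labelled D' hu hM (fun i => (hB' i).symm) (fun j => (hC' j).symm) hf
    (Projectivization.submodule_mk _ _) hΔ, ?_⟩
  have h1 := isFrame_comp (X := Y) v.linearIndependent hH hσ hτ (Projectivization.submodule_mk _ _)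
    (fun _ => rfl) (fun _ => rfl)
  rw [← ha] at h1
  rw [smul_zero, add_zero]
  exact h1

/-- Translates the matrix identity of a move into the block sizes required by `degLE_of_family`, `T`
being the set of basis vectors whose column changes. -/
lemma card_relabel {D : DecoratedMatrix b c} {M' : Matrix (Fin b.length) (Fin c.length) ℕ}
    {κ : Index D → Fin c.length} (T : Finset (Index D)) (hκ : ∀ z ∉ T, κ z = z.1.2)
    (hM : M' + ∑ z ∈ T, E z.1.1 z.1.2 = D.M + ∑ z ∈ T, E z.1.1 (κ z))
    (d : Fin b.length × Fin c.length) :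
    ({z | (z.1.1, κ z) = d} : Finset (Index D)).card = M' d.1 d.2 := by
  classical
  have h1 : ∀ κ' : Index D → Fin c.length,
      ({z | (z.1.1, κ' z) = d} : Finset (Index D)).card = ∑ z, E z.1.1 (κ' z) d.1 d.2 := by
    intro κ'
    rw [Finset.card_filter]
    exact Finset.sum_congr rfl fun z _ => by simp [E_apply, Prod.ext_iff]
  have h2 := congrFun (congrFun hM d.1) d.2
  rw [Matrix.add_apply, Matrix.add_apply, Matrix.sum_apply, Matrix.sum_apply] at h2
  have h3 : D.M d.1 d.2 = ∑ z : Index D, E z.1.1 z.1.2 d.1 d.2 := by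
    rw [← h1, ← card_sigma_fiber (fun p : Fin b.length × Fin c.length => D.M p.1 p.2) d]
  have h4 := Finset.sum_add_sum_compl T fun z : Index D => E z.1.1 z.1.2 d.1 d.2
  have h5 := Finset.sum_add_sum_compl T fun z : Index D => E z.1.1 (κ z) d.1 d.2
  have h6 : ∑ z ∈ Tᶜ, E z.1.1 (κ z) d.1 d.2 = ∑ z ∈ Tᶜ, E z.1.1 z.1.2 d.1 d.2 :=
    Finset.sum_congr rfl fun z hz => by rw [hκ z (Finset.mem_compl.1 hz)]
  rw [h1]
  omega

/-- Sets that dominate each other generate the same ideal, and the maximal positions depend only on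
that ideal. -/
lemma maximalPositions_congr {q r : ℕ} {S T : Finset (Fin q × Fin r)}
    (h₁ : ∀ p ∈ S, ∃ s ∈ T, p ≤ s) (h₂ : ∀ p ∈ T, ∃ s ∈ S, p ≤ s) :
    maximalPositions S = maximalPositions T := by
  have key : ∀ {S T : Finset (Fin q × Fin r)}, (∀ p ∈ S, ∃ s ∈ T, p ≤ s) →
      (∀ p ∈ T, ∃ s ∈ S, p ≤ s) → maximalPositions S ⊆ maximalPositions T := by
    intro S T h₁ h₂ p hp
    rw [mem_maximalPositions] at hp ⊢
    obtain ⟨s, hs, hps⟩ := h₁ p hp.1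
    refine ⟨?_, fun x hx hpx => ?_⟩
    · obtain ⟨y, hy, hsy⟩ := h₂ s hs
      rcases eq_or_lt_of_le (hps.trans hsy) with h | h
      · rwa [le_antisymm hps (h ▸ hsy)]
      · exact absurd h (hp.2 y hy)
    · obtain ⟨y, hy, hxy⟩ := h₂ x hx
      exact hp.2 y hy (hpx.trans_le hxy)
  exact (key h₁ h₂).antisymm (key h₂ h₁)

lemma image_marked (D : DecoratedMatrix b c) : (marked D).image (fun z => z.1) = D.Δ := by
  ext d
  simp only [Finset.mem_image, mem_marked]
  exact ⟨by rintro ⟨z, hz, rfl⟩; exact hz.1, fun hd => ⟨⟨d, 0, D.pos d hd⟩, ⟨hd, rfl⟩, rfl⟩⟩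

/-- Only the line moves, by t times the basis vector at the new position. The marked positions need
not form an antichain, as `degLE_of_family` passes to the maximal ones. -/
lemma MoveI.degLE [Infinite k] {D D' : DecoratedMatrix b c} (h : MoveI D D') : DegLE k D D' := by
  classical
  obtain ⟨i₁, j₁, hbel, hpos, -, hM, hΔ⟩ := h
  let z₁ : Index D := ⟨(i₁, j₁), 0, hpos⟩
  have hz₁ : z₁ ∉ marked D := fun hz => hbel ⟨_, (mem_marked.1 hz).1, le_rfl⟩
  refine degLE_of_family (κ := fun z => z.1.2) (S := insert z₁ (marked D))
    (card_relabel ∅ (fun _ _ => rfl) (by simp [hM])) ?_ fun v => ⟨v z₁, 0, fun t ht =>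
      ⟨v, fun z => if z = z₁ then t else 1, ?_, fun z => mem_lowerSpan _ (Nat.lt_succ_self _),
        fun z => ?_, fun z => Submodule.subset_span ⟨z, rfl⟩, ?_⟩⟩
  · rw [hΔ]
    congr 1
    rw [Finset.image_insert, Finset.union_comm, ← Finset.insert_eq]
    congr 1
    exact (image_marked D).symm
  · intro z _
    dsimp only
    split_ifs
    · exact ht
    · exact one_ne_zero
  · simp only [Pi.zero_apply, smul_zero, add_zero]
    exact mem_lowerSpan _ (Nat.lt_succ_self _)
  · dsimp only
    rw [Finset.sum_insert hz₁, if_pos rfl, add_comm]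
    congr 1
    refine Finset.sum_congr rfl fun z hz => ?_
    rw [if_neg (fun h : z = z₁ => hz₁ (h ▸ hz)), one_smul]

/-- The degeneration underlying an exchange at two positions. -/
lemma IsFlip.degLE [Infinite k] {D D' : DecoratedMatrix b c} {i₀ i₁ : Fin b.length}
    {j₀ j₁ : Fin c.length} (hM : IsFlip D D' i₀ i₁ j₀ j₁) (hi : i₀ < i₁) (hj : j₀ < j₁)
    {z₀ z₁ : Index D} (hz₀ : z₀.1 = (i₀, j₀)) (hz₁ : z₁.1 = (i₁, j₁)) (hm : z₁ ∉ marked D)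
    (S : Finset (Index D))
    (hS : S = marked D ∨ (z₀ ∈ marked D ∧ S = insert z₁ ((marked D).erase z₀)))
    (hΔ : D'.Δ = maximalPositions
      (S.image fun z => (z.1.1, if z = z₀ then j₁ else if z = z₁ then j₀ else z.1.2))) :
    DegLE k D D' := by
  classical
  have h01 : z₀ ≠ z₁ := by
    rintro rfl
    rw [hz₀] at hz₁
    exact hi.ne (congrArg Prod.fst hz₁)
  -- In the second flag `v z₀` becomes `v z₀ + t • v z₁`. For t ≠ 0 this vector sits at (i₁, j₀),
  -- while `v z₀` sits at (i₀, j₁). If `z₀` is marked, a fixed line has its summand at (i₀, j₁);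
  -- moving the line by `t • v z₁` puts it at (i₁, j₀).
  refine degLE_of_family (S := S)
    (card_relabel (M' := D'.M) {z₀, z₁} (fun z hz => ?_) ?_) hΔ fun v =>
      ⟨if S = marked D then 0 else v z₁, fun z => if z = z₀ then v z₁ else 0, fun t ht =>
      ⟨fun z => if z = z₁ then v z₀ + t • v z₁ else v z, fun z => 1,
        fun _ _ => one_ne_zero, fun z => ?_, fun z => ?_, fun z => ?_, ?_⟩⟩
  · simp only [Finset.mem_insert, Finset.mem_singleton, not_or] at hz
    rw [if_neg hz.1, if_neg hz.2]
  · rw [Finset.sum_pair h01, Finset.sum_pair h01, if_pos rfl, if_neg h01.symm, if_pos rfl, hz₀, hz₁,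
      ← add_assoc, ← add_assoc]
    exact hM
  · dsimp only
    split_ifs with h
    · subst h
      refine Submodule.add_mem _ (mem_lowerSpan _ ?_)
        (Submodule.smul_mem _ _ (mem_lowerSpan _ (Nat.lt_succ_self _)))
      rw [hz₀, hz₁]
      exact Nat.lt_succ_of_lt hi
    · exact mem_lowerSpan _ (Nat.lt_succ_self _)
  · have hH : ∀ z x, (z.1.2 : ℕ) < x → v z + t • (if z = z₀ then v z₁ else 0) ∈ lowerSpan k
        (fun z => v z + t • (if z = z₀ then v z₁ else 0)) (fun z : Index D => z.1.2) x :=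
      fun z x hx => mem_lowerSpan (fun z => v z + t • (if z = z₀ then v z₁ else 0)) hx
    dsimp only
    by_cases h0 : z = z₀
    · subst h0
      rw [if_pos rfl, if_neg h01]
      have h1 := hH z (j₁ + 1) (by rw [hz₀]; exact Nat.lt_succ_of_lt hj)
      have h2 := hH z₁ (j₁ + 1) (by rw [hz₁]; exact Nat.lt_succ_self _)
      rw [if_pos rfl] at h1
      rw [if_neg h01.symm, smul_zero, add_zero] at h2
      have h3 := Submodule.sub_mem _ h1 (Submodule.smul_mem _ t h2)
      rwa [add_sub_cancel_right] at h3
    by_cases h1 : z = z₁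
    · subst h1
      rw [if_pos rfl, if_neg h0, if_pos rfl]
      have h1 := hH z₀ (j₀ + 1) (by rw [hz₀]; exact Nat.lt_succ_self _)
      rwa [if_pos rfl] at h1
    · rw [if_neg h1, if_neg h0, if_neg h1]
      have h1 := hH z (z.1.2 + 1) (Nat.lt_succ_self _)
      rwa [if_neg h0, smul_zero, add_zero] at h1
  · have hU : ∀ z, z ≠ z₁ → v z ∈ Submodule.span k
        (Set.range fun z => if z = z₁ then v z₀ + t • v z₁ else v z) := fun z hz =>
      Submodule.subset_span ⟨z, if_neg hz⟩
    by_cases h1 : z = z₁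
    · subst h1
      have h2 : v z₀ + t • v z ∈ Submodule.span k
        (Set.range fun z' => if z' = z then v z₀ + t • v z else v z') :=
        Submodule.subset_span ⟨z, if_pos rfl⟩
      have h3 := Submodule.sub_mem _ h2 (hU z₀ h01)
      rw [add_sub_cancel_left] at h3
      exact (Submodule.smul_mem_iff _ ht).1 h3
    · exact hU z h1
  · simp only [one_smul]
    have h2 : ∀ z ∈ marked D, (if z = z₁ then v z₀ + t • v z₁ else v z) = v z := fun z hz =>
      if_neg fun h : z = z₁ => hm (h ▸ hz)
    rcases hS with rfl | ⟨hz, rfl⟩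
    · rw [if_pos rfl, smul_zero, add_zero]
      exact (Finset.sum_congr rfl h2).symm
    · have h3 : insert z₁ ((marked D).erase z₀) ≠ marked D := fun h =>
        hm (h ▸ Finset.mem_insert_self _ _)
      rw [if_neg h3, Finset.sum_insert fun h => hm (Finset.mem_of_mem_erase h), if_pos rfl,
        Finset.sum_congr rfl fun z hz => h2 z (Finset.mem_of_mem_erase hz),
        ← Finset.add_sum_erase _ _ hz]
      abel

/-- Exchanges which do not involve the line. -/
lemma IsFlip.degLE_of_notMem [Infinite k] {D D' : DecoratedMatrix b c} {i₀ i₁ : Fin b.length}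
    {j₀ j₁ : Fin c.length} (hM : IsFlip D D' i₀ i₁ j₀ j₁) (hi : i₀ < i₁) (hj : j₀ < j₁)
    (hm₀ : 0 < D.M i₀ j₀) (hm₁ : 0 < D.M i₁ j₁) (h₀ : (i₀, j₀) ∉ D.Δ ∨ 1 < D.M i₀ j₀)
    (h₁ : (i₁, j₁) ∉ D.Δ) (hΔ : D'.Δ = D.Δ) : DegLE k D D' := by
  classical
  -- The last index of the block is nonzero when the entry exceeds 1, so it avoids the marked
  -- vector.
  let z₀ : Index D := ⟨(i₀, j₀), D.M i₀ j₀ - 1, by simp only; omega⟩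
  let z₁ : Index D := ⟨(i₁, j₁), 0, hm₁⟩
  have hz₀ : z₀ ∉ marked D := by
    rw [mem_marked]
    rintro ⟨h2, h3⟩
    simp only [z₀] at h2 h3
    rcases h₀ with h | h
    · exact h h2
    · omega
  have hz₁ : z₁ ∉ marked D := fun h => h₁ (mem_marked.1 h).1
  refine hM.degLE hi hj (z₀ := z₀) (z₁ := z₁) rfl rfl hz₁ (marked D) (Or.inl rfl) ?_
  rw [hΔ, ← maximalPositions_eq_self D.not_lt]
  congr 1
  rw [← image_marked D]
  refine Finset.image_congr fun z hz => ?_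
  have h2 : z ≠ z₀ := fun h => hz₀ (h ▸ hz)
  have h3 : z ≠ z₁ := fun h => hz₁ (h ▸ hz)
  simp [h2, h3]

lemma notMem_of_lt {D : DecoratedMatrix b c} {p s : Fin b.length × Fin c.length} (hp : p ∈ D.Δ)
    (h : p < s) : s ∉ D.Δ := fun hs => D.not_lt p hp s hs h

lemma notMem_of_gt {D : DecoratedMatrix b c} {p s : Fin b.length × Fin c.length} (hp : p ∈ D.Δ)
    (h : s < p) : s ∉ D.Δ := fun hs => D.not_lt s hs p hp h

lemma MoveII.degLE [Infinite k] {D D' : DecoratedMatrix b c} (h : MoveII D D') : DegLE k D D' := by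
  obtain ⟨i₀, i₁, j₀, j₁, hi, hj, h0, h1, -, h2, -, h3, hM, hΔ⟩ := h
  exact hM.degLE_of_notMem hi hj h0 h1 h3 h2 hΔ

lemma MoveIVb.degLE [Infinite k] {D D' : DecoratedMatrix b c} (h : MoveIVb D D') :
    DegLE k D D' := by
  obtain ⟨i₀, i₁, i₂, j₀, j₁, hi, hi', hj, h0, h1, h2, -, -, -, hM, hΔ⟩ := h
  exact hM.degLE_of_notMem (hi.trans hi') hj h0 h1
    (Or.inl (notMem_of_gt h2 (Prod.mk_lt_mk.2 (Or.inl ⟨hi, le_rfl⟩))))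
    (notMem_of_lt h2 (Prod.mk_lt_mk.2 (Or.inl ⟨hi', hj.le⟩))) hΔ

lemma MoveIVc.degLE [Infinite k] {D D' : DecoratedMatrix b c} (h : MoveIVc D D') :
    DegLE k D D' := by
  obtain ⟨i₀, i₁, j₀, j₁, j₂, hi, hj, hj', h0, h1, h2, -, -, -, hM, hΔ⟩ := h
  exact hM.degLE_of_notMem hi (hj.trans hj') h0 h1
    (Or.inl (notMem_of_gt h2 (Prod.mk_lt_mk.2 (Or.inr ⟨le_rfl, hj⟩))))
    (notMem_of_lt h2 (Prod.mk_lt_mk.2 (Or.inl ⟨hi, hj'.le⟩))) hΔ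

lemma MoveIIIa.degLE [Infinite k] {D D' : DecoratedMatrix b c} (h : MoveIIIa D D') :
    DegLE k D D' := by
  classical
  obtain ⟨i₀, i₁, j₀, j₁, hi, hj, h0, h1, h2, -, -, hM, hΔ⟩ := h
  let z₀ : Index D := ⟨(i₀, j₀), 0, by simp [h1]⟩
  let z₁ : Index D := ⟨(i₁, j₁), 0, h2⟩
  have hz₀ : z₀ ∈ marked D := mem_marked.2 ⟨h0, rfl⟩
  have hz₁ : z₁ ∉ marked D := fun h =>
    notMem_of_lt h0 (Prod.mk_lt_mk.2 (Or.inl ⟨hi, hj.le⟩)) (mem_marked.1 h).1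
  refine hM.degLE hi hj (z₀ := z₀) (z₁ := z₁) rfl rfl hz₁ (marked D) (Or.inl rfl) ?_
  rw [hΔ]
  refine maximalPositions_congr (fun p hp => ?_) (fun p hp => ?_)
  · rw [Finset.mem_union, Finset.mem_singleton] at hp
    have h3 : (i₀, j₁) ∈ (marked D).image fun z =>
        (z.1.1, if z = z₀ then j₁ else if z = z₁ then j₀ else z.1.2) :=
      Finset.mem_image.2 ⟨z₀, hz₀, by rw [if_pos rfl]⟩
    rcases hp with hp | rfl
    · rw [← image_marked, Finset.mem_image] at hp
      obtain ⟨z, hz, rfl⟩ := hp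
      by_cases h4 : z = z₀
      · subst h4
        exact ⟨_, h3, le_rfl, hj.le⟩
      · have h5 : z ≠ z₁ := fun h => hz₁ (h ▸ hz)
        exact ⟨_, Finset.mem_image.2 ⟨z, hz, by rw [if_neg h4, if_neg h5]⟩, le_rfl⟩
    · exact ⟨_, h3, le_rfl⟩
  · obtain ⟨z, hz, rfl⟩ := Finset.mem_image.1 hp
    refine ⟨_, ?_, le_rfl⟩
    rw [Finset.mem_union, Finset.mem_singleton]
    by_cases h4 : z = z₀
    · subst h4
      right
      rw [if_pos rfl]
    · have h5 : z ≠ z₁ := fun h => hz₁ (h ▸ hz)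
      left
      rw [if_neg h4, if_neg h5]
      exact (mem_marked.1 hz).1

lemma MoveIIIb.degLE [Infinite k] {D D' : DecoratedMatrix b c} (h : MoveIIIb D D') :
    DegLE k D D' := by
  classical
  obtain ⟨i₀, i₁, j₀, j₁, hi, hj, h0, h1, h2, -, -, hM, hΔ⟩ := h
  let z₀ : Index D := ⟨(i₀, j₀), 0, by simp [h1]⟩
  let z₁ : Index D := ⟨(i₁, j₁), 0, h2⟩
  have h01 : z₁ ≠ z₀ := fun h => hi.ne (congrArg (fun z => z.1.1) h).symm
  have hz₀ : z₀ ∈ marked D := mem_marked.2 ⟨h0, rfl⟩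
  have hz₁ : z₁ ∉ marked D := fun h =>
    notMem_of_lt h0 (Prod.mk_lt_mk.2 (Or.inl ⟨hi, hj.le⟩)) (mem_marked.1 h).1
  refine hM.degLE hi hj (z₀ := z₀) (z₁ := z₁) rfl rfl hz₁ _ (Or.inr ⟨hz₀, rfl⟩) ?_
  rw [hΔ]
  refine maximalPositions_congr (fun p hp => ?_) (fun p hp => ?_)
  · rw [Finset.mem_union, Finset.mem_singleton] at hp
    have h3 : (i₁, j₀) ∈ (insert z₁ ((marked D).erase z₀)).image fun z =>
        (z.1.1, if z = z₀ then j₁ else if z = z₁ then j₀ else z.1.2) :=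
      Finset.mem_image.2 ⟨z₁, Finset.mem_insert_self _ _, by rw [if_neg h01, if_pos rfl]⟩
    rcases hp with hp | rfl
    · rw [← image_marked, Finset.mem_image] at hp
      obtain ⟨z, hz, rfl⟩ := hp
      by_cases h4 : z = z₀
      · subst h4
        exact ⟨_, h3, hi.le, le_rfl⟩
      · have h5 : z ≠ z₁ := fun h => hz₁ (h ▸ hz)
        exact ⟨_, Finset.mem_image.2 ⟨z, Finset.mem_insert_of_mem (Finset.mem_erase.2 ⟨h4, hz⟩),
          by rw [if_neg h4, if_neg h5]⟩, le_rfl⟩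
    · exact ⟨_, h3, le_rfl⟩
  · obtain ⟨z, hz, rfl⟩ := Finset.mem_image.1 hp
    refine ⟨_, ?_, le_rfl⟩
    rw [Finset.mem_union, Finset.mem_singleton]
    rcases Finset.mem_insert.1 hz with rfl | hz
    · right
      rw [if_neg h01, if_pos rfl]
    · have h5 : z ≠ z₁ := fun h => hz₁ (h ▸ Finset.mem_of_mem_erase hz)
      left
      rw [if_neg (Finset.ne_of_mem_erase hz), if_neg h5]
      exact (mem_marked.1 (Finset.mem_of_mem_erase hz)).1

/-- In the second flag `v z₀` is changed by `-t • v z₁` and `v z₂` by `t • v z₁`. The changes cancel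
in `v z₀ + v z₂`, so this part of the fixed line vector becomes a single summand at (i₂, j₀). The
vectors `v z₂ + t • v z₁` and `v z₀` fill (i₁, j₂) and (i₀, j₁). -/
lemma MoveIVa.degLE [Infinite k] {D D' : DecoratedMatrix b c} (h : MoveIVa D D') :
    DegLE k D D' := by
  classical
  obtain ⟨i₀, i₁, i₂, j₀, j₁, j₂, hi, hi', hj, hj', h0, h2, m0, m2, m1, -, hM, hΔ⟩ := h
  let z₀ : Index D := ⟨(i₀, j₀), 0, by simp [m0]⟩
  let z₁ : Index D := ⟨(i₁, j₁), 0, m1⟩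
  let z₂ : Index D := ⟨(i₂, j₂), 0, by simp [m2]⟩
  have h01 : z₀ ≠ z₁ := fun h => (hi.trans hi').ne (congrArg (fun z => z.1.1) h)
  have h02 : z₀ ≠ z₂ := fun h => hi.ne (congrArg (fun z => z.1.1) h)
  have h21 : z₂ ≠ z₁ := fun h => hi'.ne (congrArg (fun z => z.1.1) h)
  have hz₀ : z₀ ∈ marked D := mem_marked.2 ⟨h0, rfl⟩
  have hz₂ : z₂ ∈ marked D := mem_marked.2 ⟨h2, rfl⟩
  have hz₁ : z₁ ∉ marked D := fun h =>
    notMem_of_lt h0 (Prod.mk_lt_mk.2 (Or.inl ⟨hi.trans hi', hj'.le⟩)) (mem_marked.1 h).1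
  let κ : Index D → Fin c.length := fun z =>
    if z = z₀ then j₁ else if z = z₁ then j₂ else if z = z₂ then j₀ else z.1.2
  have κ0 : κ z₀ = j₁ := if_pos rfl
  have κ1 : κ z₁ = j₂ := by simp only [κ, if_neg h01.symm, if_pos]
  have κ2 : κ z₂ = j₀ := by simp only [κ, if_neg h02.symm, if_neg h21, if_pos]
  have κ3 : ∀ z, z ≠ z₀ → z ≠ z₁ → z ≠ z₂ → κ z = z.1.2 := fun z a b c => by
    simp only [κ, if_neg a, if_neg b, if_neg c]
  refine degLE_of_family (κ := κ) (S := (marked D).erase z₀)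
    (card_relabel (M' := D'.M) {z₀, z₁, z₂} (fun z hz => ?_) ?_) ?_ fun v =>
      ⟨0, fun z => if z = z₀ then - v z₁ else if z = z₂ then v z₁ else 0, fun t ht => ?_⟩
  · simp only [Finset.mem_insert, Finset.mem_singleton, not_or] at hz
    exact κ3 z hz.1 hz.2.1 hz.2.2
  · have h3 : z₀ ∉ ({z₁, z₂} : Finset (Index D)) := by simp [h01, h02]
    rw [Finset.sum_insert h3, Finset.sum_insert h3, Finset.sum_pair h21.symm,
      Finset.sum_pair h21.symm, κ0, κ1, κ2]
    rw [← add_assoc, ← add_assoc]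
    refine hM.trans ?_
    simp only [z₀, z₁, z₂]
    abel
  · rw [hΔ]
    have h3 : (i₂, j₀) ∈ ((marked D).erase z₀).image fun z => (z.1.1, κ z) :=
      Finset.mem_image.2 ⟨z₂, Finset.mem_erase.2 ⟨h02.symm, hz₂⟩, by rw [κ2]⟩
    refine maximalPositions_congr (fun p hp => ?_) (fun p hp => ?_)
    · rw [Finset.mem_union, Finset.mem_singleton] at hp
      rcases hp with hp | rfl
      · rw [← image_marked, Finset.mem_image] at hp
        obtain ⟨z, hz, rfl⟩ := hp
        by_cases h4 : z = z₀
        · subst h4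
          exact ⟨_, h3, hi.le, le_rfl⟩
        by_cases h5 : z = z₂
        · subst h5
          exact ⟨_, h3, le_rfl, hj.le⟩
        · have h6 : z ≠ z₁ := fun h => hz₁ (h ▸ hz)
          exact ⟨_, Finset.mem_image.2 ⟨z, Finset.mem_erase.2 ⟨h4, hz⟩, by rw [κ3 z h4 h6 h5]⟩,
            le_rfl⟩
      · exact ⟨_, h3, le_rfl⟩
    · obtain ⟨z, hz, rfl⟩ := Finset.mem_image.1 hp
      refine ⟨_, ?_, le_rfl⟩
      rw [Finset.mem_union, Finset.mem_singleton]
      have hz' := Finset.mem_erase.1 hz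
      by_cases h5 : z = z₂
      · subst h5
        right
        rw [κ2]
      · have h6 : z ≠ z₁ := fun h => hz₁ (h ▸ hz'.2)
        left
        rw [κ3 z hz'.1 h6 h5]
        exact (mem_marked.1 hz'.2).1
  · set w : Index D → Fin n → k := fun z =>
      if z = z₀ then - v z₁ else if z = z₂ then v z₁ else 0 with hw
    have w0 : w z₀ = - v z₁ := if_pos rfl
    have w2 : w z₂ = v z₁ := by simp only [hw, if_neg h02.symm, if_pos]
    have w3 : ∀ z, z ≠ z₀ → z ≠ z₂ → w z = 0 := fun z a b => by
      simp only [hw, if_neg a, if_neg b]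
    let u : Index D → Fin n → k := fun z =>
      if z = z₁ then v z₂ + t • v z₁ else if z = z₂ then v z₂ + v z₀ else v z
    have u1 : u z₁ = v z₂ + t • v z₁ := if_pos rfl
    have u2 : u z₂ = v z₂ + v z₀ := by simp only [u, if_neg h21, if_pos]
    have u3 : ∀ z, z ≠ z₁ → z ≠ z₂ → u z = v z := fun z a b => by
      simp only [u, if_neg a, if_neg b]
    have hV : ∀ z x, (z.1.1 : ℕ) < x → v z ∈ lowerSpan k v (fun z : Index D => z.1.1) x :=
      fun z x hx => mem_lowerSpan v hx
    have hH : ∀ z x, (z.1.2 : ℕ) < x → v z + t • w z ∈ lowerSpan k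
        (fun z => v z + t • w z) (fun z : Index D => z.1.2) x :=
      fun z x hx => mem_lowerSpan (fun z => v z + t • w z) hx
    have hU : ∀ z, u z ∈ Submodule.span k (Set.range u) := fun z => Submodule.subset_span ⟨z, rfl⟩
    refine ⟨u, fun _ => 1, fun _ _ => one_ne_zero, fun z => ?_, fun z => ?_, fun z => ?_, ?_⟩
    · by_cases h1 : z = z₁
      · subst h1
        rw [u1]
        exact Submodule.add_mem _ (hV z₂ _ (Nat.lt_succ_of_lt hi'))
          (Submodule.smul_mem _ _ (hV z₁ _ (Nat.lt_succ_self _)))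
      by_cases h2 : z = z₂
      · subst h2
        rw [u2]
        exact Submodule.add_mem _ (hV z₂ _ (Nat.lt_succ_self _)) (hV z₀ _ (Nat.lt_succ_of_lt hi))
      · rw [u3 z h1 h2]
        exact hV z _ (Nat.lt_succ_self _)
    · by_cases h1 : z = z₁
      · subst h1
        have h3 := hH z₂ (j₂ + 1) (Nat.lt_succ_self _)
        rw [w2] at h3
        rw [u1, κ1]
        exact h3
      by_cases h2 : z = z₂
      · subst h2
        have h3 := hH z₂ (j₀ + 1) (Nat.lt_succ_of_lt hj)
        have h4 := hH z₀ (j₀ + 1) (Nat.lt_succ_self _)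
        rw [w2] at h3
        rw [w0] at h4
        rw [u2, κ2]
        convert Submodule.add_mem _ h3 h4 using 1
        module
      by_cases h0 : z = z₀
      · subst h0
        have h3 := hH z₀ (j₁ + 1) (Nat.lt_succ_of_lt hj')
        have h4 := hH z₁ (j₁ + 1) (Nat.lt_succ_self _)
        rw [w0] at h3
        rw [w3 z₁ h01.symm h21.symm] at h4
        rw [u3 z₀ h01 h02, κ0]
        convert Submodule.add_mem _ h3 (Submodule.smul_mem _ t h4) using 1
        module
      · have h3 := hH z (z.1.2 + 1) (Nat.lt_succ_self _)
        rw [w3 z h0 h2] at h3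
        rw [u3 z h1 h2, κ3 z h0 h1 h2]
        simpa using h3
    · have k0 := hU z₀
      rw [u3 z₀ h01 h02] at k0
      have k2 := Submodule.sub_mem _ (hU z₂) k0
      rw [u2, add_sub_cancel_right] at k2
      by_cases h1 : z = z₁
      · subst h1
        have k1 := Submodule.sub_mem _ (hU z₁) k2
        rw [u1, add_sub_cancel_left] at k1
        exact (Submodule.smul_mem_iff _ ht).1 k1
      by_cases h2 : z = z₂
      · subst h2
        exact k2
      · rw [← u3 z h1 h2]
        exact hU z
    · simp only [one_smul, smul_zero, add_zero]
      rw [← Finset.add_sum_erase _ _ hz₀]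
      have h3 : z₂ ∈ (marked D).erase z₀ := Finset.mem_erase.2 ⟨h02.symm, hz₂⟩
      rw [← Finset.add_sum_erase _ _ h3, ← Finset.add_sum_erase _ _ h3, u2]
      rw [Finset.sum_congr rfl (g := fun z => v z) fun z hz => u3 z
        (fun h => hz₁ (h ▸ Finset.mem_of_mem_erase (Finset.mem_of_mem_erase hz)))
        (Finset.ne_of_mem_erase hz)]
      abel

end LineTwoFlags

/-! ### The family for move (v), and moves as degenerations -/

namespace LineTwoFlags

open Module

variable {n : ℕ} {b c : Composition n} {k : Type*} [Field k]

-- In the second flag only `v z₀` changes, to `v z₀ + t • ∑ s, v (Z s)`. The partial sum up to s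
-- lies in row `i s`; as the full sum minus the later terms, it lies in column `next s`. The line is
-- fixed, and its part `∑ s, v (Z s)` is t⁻¹ times the full sum minus t⁻¹ times `v z₀`, whence the
-- two new circles.
set_option maxHeartbeats 1000000 in
lemma MoveV.degLE [Infinite k] {D D' : DecoratedMatrix b c} (h : MoveV D D') : DegLE k D D' := by
  classical
  obtain ⟨m, i₀, j₀, i, j, hi, hj, hi₀, hj₀, hmem, hpos, -, hM, hΔ⟩ := h
  let z₀ : Index D := ⟨(i₀, j₀), 0, hpos⟩
  let Z : Fin (m + 1) → Index D := fun s => ⟨(i s, j s), 0, D.pos _ (hmem s)⟩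
  -- The column of the next circled position, closing up with j₀ at the end of the cycle.
  let next : Fin (m + 1) → Fin c.length :=
    @Fin.snoc m (fun _ => Fin c.length) (fun s => j s.succ) j₀
  have next_last : next (Fin.last m) = j₀ := Fin.snoc_last (α := fun _ => Fin c.length) _ _
  have next_castSucc : ∀ s : Fin m, next s.castSucc = j s.succ := fun s =>
    Fin.snoc_castSucc (α := fun _ => Fin c.length) _ _ s
  have hnext₀ : ∀ s, j₀ ≤ next s := by
    intro s
    induction s using Fin.lastCases with
    | last => exact next_last.ge
    | cast s => exact next_castSucc s ▸ hj₀.le.trans (hj.antitone (Fin.le_last _))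
  have hnext : ∀ s s', s < s' → j s' ≤ next s := by
    intro s s' hs
    induction s using Fin.lastCases with
    | last => exact absurd hs (Fin.le_last s').not_gt
    | cast s => exact next_castSucc s ▸ hj.antitone (Fin.castSucc_lt_iff_succ_le.1 hs)
  have hii : ∀ s, i₀ < i s := fun s => hi₀.trans_le (hi.monotone (Fin.zero_le s))
  have hZ : Function.Injective Z := fun s s' hs => hi.injective (congrArg (fun z => z.1.1) hs)
  have hZ₀ : ∀ s, Z s ≠ z₀ := fun s hs => (hii s).ne (congrArg (fun z => z.1.1) hs).symm
  have hZ₀' : ¬ ∃ s, Z s = z₀ := fun ⟨s, hs⟩ => hZ₀ s hs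
  have hZm : Finset.univ.image Z ⊆ marked D := by
    intro z hz
    obtain ⟨s, -, rfl⟩ := Finset.mem_image.1 hz
    exact mem_marked.2 ⟨hmem s, rfl⟩
  have hz₀ : z₀ ∉ marked D := fun h =>
    notMem_of_gt (hmem 0) (Prod.mk_lt_mk.2 (Or.inl ⟨hi₀, hj₀.le.trans (hj.antitone (Fin.le_last _))⟩))
      (mem_marked.1 h).1
  let κ : Index D → Fin c.length :=
    Function.update (Function.extend Z next fun z => z.1.2) z₀ (j 0)
  have κ0 : κ z₀ = j 0 := Function.update_self _ _ _
  have κZ : ∀ s, κ (Z s) = next s := fun s => by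
    simp only [κ, Function.update_of_ne (hZ₀ s), hZ.extend_apply]
  have κ1 : ∀ z, z ≠ z₀ → (¬ ∃ s, Z s = z) → κ z = z.1.2 := fun z h1 h2 => by
    simp only [κ, Function.update_of_ne h1, Function.extend_apply' _ _ _ h2]
  have hlast : Z (Fin.last m) ∉ marked D \ Finset.univ.image Z := fun h =>
    (Finset.mem_sdiff.1 h).2 (Finset.mem_image_of_mem _ (Finset.mem_univ _))
  have hz₀S : z₀ ∉ insert (Z (Fin.last m)) (marked D \ Finset.univ.image Z) := by
    rw [Finset.mem_insert, not_or]
    exact ⟨(hZ₀ _).symm, fun h => hz₀ (Finset.mem_sdiff.1 h).1⟩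
  have hrest : ∀ z ∈ marked D \ Finset.univ.image Z, z ≠ z₀ ∧ ¬ ∃ s, Z s = z := by
    intro z hz
    rw [Finset.mem_sdiff] at hz
    exact ⟨fun h => hz₀ (h ▸ hz.1), fun ⟨s, hs⟩ =>
      hz.2 (hs ▸ Finset.mem_image_of_mem _ (Finset.mem_univ _))⟩
  refine degLE_of_family (κ := κ)
    (S := insert z₀ (insert (Z (Fin.last m)) (marked D \ Finset.univ.image Z)))
    (card_relabel (M' := D'.M) (insert z₀ (Finset.univ.image Z)) (fun z hz => ?_) ?_) ?_ fun v =>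
      ⟨0, Function.update 0 z₀ (∑ s, v (Z s)), fun t ht => ?_⟩
  · rw [Finset.mem_insert, not_or] at hz
    exact κ1 z hz.1 fun ⟨s, hs⟩ => hz.2 (hs ▸ Finset.mem_image_of_mem _ (Finset.mem_univ _))
  · have h1 : z₀ ∉ Finset.univ.image Z := fun h => hz₀ (hZm h)
    rw [Finset.sum_insert h1, Finset.sum_insert h1, Finset.sum_image fun _ _ _ _ h => hZ h,
      Finset.sum_image fun _ _ _ _ h => hZ h, κ0, ← add_assoc]
    refine hM.trans ?_
    rw [add_assoc (D.M + E i₀ (j 0)), add_assoc D.M]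
    congr 2
    simp only [κZ]
    rw [Fin.sum_univ_castSucc (n := m), next_last]
    simp only [next_castSucc]
    rfl
  · rw [hΔ, Finset.image_insert, Finset.image_insert, κ0, κZ, next_last]
    congr 1
    ext p
    simp only [Finset.mem_union, Finset.mem_insert, Finset.mem_singleton]
    have h1 : p ∈ D.Δ \ ({(i₀, j₀)} ∪ Finset.univ.image fun s => (i s, j s)) ↔
        p ∈ (marked D \ Finset.univ.image Z).image fun z => (z.1.1, κ z) := by
      constructor
      · intro hp
        rw [Finset.mem_sdiff, Finset.mem_union, not_or] at hp
        refine Finset.mem_image.2 ⟨⟨p, 0, D.pos p hp.1⟩, ?_, ?_⟩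
        · refine Finset.mem_sdiff.2 ⟨mem_marked.2 ⟨hp.1, rfl⟩, fun h => hp.2.2 ?_⟩
          obtain ⟨s, -, hs⟩ := Finset.mem_image.1 h
          exact Finset.mem_image.2 ⟨s, Finset.mem_univ _, congrArg Sigma.fst hs⟩
        · rw [κ1]
          · intro h
            exact hp.2.1 (Finset.mem_singleton.2 (congrArg Sigma.fst h))
          · rintro ⟨s, hs⟩
            exact hp.2.2 (Finset.mem_image.2 ⟨s, Finset.mem_univ _, congrArg Sigma.fst hs⟩)
      · intro hp
        obtain ⟨z, hz, rfl⟩ := Finset.mem_image.1 hp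
        have h2 := hrest z hz
        rw [κ1 z h2.1 h2.2]
        have h3 := mem_marked.1 (Finset.mem_sdiff.1 hz).1
        refine Finset.mem_sdiff.2 ⟨h3.1, fun h => ?_⟩
        rcases Finset.mem_union.1 h with h | h
        · refine hz₀ ?_
          have h4 : z.1 = (i₀, j₀) := Finset.mem_singleton.1 h
          exact mem_marked.2 ⟨show (i₀, j₀) ∈ D.Δ from h4 ▸ h3.1, rfl⟩
        · obtain ⟨s, -, hs⟩ := Finset.mem_image.1 h
          refine h2.2 ⟨s, ?_⟩
          obtain ⟨q, l⟩ := z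
          change (i s, j s) = q at hs
          subst hs
          exact Sigma.ext rfl (heq_of_eq (Fin.ext h3.2.symm))
    rw [← h1]
    tauto
  · set w : Index D → Fin n → k := Function.update 0 z₀ (∑ s, v (Z s)) with hw
    have w0 : w z₀ = ∑ s, v (Z s) := Function.update_self _ _ _
    have w1 : ∀ z, z ≠ z₀ → w z = 0 := fun z hz => by rw [hw, Function.update_of_ne hz]; rfl
    let u : Index D → Fin n → k :=
      Function.extend Z (fun s => v z₀ + t • ∑ s' ∈ Finset.Iic s, v (Z s')) v
    have uZ : ∀ s, u (Z s) = v z₀ + t • ∑ s' ∈ Finset.Iic s, v (Z s') := hZ.extend_apply _ _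
    have u1 : ∀ z, (¬ ∃ s, Z s = z) → u z = v z := fun z hz => Function.extend_apply' _ _ _ hz
    let f : Index D → k := Function.update (Function.update 1 (Z (Fin.last m)) t⁻¹) z₀ (-t⁻¹)
    have f0 : f z₀ = -t⁻¹ := Function.update_self _ _ _
    have fZ : f (Z (Fin.last m)) = t⁻¹ := by
      simp only [f, Function.update_of_ne (hZ₀ _), Function.update_self]
    have f1 : ∀ z ∈ marked D \ Finset.univ.image Z, f z = 1 := fun z hz => by
      have h1 := hrest z hz
      simp only [f, Function.update_of_ne h1.1, Function.update_of_ne fun h => h1.2 ⟨_, h.symm⟩,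
        Pi.one_apply]
    have hV : ∀ z x, (z.1.1 : ℕ) < x → v z ∈ lowerSpan k v (fun z : Index D => z.1.1) x :=
      fun z x hx => mem_lowerSpan v hx
    have hH : ∀ z x, (z.1.2 : ℕ) < x → v z + t • w z ∈ lowerSpan k
        (fun z => v z + t • w z) (fun z : Index D => z.1.2) x :=
      fun z x hx => mem_lowerSpan (fun z => v z + t • w z) hx
    have hHZ : ∀ s x, (j s : ℕ) < x → v (Z s) ∈ lowerSpan k
        (fun z => v z + t • w z) (fun z : Index D => z.1.2) x := by
      intro s x hx
      have h1 := hH (Z s) x hx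
      rwa [w1 _ (hZ₀ s), smul_zero, add_zero] at h1
    have hU : ∀ z, u z ∈ Submodule.span k (Set.range u) := fun z => Submodule.subset_span ⟨z, rfl⟩
    refine ⟨u, f, fun z hz => ?_, fun z => ?_, fun z => ?_, ?_, ?_⟩
    · rcases Finset.mem_insert.1 hz with rfl | hz
      · rw [f0]
        exact neg_ne_zero.2 (inv_ne_zero ht)
      rcases Finset.mem_insert.1 hz with rfl | hz
      · rw [fZ]
        exact inv_ne_zero ht
      · rw [f1 z hz]
        exact one_ne_zero
    · by_cases h1 : ∃ s, Z s = z
      · obtain ⟨s, rfl⟩ := h1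
        rw [uZ]
        refine Submodule.add_mem _ (hV z₀ _ (Nat.lt_succ_of_lt (hii s))) (Submodule.smul_mem _ _
          (Submodule.sum_mem _ fun s' hs' => hV _ _ (Nat.lt_succ_of_le ?_)))
        exact hi.monotone (Finset.mem_Iic.1 hs')
      · rw [u1 z h1]
        exact hV z _ (Nat.lt_succ_self _)
    · by_cases h1 : ∃ s, Z s = z
      · obtain ⟨s, rfl⟩ := h1
        rw [uZ, κZ]
        have h2 := hH z₀ (next s + 1) (Nat.lt_succ_of_le (hnext₀ s))
        have h3 : ∑ s' ∈ (Finset.Iic s)ᶜ, v (Z s') ∈ lowerSpan k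
            (fun z => v z + t • w z) (fun z : Index D => z.1.2) (next s + 1) := by
          refine Submodule.sum_mem _ fun s' hs' => hHZ s' _ (Nat.lt_succ_of_le (hnext s s' ?_))
          rw [Finset.mem_compl, Finset.mem_Iic, not_le] at hs'
          exact hs'
        rw [w0, ← Finset.sum_add_sum_compl (Finset.Iic s)] at h2
        convert Submodule.sub_mem _ h2 (Submodule.smul_mem _ t h3) using 1
        module
      · rw [u1 z h1]
        by_cases h0 : z = z₀
        · subst h0
          rw [κ0]
          have h2 := hH z₀ (j 0 + 1)
            (Nat.lt_succ_of_le (hj₀.le.trans (hj.antitone (Fin.le_last _))))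
          have h3 : ∑ s, v (Z s) ∈ lowerSpan k
              (fun z => v z + t • w z) (fun z : Index D => z.1.2) (j 0 + 1) :=
            Submodule.sum_mem _ fun s _ => hHZ s _ (Nat.lt_succ_of_le (hj.antitone (Fin.zero_le s)))
          rw [w0] at h2
          convert Submodule.sub_mem _ h2 (Submodule.smul_mem _ t h3) using 1
          module
        · rw [κ1 z h0 h1]
          have h2 := hH z (z.1.2 + 1) (Nat.lt_succ_self _)
          rwa [w1 z h0, smul_zero, add_zero] at h2
    · have k0 := hU z₀
      rw [u1 z₀ hZ₀'] at k0
      have kZ : ∀ s, v (Z s) ∈ Submodule.span k (Set.range u) := by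
        intro s
        induction s using WellFoundedLT.induction with
        | ind s ih =>
          have h1 := Submodule.sub_mem _ (hU (Z s)) k0
          rw [uZ, add_sub_cancel_left, Submodule.smul_mem_iff _ ht, ← Finset.Iio_insert,
            Finset.sum_insert (by simp)] at h1
          have h2 : ∑ s' ∈ Finset.Iio s, v (Z s') ∈ Submodule.span k (Set.range u) :=
            Submodule.sum_mem _ fun s' hs' => ih s' (Finset.mem_Iio.1 hs')
          have h3 := Submodule.sub_mem _ h1 h2
          rwa [add_sub_cancel_right] at h3
      intro z
      by_cases h1 : ∃ s, Z s = z
      · obtain ⟨s, rfl⟩ := h1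
        exact kZ s
      · rw [← u1 z h1]
        exact hU z
    · rw [smul_zero, add_zero, Finset.sum_insert hz₀S, Finset.sum_insert hlast, f0, fZ,
        u1 z₀ hZ₀', uZ, ← Finset.sum_sdiff hZm, Finset.sum_image fun _ _ _ _ h => hZ h]
      have h1 : ∑ z ∈ marked D \ Finset.univ.image Z, f z • u z =
          ∑ z ∈ marked D \ Finset.univ.image Z, v z :=
        Finset.sum_congr rfl fun z hz => by rw [f1 z hz, one_smul, u1 z (hrest z hz).2]
      have h2 : Finset.Iic (Fin.last m) = Finset.univ := by
        ext s
        simp [Fin.le_last]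
      rw [h1, h2, smul_add, smul_smul, inv_mul_cancel₀ ht, one_smul, neg_smul]
      abel

theorem SimpleMove.degLE [Infinite k] {D D' : DecoratedMatrix b c} (h : SimpleMove D D') :
    DegLE k D D' := by
  rcases h with h | h | (h | h) | (h | h | h) | h
  · exact h.degLE
  · exact h.degLE
  · exact h.degLE
  · exact h.degLE
  · exact h.degLE
  · exact h.degLE
  · exact h.degLE
  · exact h.degLE

theorem MoveLE.degLE [Infinite k] {D D' : DecoratedMatrix b c} (h : MoveLE D D') :
    DegLE k D D' := by
  induction h with
  | refl => exact DegLE.refl D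
  | tail _ h ih => exact ih.trans h.degLE

end LineTwoFlags

namespace LineTwoFlags

open Module

/-! ### Ranks are lower semicontinuous -/

lemma exists_linearIndependent_comp {k V ι : Type*} [Field k] [AddCommGroup V] [Module k V]
    [FiniteDimensional k V] {w : ι → V} {s : ℕ}
    (h : s ≤ finrank k (Submodule.span k (Set.range w))) :
    ∃ φ : Fin s → ι, LinearIndependent k (w ∘ φ) := by
  obtain ⟨κ, e, he, hspan, hli⟩ := exists_linearIndependent' k w
  have := hli.finite
  have : Fintype κ := Fintype.ofFinite κ
  rw [← hspan, finrank_span_eq_card hli] at h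
  obtain ⟨f⟩ : Nonempty (Fin s ↪ κ) :=
    Function.Embedding.nonempty_of_card_le (by rwa [Fintype.card_fin])
  exact ⟨e ∘ f, hli.comp f f.injective⟩

/-- Rank expressed through minors: a larger rank gives s + 1 independent vectors and then, row rank
being column rank, s + 1 coordinates with nonzero determinant. -/
lemma finrank_span_range_le_iff {k ι : Type*} [Field k] {n s : ℕ} (w : ι → Fin n → k) :
    finrank k (Submodule.span k (Set.range w)) ≤ s ↔
      ∀ (φ : Fin (s + 1) → ι) (ψ : Fin (s + 1) → Fin n),
        (Matrix.of fun x y => w (φ x) (ψ y)).det = 0 := by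
  constructor
  · intro h φ ψ
    by_contra hdet
    have h1 : LinearIndependent k (Matrix.of fun x y => w (φ x) (ψ y)).row :=
      Matrix.linearIndependent_rows_iff_isUnit.2
        ((Matrix.isUnit_iff_isUnit_det _).2 (isUnit_iff_ne_zero.2 hdet))
    have h2 : LinearIndependent k (w ∘ φ) :=
      LinearIndependent.of_comp (LinearMap.funLeft k k ψ) h1
    have h3 := finrank_span_eq_card h2
    have h4 := Submodule.finrank_mono (Submodule.span_mono (R := k) (Set.range_comp_subset_range φ w))
    rw [h3, Fintype.card_fin] at h4
    omega
  · intro h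
    by_contra hc
    obtain ⟨φ, hφ⟩ := exists_linearIndependent_comp (Nat.succ_le_of_lt (not_le.1 hc))
    let A : Matrix (Fin (s + 1)) (Fin n) k := Matrix.of fun x y => w (φ x) y
    have hA : A.rank = s + 1 := by
      rw [LinearIndependent.rank_matrix (M := A) hφ, Fintype.card_fin]
    rw [Matrix.rank_eq_finrank_span_cols] at hA
    obtain ⟨ψ, hψ⟩ := exists_linearIndependent_comp hA.ge
    have h1 : LinearIndependent k (Matrix.of fun x y => w (φ x) (ψ y)).col := hψ
    have h2 := (Matrix.isUnit_iff_isUnit_det _).1 (Matrix.linearIndependent_cols_iff_isUnit.1 h1)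
    exact h2.ne_zero (h φ ψ)

variable {n : ℕ} {b c : Composition n} {k : Type*} [Field k]

lemma image_sumElim {α β γ : Type*} (f : α → γ) (g : β → γ) (p : α → Prop) (q : β → Prop) :
    Sum.elim f g '' {z | Sum.elim p q z} = f '' {x | p x} ∪ g '' {y | q y} := by
  ext x
  simp [Sum.exists]

/-- The triples with bounded `dim (A + B_i + C_j)`, or bounded `dim (B_i + C_j)`, form a closed
set. -/
lemma isZariskiClosed_finrank_le (P : Prop) (i : Fin (b.length + 1)) (j : Fin (c.length + 1))
    (s : ℕ) : IsZariskiClosed {X : TripleFlag k b c | finrank k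
      ↥((⨆ _ : P, X.line.submodule) ⊔ (X.fst.space i ⊔ X.snd.space j)) ≤ s} := by
  classical
  -- The frame vectors that span the sum, the one for the line being present only if `P` holds. The
  -- equations are their minors of size s + 1.
  let T : Set (Unit ⊕ (Fin n ⊕ Fin n)) := {z | Sum.elim (fun _ => P)
    (Sum.elim (fun m : Fin n => (m : ℕ) < b.sizeUpTo i) (fun m : Fin n => (m : ℕ) < c.sizeUpTo j)) z}
  let idx : Unit ⊕ (Fin n ⊕ Fin n) → Fin n → FrameCoord n :=
    Sum.elim (fun _ m => Sum.inl m) (Sum.elim (fun x m => Sum.inr (Sum.inl (x, m)))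
      (fun x m => Sum.inr (Sum.inr (x, m))))
  let pol : (Fin (s + 1) → T) × (Fin (s + 1) → Fin n) → MvPolynomial (FrameCoord n) k := fun p =>
    (Matrix.of fun x y => MvPolynomial.X (idx (p.1 x) (p.2 y))).det
  refine ⟨Set.range pol, fun X a g h hfr => ?_⟩
  let W : Unit ⊕ (Fin n ⊕ Fin n) → Fin n → k := Sum.elim (fun _ => a) (Sum.elim g h)
  have hW : ∀ z m, frameCoords a g h (idx z m) = W z m := by
    rintro (z | z | z) m <;> rfl
  have hspan : (⨆ _ : P, X.line.submodule) ⊔ (X.fst.space i ⊔ X.snd.space j) =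
      Submodule.span k (Set.range fun z : T => W z) := by
    rw [← Set.image_eq_range, image_sumElim, image_sumElim, Submodule.span_union,
      Submodule.span_union, ← hfr.fst, ← hfr.snd]
    congr 1
    by_cases hP : P
    · simp [hP, hfr.line]
    · simp [hP]
  rw [Set.mem_ofPred_eq, hspan, finrank_span_range_le_iff]
  have heval : ∀ p, MvPolynomial.eval (frameCoords a g h) (pol p) =
      (Matrix.of fun x y => W (p.1 x) (p.2 y)).det := by
    intro p
    simp only [pol]
    rw [RingHom.map_det]
    congr 1
    ext x y
    simp [hW]
  constructor
  · rintro hdet _ ⟨p, rfl⟩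
    rw [heval]
    exact hdet p.1 p.2
  · intro hp φ ψ
    have h1 := hp _ ⟨(φ, ψ), rfl⟩
    rwa [heval] at h1

/-! ### Ranks on orbits -/

lemma orbit_nonempty (D : DecoratedMatrix b c) : (orbit k D).Nonempty := by
  have hp := card_sigma_fiber fun p : Fin b.length × Fin c.length => D.M p.1 p.2
  have hrow := isLabelling_row D.row_sum hp
  have hcol := isLabelling_col D.col_sum hp
  let v : Basis (Index D) k (Fin n → k) :=
    (Pi.basisFun k (Fin n)).reindex (Fintype.equivFinOfCardEq hrow.card).symm
  have hne : ∑ z ∈ marked D, v z ≠ 0 := by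
    intro h0
    obtain ⟨d, hd⟩ := D.nonempty
    refine one_ne_zero (linearIndependent_iff'.1 v.linearIndependent (marked D) (fun _ => (1 : k))
      (by simpa using h0) ⟨d, 0, D.pos d hd⟩ (mem_marked.2 ⟨hd, rfl⟩))
  exact ⟨⟨Projectivization.mk k _ hne, flagOf v.linearIndependent hrow,
    flagOf v.linearIndependent hcol⟩, v, fun _ => rfl, fun _ => rfl, rfl⟩

lemma cnt_eq_card (D : DecoratedMatrix b c) (x y : ℕ) :
    cnt D.M x y = ({z | (z.1.1 : ℕ) < x ∧ (z.1.2 : ℕ) < y} : Finset (Index D)).card := by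
  rw [Finset.card_filter, Fintype.sum_sigma, Fintype.sum_prod_type, cnt]
  refine Finset.sum_congr rfl fun i _ => Finset.sum_congr rfl fun j _ => ?_
  split_ifs <;> simp

lemma span_sup_span (D : DecoratedMatrix b c) (v : Basis (Index D) k (Fin n → k)) (x y : ℕ) :
    Submodule.span k (v '' {z | (z.1.1 : ℕ) < x}) ⊔ Submodule.span k (v '' {z | (z.1.2 : ℕ) < y}) =
      Submodule.span k (v '' {z | (z.1.1 : ℕ) < x ∨ (z.1.2 : ℕ) < y}) := by
  rw [← Submodule.span_union, ← Set.image_union]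
  rfl

/-- Both spaces are spanned by parts of one basis, so this is inclusion–exclusion for index sets,
with `cnt` counting the intersection. -/
lemma finrank_sup_add_cnt {D : DecoratedMatrix b c} {X : TripleFlag k b c} (hX : X ∈ orbit k D)
    (i : Fin (b.length + 1)) (j : Fin (c.length + 1)) :
    finrank k ↥(X.fst.space i ⊔ X.snd.space j) + cnt D.M i j = b.sizeUpTo i + c.sizeUpTo j := by
  classical
  obtain ⟨v, hB, hC, -⟩ := hX
  have hp := card_sigma_fiber fun p : Fin b.length × Fin c.length => D.M p.1 p.2
  rw [hB, hC, span_sup_span, cnt_eq_card, ← (isLabelling_row D.row_sum hp).card_lt,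
    ← (isLabelling_col D.col_sum hp).card_lt, ← Finset.card_union_add_card_inter,
    ← Finset.filter_or, ← Finset.filter_and, Set.image_eq_range]
  congr 1
  refine (finrank_span_eq_card (v.linearIndependent.comp
    (Subtype.val : {z : Index D | (z.1.1 : ℕ) < i ∨ (z.1.2 : ℕ) < j} → Index D)
    Subtype.val_injective)).trans ?_
  rw [← Fintype.card_subtype]
  exact Fintype.card_congr (Equiv.refl _)

/-- A sum of basis vectors lies in a span of basis vectors iff each summand does. As B_i covers the
rows of index < i, the zero-based position (i, j) is the first one not covered by B_i + C_j. -/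
lemma line_le_iff {D : DecoratedMatrix b c} {X : TripleFlag k b c} (hX : X ∈ orbit k D)
    (i : Fin (b.length + 1)) (j : Fin (c.length + 1)) :
    X.line.submodule ≤ X.fst.space i ⊔ X.snd.space j ↔ ¬ Ideal (Circled D.Δ) i j := by
  classical
  obtain ⟨v, hB, hC, hA⟩ := hX
  rw [hB, hC, span_sup_span, hA, Submodule.span_singleton_le_iff_mem, ideal_circled]
  change ∑ z ∈ marked D, v z ∈ _ ↔ _
  constructor
  · rintro h ⟨d, hd, h1, h2⟩
    rw [v.mem_span_image] at h
    have h3 : (⟨d, 0, D.pos d hd⟩ : Index D) ∈ marked D := mem_marked.2 ⟨hd, rfl⟩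
    have h4 : (⟨d, 0, D.pos d hd⟩ : Index D) ∈ (v.repr (∑ z ∈ marked D, v z)).support := by
      rw [Finsupp.mem_support_iff, map_sum, Finsupp.finsetSum_apply]
      simp [Finsupp.single_apply, h3]
    rcases h h4 with h5 | h5
    · exact absurd h5 h1.not_gt
    · exact absurd h5 h2.not_gt
  · intro h
    refine Submodule.sum_mem _ fun z hz => Submodule.subset_span ⟨z, ?_, rfl⟩
    by_contra hc
    rw [Set.mem_ofPred_eq, not_or, not_lt, not_lt] at hc
    exact h ⟨z.1, (mem_marked.1 hz).1, hc.1, hc.2⟩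

/-- Degenerations of orbits are detected by ranks. -/
theorem DegLE.rankLE {D D' : DecoratedMatrix b c} (h : DegLE k D D') : RankLE D D' := by
  obtain ⟨X, hX⟩ := orbit_nonempty (k := k) D
  have key : ∀ (P : Prop) (i : Fin (b.length + 1)) (j : Fin (c.length + 1)) (s : ℕ),
      (∀ Y ∈ orbit k D', finrank k
        ↥((⨆ _ : P, Y.line.submodule) ⊔ (Y.fst.space i ⊔ Y.snd.space j)) ≤ s) →
      finrank k ↥((⨆ _ : P, X.line.submodule) ⊔ (X.fst.space i ⊔ X.snd.space j)) ≤ s :=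
    fun P i j s hs => h hX _ ⟨isZariskiClosed_finrank_le P i j s, hs⟩
  have hF : ∀ (Y : TripleFlag k b c) (W : Submodule k (Fin n → k)),
      (⨆ _ : False, Y.line.submodule) ⊔ W = W := by simp
  have hT : ∀ (Y : TripleFlag k b c) (W : Submodule k (Fin n → k)),
      (⨆ _ : True, Y.line.submodule) ⊔ W = Y.line.submodule ⊔ W := by simp
  refine ⟨fun x y => ?_, fun x y hid hcnt => ?_⟩
  · by_cases hxy : b.length ≤ x ∨ c.length ≤ y
    · exact (cnt_eq_of_le hxy).ge
    · rw [not_or, not_le, not_le] at hxy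
      have h1 := key False ⟨x, by omega⟩ ⟨y, by omega⟩
        (b.sizeUpTo x + c.sizeUpTo y - cnt D'.M x y) fun Y hY => by
          have h2 := finrank_sup_add_cnt hY ⟨x, by omega⟩ ⟨y, by omega⟩
          rw [hF]
          simp only at h2
          omega
      have h2 := finrank_sup_add_cnt hX ⟨x, by omega⟩ ⟨y, by omega⟩
      -- A point of the larger orbit shows that the truncated subtraction in the bound is exact.
      obtain ⟨Y, hY⟩ := orbit_nonempty (k := k) D'
      have h3 := finrank_sup_add_cnt hY ⟨x, by omega⟩ ⟨y, by omega⟩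
      rw [hF] at h1
      simp only at h2 h3
      omega
  · by_contra hc
    obtain ⟨p, -, hx, hy⟩ := ideal_circled.1 hid
    let i : Fin (b.length + 1) := ⟨x, by omega⟩
    let j : Fin (c.length + 1) := ⟨y, by omega⟩
    -- Outside the ideal of Δ' the line adds nothing to B_i + C_j on the whole larger orbit, and
    -- this bound passes to `X`, where the line does add a dimension.
    have h1 := key True i j (b.sizeUpTo x + c.sizeUpTo y - cnt D'.M x y) fun Y hY => by
      have h2 := finrank_sup_add_cnt hY i j
      rw [hT, sup_eq_right.2 ((line_le_iff hY i j).2 hc)]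
      simp only [i, j] at h2 ⊢
      omega
    have h2 := finrank_sup_add_cnt hX i j
    have h3 : X.fst.space i ⊔ X.snd.space j <
        X.line.submodule ⊔ (X.fst.space i ⊔ X.snd.space j) := by
      refine lt_of_le_of_ne le_sup_right fun h4 => ?_
      exact (line_le_iff hX i j).1 (sup_eq_right.1 h4.symm) hid
    have h4 := Submodule.finrank_lt_finrank_of_lt h3
    rw [hT] at h1
    simp only [i, j] at h1 h2 h4
    omega

end LineTwoFlags

theorem mainTheorem2 (k : Type*) [Field k] [Infinite k] {n : ℕ} (b c : Composition n)
    (D D' : LineTwoFlags.DecoratedMatrix b c) :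
    LineTwoFlags.DegLE k D D' ↔ LineTwoFlags.MoveLE D D' :=
  ⟨fun h => h.rankLE.moveLE, fun h => h.degLE⟩
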